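/- **Setting.** Let $D\subset\mathbb R^2$ be a convex polygonal domain with $\partial D=\partial D_0\cup\partial D_1$ (disjoint, measurable), $\mathrm{meas}(\partial D_0)>0$ ($\partial D_1$ may be empty or of length zero). Put $V_D=\{v\in H^1(D)^2: v|_{\partial D_0}=0\}$, and let $\Sigma_D$ be the space of symmetric tensor fields in $L^2(D;\mathbb R^{2\times 2})$, with the additional condition $\int_D \mathrm{tr}\,\tau\,dx=0$ if $\mathrm{meas}(\partial D_1)=0$. Let $\nu\in(0,\tfrac12)$, $\lambda_0>0$, and $\mathbf C\varepsilon=\frac1{1+\nu}\varepsilon+\lambda_0(\mathrm{tr}\,\varepsilon) I$ (for plane strain $\lambda_0=\frac{\nu}{(1+\nu)(1-2\nu)}$, for plane stress $\lambda_0=\frac{\nu}{(1+\nu)(1-\nu)}$). *Spatial discretization.* Let $\mathcal T_h$ be a finite partition of $\overline D$ into nondegenerate convex quadrilaterals $T$ with vertices $A_1,\dots,A_4$ numbered counterclockwise, and let $F_T(\hat x_1,\hat x_2)=(a_0+a_1\hat x_1+a_2\hat x_1\hat x_2+a_3\hat x_2,\ b_0+b_1\hat x_1+b_2\hat x_1\hat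 x_2+b_3\hat x_2)$ be the isoparametric bilinear map of $[-1,1]^2$ onto $T$ that maps $(-1,-1),(1,-1),(1,1),(-1,1)$ to $A_1,A_2,A_3,A_4$; the vertices are numbered so that $a_1\ne0$, $b_3\neq 0$. Let $V_{Dh}$ be the set of $v\in V_D$ with $v|_T\circ F_T\in \mathrm{span}\{1,\hat x_1,\hat x_2,\hat x_1\hat x_2\}^2$ for all $T$, and let $\Sigma_{Dh}$ be the set of $\tau\in\Sigma_D$ such that on each $T$, for some $\beta\in\mathbb R^5$, $$\begin{pmatrix}\tau_{11}\\ \tau_{22}\\ \tau_{12}\end{pmatrix}\circ F_T=\begin{pmatrix}1&0&0&\hat x_2&\frac{a_3^2}{b_3^2}\hat x_1\\0&1&0&\frac{b_1^2}{a_1^2}\hat x_2&\hat x_1\\0&0&1&\frac{b_1}{a_1}\hat x_2&\frac{a_3}{b_3}\hat x_1\end{pmatrix}\beta .$$ *Stochastic discretization.* Let $\Gamma=\prod_{n=1}^N\Gamma_n$ with bounded $\Gamma_n\subset\mathbb R$, let $\rho\ge0$ be a bounded probability density on $\Gamma$, and let $\Gamma$ be partitioned, up to a null set, into finitely many disjoint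 boxes $\gamma=\prod_n(a_n^\gamma,b_n^\gamma)$ with $a_n^\gamma<b_n^\gamma$ and $(a_n^\gamma,b_n^\gamma)\subset\Gamma_n$. For $\mathbf q\in\mathbb N_0^N$ let $Y_{\mathbf k}^{\mathbf q}=\bigotimes_n Y_{k_n}^{q_n}$, where $Y_{k_n}^{q_n}$ is the set of functions on $\Gamma_n$ whose restriction to each $(a_n^\gamma,b_n^\gamma)$ is a polynomial of degree at most $q_n$. For a space $X$ of fields on $D$, $Y_{\mathbf k}^{\mathbf q}\otimes X=\mathrm{span}\{\varphi(\mathbf y)w(\mathbf x):\varphi\in Y_{\mathbf k}^{\mathbf q},\,w\in X\}$. *Data.* Let $\widetilde E_N:D\times\Gamma\to\mathbb R$ be measurable with $0<e'_{\min}\le \widetilde E_N\le e'_{\max}$ a.e. with respect to $dx\,\rho\,dy$, and let $\mathbf f_N$, $\mathbf g_N$ be square integrable $\mathbb R^2$-valued functions on $D\times\Gamma$ and $\partial D_1\times\Gamma$ with respect to $dx\,\rho\,dy$ and $ds\,\rho\,dy$ (for instance truncated Karhunen–Loève expansions). Put $$a_N(\sigma,\tau)=\int_\Gamma\rho\int_D\frac1{\widetilde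 E_N}\sigma:\mathbf C^{-1}\tau\,dx\,dy,\qquad b_N(\tau,v)=\int_\Gamma\rho\int_D\tau:\varepsilon(v)\,dx\,dy,$$ $$\ell_N(v)=\int_\Gamma\rho\int_D \mathbf f_N\cdot v\,dx\,dy+\int_\Gamma\rho\int_{\partial D_1}\mathbf g_N\cdot v\,ds\,dy.$$ **Theorem.** Assume that the mesh is stable for the Q1–P0 element: there is $C>0$ such that for every $w$ that is constant on each $T\in\mathcal T_h$ (with $\int_D w\,dx=0$ if $\mathrm{meas}(\partial D_1)=0$) there is $v\in V_{Dh}$ with $\|w\|_0^2\le C\int_D w\,\mathrm{div}\,v\,dx$ and $|v|_1^2\le C\|w\|_0^2$. Then there is a unique pair $(\sigma_{kh},u_{kh})\in (Y_{\mathbf k}^{\mathbf q}\otimes\Sigma_{Dh})\times(Y_{\mathbf k}^{\mathbf q}\otimes V_{Dh})$ with $$a_N(\sigma_{kh},\tau)-b_N(\tau,u_{kh})=0\quad\forall\,\tau\in Y_{\mathbf k}^{\mathbf q}\otimes\Sigma_{Dh},\qquad b_N(\sigma_{kh},v)=\ell_N(v)\quad\forall\, v\in Y_{\mathbf k}^{\mathbf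 q}\otimes V_{Dh},$$ where pairs that agree almost everywhere with respect to $\rho\,dy\,dx$ are identified, as elements of $L^2_\rho(\Gamma)\otimes\Sigma_D$ and $L^2_\rho(\Gamma)\otimes V_D$. -/

import Mathlib

open MeasureTheory
open scoped ContDiff

noncomputable section

namespace SHSFEM

/-- The physical plane `ℝ²` with the Euclidean norm. -/
abbrev Plane : Type := EuclideanSpace ℝ (Fin 2)

/-- Real `2 × 2` tensors. -/
abbrev Tensor : Type := Matrix (Fin 2) (Fin 2) ℝ

/-- The double contraction `σ : τ = ∑ i j, σ i j * τ i j`. -/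
def contract (σ τ : Tensor) : ℝ := ∑ i, ∑ j, σ i j * τ i j

/-! ### The elasticity tensor -/

/-- `ε ↦ 2 μ ε + lam (tr ε) I`. -/
def stiffness (μ lam : ℝ) (ε : Tensor) : Tensor :=
  (2 * μ) • ε + (lam * ε.trace) • (1 : Tensor)

/-- The inverse of `stiffness μ lam` in the plane,
`τ ↦ (1 / (2 μ)) (τ - lam / (2 μ + 2 lam) (tr τ) I)`. -/
def compliance (μ lam : ℝ) (τ : Tensor) : Tensor :=
  (1 / (2 * μ)) • (τ - (lam / (2 * μ + 2 * lam) * τ.trace) • (1 : Tensor))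

theorem stiffness_compliance {μ lam : ℝ} (hμ : 0 < μ) (hlam : 0 < lam) (τ : Tensor) :
    stiffness μ lam (compliance μ lam τ) = τ := by
  have h1 : 2 * μ ≠ 0 := by positivity
  have h2 : 2 * μ + 2 * lam ≠ 0 := by positivity
  have h3 : μ + lam ≠ 0 := by positivity
  ext i j
  fin_cases i <;> fin_cases j <;>
    simp [stiffness, compliance, Matrix.trace, Fin.sum_univ_two] <;> field_simp <;> ring

theorem compliance_stiffness {μ lam : ℝ} (hμ : 0 < μ) (hlam : 0 < lam) (ε : Tensor) :
    compliance μ lam (stiffness μ lam ε) = ε := by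
  have h1 : 2 * μ ≠ 0 := by positivity
  have h2 : 2 * μ + 2 * lam ≠ 0 := by positivity
  have h3 : μ + lam ≠ 0 := by positivity
  ext i j
  fin_cases i <;> fin_cases j <;>
    simp [stiffness, compliance, Matrix.trace, Fin.sum_univ_two] <;> field_simp <;> ring

/-! ### The spatial domain and `H¹` -/

/-- A convex polygonal domain `D` whose boundary is split into the part `D0`, of positive length,
where the displacement is prescribed, and the (possibly empty) traction part `D1`. -/
structure PolygonalDomain where
  D : Set Plane
  D0 : Set Plane
  D1 : Set Plane
  isOpen : IsOpen D
  convex : Convex ℝ D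
  polygon : ∃ s : Finset Plane, closure D = convexHull ℝ (s : Set Plane)
  boundary : frontier D = D0 ∪ D1
  disjoint : Disjoint D0 D1
  measurable_D0 : MeasurableSet D0
  measurable_D1 : MeasurableSet D1
  length_D0_pos : 0 < Measure.hausdorffMeasure (X := Plane) 1 D0

/-- `G x i j` is the weak derivative `∂ⱼ vᵢ` on `D`, and all these are in `L²(D)`. -/
def IsWeakGradient (D : Set Plane) (v : Plane → Plane) (G : Plane → Tensor) : Prop :=
  (∀ i j, MemLp (fun x => G x i j) 2 (volume.restrict D)) ∧
  ∀ (i j : Fin 2) (φ : Plane → ℝ), ContDiff ℝ ∞ φ → HasCompactSupport φ → tsupport φ ⊆ D →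
    ∫ x in D, v x i * fderiv ℝ φ x (EuclideanSpace.single j 1) = - ∫ x in D, G x i j * φ x

/-- `v ∈ H¹(D)²`. -/
def MemH1 (D : Set Plane) (v : Plane → Plane) : Prop :=
  MemLp v 2 (volume.restrict D) ∧ ∃ G, IsWeakGradient D v G

open Classical in
/-- The weak gradient of `v ∈ H¹(D)²` (determined almost everywhere on `D`). -/
def weakGradient (D : Set Plane) (v : Plane → Plane) : Plane → Tensor :=
  if h : ∃ G, IsWeakGradient D v G then h.choose else 0

/-- The strain `ε(v) = (∇v + ∇vᵀ) / 2`. -/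
def strain (D : Set Plane) (v : Plane → Plane) (x : Plane) : Tensor :=
  (1 / 2 : ℝ) • (weakGradient D v x + (weakGradient D v x).transpose)

/-- The divergence of `v`. -/
def divergence (D : Set Plane) (v : Plane → Plane) (x : Plane) : ℝ :=
  (weakGradient D v x).trace

/-- The squared seminorm `|v|₁²` on `H¹(D)²`. -/
def seminormH1Sq (D : Set Plane) (v : Plane → Plane) : ℝ :=
  ∫ x in D, contract (weakGradient D v x) (weakGradient D v x)

/-- The stress space: square integrable symmetric tensor fields, with mean value zero of the trace
if there is no traction boundary. -/
def StressSpace (P : PolygonalDomain) : Set (Plane → Tensor) :=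
  {τ | (∀ i j, MemLp (fun x => τ x i j) 2 (volume.restrict P.D)) ∧
    (∀ᵐ x ∂(volume.restrict P.D), (τ x).IsSymm) ∧
    (Measure.hausdorffMeasure (X := Plane) 1 P.D1 = 0 → ∫ x in P.D, (τ x).trace = 0)}

/-! ### Quadrilaterals and meshes -/

/-- `4` times the inverse of the matrix of nodal values of `1, s, s t, t`. -/
def nodalMatrix : Matrix (Fin 4) (Fin 4) ℝ :=
  !![1, 1, 1, 1; -1, 1, 1, -1; 1, -1, 1, -1; -1, -1, 1, 1]

/-- The coefficient vectors `(aₖ, bₖ)`, `k = 0, 1, 2, 3`, of the isoparametric bilinear map of the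
quadrilateral with vertices `A 0, A 1, A 2, A 3`. -/
def quadCoeff (A : Fin 4 → Plane) (k : Fin 4) : Plane :=
  (1 / 4 : ℝ) • ∑ j, nodalMatrix k j • A j

/-- The vector polynomial `c₀ + c₁ s + c₂ s t + c₃ t`. -/
def bilin (c : Fin 4 → Plane) (s t : ℝ) : Plane :=
  c 0 + s • c 1 + (s * t) • c 2 + t • c 3

/-- The isoparametric bilinear map, from the reference square `[-1, 1]²` onto the quadrilateral. -/
def quadMap (A : Fin 4 → Plane) (s t : ℝ) : Plane := bilin (quadCoeff A) s t

/-- Signed area of the parallelogram spanned by two vectors. -/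
def cross (p q : Plane) : ℝ := p 0 * q 1 - p 1 * q 0

/-- The closed quadrilateral with the given vertices. -/
def quad (A : Fin 4 → Plane) : Set Plane := convexHull ℝ (Set.range A)

/-- A finite partition of the closure of `D` into nondegenerate convex quadrilaterals, with vertices
numbered counterclockwise, and such that `a₁` and `b₃`, by which the stress
modes divide, do not vanish (every convex quadrilateral has such a numbering). -/
structure QuadMesh (D : Set Plane) where
  m : ℕ
  A : Fin m → Fin 4 → Plane
  convex : ∀ T (i : Fin 4), 0 < cross (A T (i + 1) - A T i) (A T (i + 2) - A T (i + 1))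
  a1_ne_zero : ∀ T, quadCoeff (A T) 1 0 ≠ 0
  b3_ne_zero : ∀ T, quadCoeff (A T) 3 1 ≠ 0
  cover : ⋃ T, quad (A T) = closure D
  disjoint : Pairwise fun T T' => Disjoint (interior (quad (A T))) (interior (quad (A T')))

/-- The five-parameter Pian-Sumihara stress mode, with `a k = (c k) 0` and `b k = (c k) 1`, at the
point `(s, t)` of the reference square. -/
def psMode (c : Fin 4 → Plane) (β : Fin 5 → ℝ) (s t : ℝ) : Tensor :=
  let a : Fin 4 → ℝ := fun k => c k 0
  let b : Fin 4 → ℝ := fun k => c k 1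
  let τ11 := β 0 + t * β 3 + (a 3 ^ 2 / b 3 ^ 2) * s * β 4
  let τ22 := β 1 + (b 1 ^ 2 / a 1 ^ 2) * t * β 3 + s * β 4
  let τ12 := β 2 + (b 1 / a 1) * t * β 3 + (a 3 / b 3) * s * β 4
  !![τ11, τ12; τ12, τ22]

/-- The Pian-Sumihara stress space. The form is prescribed inside the elements: a stress may jump
across the edges. -/
def StressSpaceH (P : PolygonalDomain) (M : QuadMesh P.D) : Set (Plane → Tensor) :=
  {τ | τ ∈ StressSpace P ∧ ∀ T, ∃ β : Fin 5 → ℝ,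
    ∀ s ∈ Set.Ioo (-1 : ℝ) 1, ∀ t ∈ Set.Ioo (-1 : ℝ) 1,
      τ (quadMap (M.A T) s t) = psMode (quadCoeff (M.A T)) β s t}

/-- The isoparametric bilinear displacement space: the `H¹` vector fields that vanish on `D0` and
are isoparametric bilinear on each element. Such a field is continuous on the closure of `D`; it is
represented by its continuous version, whose boundary values are its trace. -/
def DisplSpaceH (P : PolygonalDomain) (M : QuadMesh P.D) : Set (Plane → Plane) :=
  {v | MemH1 P.D v ∧ ContinuousOn v (closure P.D) ∧
    (∀ᵐ x ∂((Measure.hausdorffMeasure (X := Plane) 1).restrict P.D0), v x = 0) ∧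
    ∀ T, ∃ c : Fin 4 → Plane, ∀ s ∈ Set.Icc (-1 : ℝ) 1, ∀ t ∈ Set.Icc (-1 : ℝ) 1,
      v (quadMap (M.A T) s t) = bilin c s t}

/-- The mesh is stable for the Q1-P0 Stokes element: each piecewise constant `w` (of mean value zero
if there is no traction boundary) is controlled by the divergence of some discrete displacement. -/
def Q1P0Stable (P : PolygonalDomain) (M : QuadMesh P.D) : Prop :=
  ∃ C : ℝ, 0 < C ∧ ∀ w : Plane → ℝ,
    (∀ T, ∃ c : ℝ, ∀ x ∈ interior (quad (M.A T)), w x = c) →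
    (Measure.hausdorffMeasure (X := Plane) 1 P.D1 = 0 → ∫ x in P.D, w x = 0) →
    ∃ v ∈ DisplSpaceH P M,
      ∫ x in P.D, w x ^ 2 ≤ C * ∫ x in P.D, w x * divergence P.D v x ∧
      seminormH1Sq P.D v ≤ C * ∫ x in P.D, w x ^ 2

/-! ### The stochastic field -/

/-- The product set `Γ = ∏ Γₙ`. -/
def box {N : ℕ} (Γ : Fin N → Set ℝ) : Set (Fin N → ℝ) := Set.univ.pi Γ

/-- The measure `ρ dy` on `Γ`. -/
def rhoMeasure {N : ℕ} (Γ : Fin N → Set ℝ) (ρ : (Fin N → ℝ) → ℝ) : Measure (Fin N → ℝ) :=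
  (volume.restrict (box Γ)).withDensity fun y => ENNReal.ofReal (ρ y)

/-- A partition of `Γ` (up to a null set) into finitely many disjoint open boxes. -/
structure BoxPartition {N : ℕ} (Γ : Fin N → Set ℝ) where
  m : ℕ
  lo : Fin m → Fin N → ℝ
  hi : Fin m → Fin N → ℝ
  lo_lt_hi : ∀ γ n, lo γ n < hi γ n
  subset : ∀ γ n, Set.Ioo (lo γ n) (hi γ n) ⊆ Γ n
  disjoint : Pairwise fun γ γ' => Disjoint (box fun n => Set.Ioo (lo γ n) (hi γ n))
    (box fun n => Set.Ioo (lo γ' n) (hi γ' n))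
  cover : volume (box Γ \ ⋃ γ, box fun n => Set.Ioo (lo γ n) (hi γ n)) = 0

/-- The functions of the `n`-th variable that are polynomials of degree at most `q n` on the
`n`-th side of each box. Functions on `Γ n` are written as functions on `ℝ`, with irrelevant
values outside `Γ n`. -/
def Y1 {N : ℕ} {Γ : Fin N → Set ℝ} (K : BoxPartition Γ) (q : Fin N → ℕ) (n : Fin N) :
    Set (ℝ → ℝ) :=
  {φ | ∀ γ, ∃ p : Polynomial ℝ, p.natDegree ≤ q n ∧
    ∀ z ∈ Set.Ioo (K.lo γ n) (K.hi γ n), φ z = p.eval z}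

/-- The `k`-version tensor product space `Y_k^q`. -/
def Y {N : ℕ} {Γ : Fin N → Set ℝ} (K : BoxPartition Γ) (q : Fin N → ℕ) :
    Submodule ℝ ((Fin N → ℝ) → ℝ) :=
  Submodule.span ℝ {f | ∃ φ : Fin N → ℝ → ℝ, (∀ n, φ n ∈ Y1 K q n) ∧ f = fun y => ∏ n, φ n (y n)}

/-- `Y_k^q ⊗ X = span {φ(y) w(x)}` for a space `X` of fields on the plane. -/
def tensorSpace {N : ℕ} {Γ : Fin N → Set ℝ} (K : BoxPartition Γ) (q : Fin N → ℕ)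
    {V : Type} [AddCommGroup V] [Module ℝ V] (X : Set (Plane → V)) :
    Submodule ℝ ((Fin N → ℝ) → Plane → V) :=
  Submodule.span ℝ {F | ∃ φ ∈ Y K q, ∃ w ∈ X, F = fun y x => φ y • w x}

/-! ### The forms and the discrete problem -/

/-- `∫_Γ ρ ∫_D (1 / E_N) σ : C⁻¹ τ dx dy`. -/
def aForm (P : PolygonalDomain) (μ lam : ℝ) {N : ℕ} (Γ : Fin N → Set ℝ) (ρ : (Fin N → ℝ) → ℝ)
    (EN : Plane → (Fin N → ℝ) → ℝ) (σ τ : (Fin N → ℝ) → Plane → Tensor) : ℝ :=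
  ∫ y in box Γ, ρ y * ∫ x in P.D, 1 / EN x y * contract (σ y x) (compliance μ lam (τ y x))

/-- `∫_Γ ρ ∫_D τ : ε(u) dx dy`. -/
def bForm (P : PolygonalDomain) {N : ℕ} (Γ : Fin N → Set ℝ) (ρ : (Fin N → ℝ) → ℝ)
    (τ : (Fin N → ℝ) → Plane → Tensor) (u : (Fin N → ℝ) → Plane → Plane) : ℝ :=
  ∫ y in box Γ, ρ y * ∫ x in P.D, contract (τ y x) (strain P.D (u y) x)

/-- `∫_Γ ρ ∫_D f · v dx dy + ∫_Γ ρ ∫_{D1} g · v ds dy`. -/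
def loadForm (P : PolygonalDomain) {N : ℕ} (Γ : Fin N → Set ℝ) (ρ : (Fin N → ℝ) → ℝ)
    (fN gN : Plane → (Fin N → ℝ) → Plane) (v : (Fin N → ℝ) → Plane → Plane) : ℝ :=
  (∫ y in box Γ, ρ y * ∫ x in P.D, inner ℝ (fN x y) (v y x)) +
  ∫ y in box Γ, ρ y * ∫ x in P.D1, inner ℝ (gN x y) (v y x) ∂(Measure.hausdorffMeasure 1)

/-- `(σ, u)` solves the `k × h` discrete mixed problem. -/
def IsDiscreteSolution (P : PolygonalDomain) (M : QuadMesh P.D) (μ lam : ℝ) {N : ℕ}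
    {Γ : Fin N → Set ℝ} (K : BoxPartition Γ) (q : Fin N → ℕ) (ρ : (Fin N → ℝ) → ℝ)
    (EN : Plane → (Fin N → ℝ) → ℝ) (fN gN : Plane → (Fin N → ℝ) → Plane)
    (σ : (Fin N → ℝ) → Plane → Tensor) (u : (Fin N → ℝ) → Plane → Plane) : Prop :=
  σ ∈ tensorSpace K q (StressSpaceH P M) ∧ u ∈ tensorSpace K q (DisplSpaceH P M) ∧
  (∀ τ ∈ tensorSpace K q (StressSpaceH P M),
    aForm P μ lam Γ ρ EN σ τ - bForm P Γ ρ τ u = 0) ∧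
  (∀ v ∈ tensorSpace K q (DisplSpaceH P M), bForm P Γ ρ σ v = loadForm P Γ ρ fN gN v)

end SHSFEM

end

noncomputable section

namespace SHSFEM

/-! ### The isoparametric bilinear map -/

/-! Modulo null fields both discrete spaces are finite-dimensional, so the mixed problem is a square
linear system and it is enough that zero loads force a null solution (`exists_saddle`). Testing the
first equation with `σ` itself gives `a(σ, σ) = b(σ, u) = 0`, and the compliance is coercive
(`contract_self_le`), so `σ` is null. There remains the nondegeneracy of `b`: if `b(τ, u) = 0` for
all `τ`, then `u` is null.

The stochastic variable is removed first. For a fixed spatial stress `τ` the function `c(y) = ∫_D τ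
: ε(u(y))` lies in `Y_k^q`, so `c ⊗ τ` is a legitimate test stress and yields `∫ ρ c² = 0`
(`ae_strainEnergy_eq_zero`). As finitely many `τ` span, almost every slice `v = u(y)` is orthogonal
to all Pian-Sumihara stresses at once.

The spatial claim is `eq_zero_of_forall_integral_strain_eq_zero`. Stresses on different elements are
coupled only by the mean value of the trace, which is the energy against the gradient of the
identity; hence for some multiplier `μ` the field `z = v - μ x` is orthogonal to each mode on each
element separately. Up to translation a bilinear field has six parameters, and the five modes leave
only the infinitesimal rotation (`exists_rigid_of_modeEnergy_eq`), so `z` is rigid on each element.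

The pieces are glued without any combinatorics of edges. Along a segment, the component of a rigid
motion in the direction of the segment is constant; for the continuous `z` it takes finitely many
values, hence one, so `(z x - z y) · (x - y) = 0` on the convex set `closure D`
(`inner_eq_of_piecewise_rigid`). This forces `z` to be one rigid motion (`eq_rigid_of_inner_eq`).
Thus `v` has linear part `μ I + k J`, with `J` the rotation by a right angle, which is zero or
invertible; `v` vanishes at two distinct points of `D0`, so `v = 0`. -/

/-- `bilin c` as a map of the plane. -/
def refMap (c : Fin 4 → Plane) (p : Plane) : Plane := bilin c (p 0) (p 1)

/-- The derivative of `refMap c`. -/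
def refDeriv (c : Fin 4 → Plane) (p : Plane) : Plane →L[ℝ] Plane :=
  (EuclideanSpace.proj (𝕜 := ℝ) (0 : Fin 2)).smulRight (c 1 + p 1 • c 2) +
    (EuclideanSpace.proj (𝕜 := ℝ) (1 : Fin 2)).smulRight (c 3 + p 0 • c 2)

/-- The Jacobian determinant of `bilin c`. -/
def jac (c : Fin 4 → Plane) (s t : ℝ) : ℝ := cross (c 1 + t • c 2) (c 3 + s • c 2)

/-- The open reference square. -/
def refSquare : Set Plane := {p | ∀ i, p i ∈ Set.Ioo (-1 : ℝ) 1}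

/-- The closed reference square. -/
def refSquareClosed : Set Plane := {p | ∀ i, p i ∈ Set.Icc (-1 : ℝ) 1}

theorem refDeriv_apply (c : Fin 4 → Plane) (p h : Plane) :
    refDeriv c p h = h 0 • (c 1 + p 1 • c 2) + h 1 • (c 3 + p 0 • c 2) := by
  simp [refDeriv]

theorem hasStrictFDerivAt_refMap (c : Fin 4 → Plane) (p : Plane) :
    HasStrictFDerivAt (refMap c) (refDeriv c p) p := by
  have h0 : HasStrictFDerivAt (fun p : Plane => p 0) (EuclideanSpace.proj (𝕜 := ℝ) (0 : Fin 2)) p :=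
    (EuclideanSpace.proj (𝕜 := ℝ) (0 : Fin 2)).hasStrictFDerivAt
  have h1 : HasStrictFDerivAt (fun p : Plane => p 1) (EuclideanSpace.proj (𝕜 := ℝ) (1 : Fin 2)) p :=
    (EuclideanSpace.proj (𝕜 := ℝ) (1 : Fin 2)).hasStrictFDerivAt
  have := (((h0.smul_const (c 1)).const_add (c 0)).add ((h0.mul h1).smul_const (c 2))).add
    (h1.smul_const (c 3))
  refine (HasStrictFDerivAt.congr_fderiv this ?_)
  ext h i
  simp [refDeriv]
  ring

theorem hasFDerivAt_refMap (c : Fin 4 → Plane) (p : Plane) :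
    HasFDerivAt (refMap c) (refDeriv c p) p := (hasStrictFDerivAt_refMap c p).hasFDerivAt

theorem det_refDeriv (c : Fin 4 → Plane) (p : Plane) :
    (refDeriv c p).det = jac c (p 0) (p 1) := by
  rw [ContinuousLinearMap.det, ← LinearMap.det_toMatrix (EuclideanSpace.basisFun (Fin 2) ℝ).toBasis,
    Matrix.det_fin_two]
  simp [LinearMap.toMatrix_apply, refDeriv_apply, jac, cross]
  ring

/-- The Jacobian is the bilinear interpolant of its values at the corners, and each of these is a
quarter of the cross product of the two edges that meet there. -/
theorem jac_quadCoeff_pos {A : Fin 4 → Plane}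
    (hA : ∀ i : Fin 4, 0 < cross (A (i + 1) - A i) (A (i + 2) - A (i + 1)))
    {s t : ℝ} (hs : s ∈ Set.Icc (-1 : ℝ) 1) (ht : t ∈ Set.Icc (-1 : ℝ) 1) :
    0 < jac (quadCoeff A) s t := by
  have h0 := hA 0
  have h1 := hA 1
  have h2 := hA 2
  have h3 := hA 3
  have e : jac (quadCoeff A) s t = 1 / 16 * (
      ((1 - s) * (1 - t)) * cross (A (3 + 1) - A 3) (A (3 + 2) - A (3 + 1)) +
      ((1 + s) * (1 - t)) * cross (A (0 + 1) - A 0) (A (0 + 2) - A (0 + 1)) +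
      ((1 + s) * (1 + t)) * cross (A (1 + 1) - A 1) (A (1 + 2) - A (1 + 1)) +
      ((1 - s) * (1 + t)) * cross (A (2 + 1) - A 2) (A (2 + 2) - A (2 + 1))) := by
    have e1 : (3 + 1 : Fin 4) = 0 := rfl
    have e2 : (3 + 2 : Fin 4) = 1 := rfl
    have e3 : (2 + 1 : Fin 4) = 3 := rfl
    have e4 : (2 + 2 : Fin 4) = 0 := rfl
    have e5 : (1 + 2 : Fin 4) = 3 := rfl
    have e6 : (1 + 1 : Fin 4) = 2 := rfl
    rw [e1, e2, e3, e4, e5, e6]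
    simp [jac, cross, quadCoeff, nodalMatrix, Fin.sum_univ_four]
    ring
  rw [e]
  obtain ⟨hs1, hs2⟩ := hs
  obtain ⟨ht1, ht2⟩ := ht
  -- Individual weights may vanish on the boundary of the square, but they sum to 4, so the smallest
  -- corner value bounds the interpolant below.
  set m := min (min (cross (A (3 + 1) - A 3) (A (3 + 2) - A (3 + 1)))
    (cross (A (0 + 1) - A 0) (A (0 + 2) - A (0 + 1))))
    (min (cross (A (1 + 1) - A 1) (A (1 + 2) - A (1 + 1)))
    (cross (A (2 + 1) - A 2) (A (2 + 2) - A (2 + 1)))) with hm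
  have hmp : 0 < m := lt_min (lt_min h3 h0) (lt_min h1 h2)
  have a1 : m ≤ cross (A (3 + 1) - A 3) (A (3 + 2) - A (3 + 1)) :=
    (min_le_left _ _).trans (min_le_left _ _)
  have a2 : m ≤ cross (A (0 + 1) - A 0) (A (0 + 2) - A (0 + 1)) :=
    (min_le_left _ _).trans (min_le_right _ _)
  have a3 : m ≤ cross (A (1 + 1) - A 1) (A (1 + 2) - A (1 + 1)) :=
    (min_le_right _ _).trans (min_le_left _ _)
  have a4 : m ≤ cross (A (2 + 1) - A 2) (A (2 + 2) - A (2 + 1)) :=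
    (min_le_right _ _).trans (min_le_right _ _)
  have b1 := mul_le_mul_of_nonneg_left a1
    (mul_nonneg (sub_nonneg.2 hs2) (sub_nonneg.2 ht2))
  have b2 := mul_le_mul_of_nonneg_left a2
    (mul_nonneg (by linarith : 0 ≤ 1 + s) (sub_nonneg.2 ht2))
  have b3 := mul_le_mul_of_nonneg_left a3
    (mul_nonneg (by linarith : 0 ≤ 1 + s) (by linarith : 0 ≤ 1 + t))
  have b4 := mul_le_mul_of_nonneg_left a4
    (mul_nonneg (sub_nonneg.2 hs2) (by linarith : 0 ≤ 1 + t))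
  linarith

theorem eq_zero_of_cross_ne_zero {p q : Plane} (h : cross p q ≠ 0) {x y : ℝ}
    (e : x • p + y • q = 0) : x = 0 ∧ y = 0 := by
  have e0 := congrArg (fun v : Plane => v 0) e
  have e1 := congrArg (fun v : Plane => v 1) e
  simp at e0 e1
  constructor
  · apply (mul_eq_zero.1 (_ : x * cross p q = 0)).resolve_right h
    simp only [cross]; linear_combination q 1 * e0 - q 0 * e1
  · apply (mul_eq_zero.1 (_ : y * cross p q = 0)).resolve_right h
    simp only [cross]; linear_combination p 0 * e1 - p 1 * e0

/-- For a bilinear map the difference of two values is exactly the derivative at the midpoint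
applied to the difference of the arguments, and the midpoint stays in the square, where the Jacobian
is positive. -/
theorem injOn_refMap {A : Fin 4 → Plane}
    (hA : ∀ i : Fin 4, 0 < cross (A (i + 1) - A i) (A (i + 2) - A (i + 1))) :
    Set.InjOn (refMap (quadCoeff A)) refSquareClosed := by
  intro p hp p' hp' h
  set c := quadCoeff A
  have hj : 0 < jac c ((p 0 + p' 0) / 2) ((p 1 + p' 1) / 2) := by
    have := hp 0; have := hp 1; have := hp' 0; have := hp' 1
    simp only [Set.mem_Icc] at *
    apply jac_quadCoeff_pos hA <;> constructor <;> linarith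
  have e : (p 0 - p' 0) • (c 1 + ((p 1 + p' 1) / 2) • c 2) +
      (p 1 - p' 1) • (c 3 + ((p 0 + p' 0) / 2) • c 2) = 0 := by
    rw [← sub_eq_zero] at h
    rw [← h]
    ext i
    simp [refMap, bilin]
    ring
  obtain ⟨h0, h1⟩ := eq_zero_of_cross_ne_zero hj.ne' e
  ext i
  fin_cases i
  · exact sub_eq_zero.1 h0
  · exact sub_eq_zero.1 h1

theorem refSquare_subset_closed : refSquare ⊆ refSquareClosed :=
  fun _ hp i => Set.Ioo_subset_Icc_self (hp i)

theorem isOpen_refSquare : IsOpen refSquare := by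
  have : refSquare = ⋂ i : Fin 2, (fun p : Plane => p i) ⁻¹' Set.Ioo (-1 : ℝ) 1 := by
    ext p; simp [refSquare]
  rw [this]
  exact isOpen_iInter_of_finite fun i => isOpen_Ioo.preimage (by fun_prop)

theorem quadMap_mem_quad (A : Fin 4 → Plane) {s t : ℝ} (hs : s ∈ Set.Icc (-1 : ℝ) 1)
    (ht : t ∈ Set.Icc (-1 : ℝ) 1) : quadMap A s t ∈ quad A := by
  obtain ⟨hs1, hs2⟩ := hs
  obtain ⟨ht1, ht2⟩ := ht
  have e : quadMap A s t = ∑ j, (![(1 - s) * (1 - t) / 4, (1 + s) * (1 - t) / 4,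
      (1 + s) * (1 + t) / 4, (1 - s) * (1 + t) / 4] : Fin 4 → ℝ) j • A j := by
    ext i
    simp [quadMap, bilin, quadCoeff, nodalMatrix, Fin.sum_univ_four]
    ring
  rw [e]
  have h1 : 0 ≤ 1 - s := by linarith
  have h2 : 0 ≤ 1 + s := by linarith
  have h3 : 0 ≤ 1 - t := by linarith
  have h4 : 0 ≤ 1 + t := by linarith
  apply (convex_convexHull ℝ (Set.range A)).sum_mem
  · intro j _
    fin_cases j <;> simp <;> positivity
  · simp [Fin.sum_univ_four]; ring
  · intro j _; exact subset_convexHull _ _ ⟨j, rfl⟩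

/-- A half-plane is convex, so only the vertices matter: two lie on the edge line, and the other two
are handled by the turning conditions at the two ends of the edge. -/
theorem cross_nonneg_of_mem_quad {A : Fin 4 → Plane}
    (hA : ∀ i : Fin 4, 0 < cross (A (i + 1) - A i) (A (i + 2) - A (i + 1)))
    {x : Plane} (hx : x ∈ quad A) (i : Fin 4) : 0 ≤ cross (A (i + 1) - A i) (x - A i) := by
  have hc : Convex ℝ {x : Plane | 0 ≤ cross (A (i + 1) - A i) (x - A i)} := by
    intro y hy z hz a b ha hb hab
    simp only [Set.mem_ofPred_eq] at *
    have : cross (A (i + 1) - A i) (a • y + b • z - A i) =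
        a * cross (A (i + 1) - A i) (y - A i) + b * cross (A (i + 1) - A i) (z - A i) := by
      simp [cross]
      obtain rfl : b = 1 - a := by linarith
      ring
    rw [this]; positivity
  refine convexHull_min ?_ hc hx
  rintro _ ⟨j, rfl⟩
  simp only [Set.mem_ofPred_eq]
  obtain ⟨k, rfl⟩ : ∃ k, j = i + k := ⟨j - i, by abel⟩
  have h1 := hA i
  have h2 := hA (i + 3)
  rw [show i + 3 + 1 = i by rw [add_assoc]; exact add_zero i,
    show i + 3 + 2 = i + 1 by rw [add_assoc]; rfl] at h2
  fin_cases k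
  · simp [cross]
  · simp [cross]; linarith
  · simp [cross] at *; linarith
  · simp [cross] at *; linarith

/-- The segments from `L t` on the side `A 3 A 0` to `R t` on the side `A 1 A 2` sweep the
quadrilateral from its bottom edge to its top edge. The signed area `g t` that decides on which side
of the segment `x` lies changes sign, so some segment line passes through `x`; the half-planes of
the two lateral sides then put `x` between `L t` and `R t`. -/
theorem quad_subset_image {A : Fin 4 → Plane}
    (hA : ∀ i : Fin 4, 0 < cross (A (i + 1) - A i) (A (i + 2) - A (i + 1))) :
    quad A ⊆ refMap (quadCoeff A) '' refSquareClosed := by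
  intro x hx
  set L : ℝ → Plane := fun t => (1 / 2 : ℝ) • ((1 - t) • A 0 + (1 + t) • A 3) with hL
  set R : ℝ → Plane := fun t => (1 / 2 : ℝ) • ((1 - t) • A 1 + (1 + t) • A 2) with hR
  set g : ℝ → ℝ := fun t => cross (R t - L t) (x - L t) with hg
  have hgc : Continuous g := by simp only [hg, cross, hL, hR]; fun_prop
  have c0 := cross_nonneg_of_mem_quad hA hx 0
  have c1 := cross_nonneg_of_mem_quad hA hx 1
  have c2 := cross_nonneg_of_mem_quad hA hx 2
  have c3 := cross_nonneg_of_mem_quad hA hx 3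
  have h0 := hA 0
  have h1 := hA 1
  have h2 := hA 2
  have h3 := hA 3
  simp only [show (3 + 1 : Fin 4) = 0 from rfl, show (3 + 2 : Fin 4) = 1 from rfl,
    show (2 + 1 : Fin 4) = 3 from rfl, show (2 + 2 : Fin 4) = 0 from rfl,
    show (1 + 2 : Fin 4) = 3 from rfl, show (1 + 1 : Fin 4) = 2 from rfl,
    zero_add] at c0 c1 c2 c3 h0 h1 h2 h3
  have hgm : 0 ≤ g (-1) := by
    simp [hg, hL, hR, cross] at c0 ⊢; linarith
  have hgp : g 1 ≤ 0 := by
    simp [hg, hL, hR, cross] at c2 ⊢; linarith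
  obtain ⟨t, ht, hgt⟩ : ∃ t ∈ Set.Icc (-1 : ℝ) 1, g t = 0 :=
    intermediate_value_Icc' (by norm_num) hgc.continuousOn ⟨hgp, hgm⟩
  obtain ⟨ht1, ht2⟩ := ht
  have p1 : 0 < cross (A 0 - A 3) (R t - L t) := by
    have : cross (A 0 - A 3) (R t - L t) =
        1 / 2 * ((1 - t) * cross (A 0 - A 3) (A 1 - A 0) +
          (1 + t) * cross (A 3 - A 2) (A 0 - A 3)) := by
      simp [cross, hL, hR]; ring
    rw [this]
    rcases eq_or_lt_of_le ht2 with h | h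
    · rw [h]; linarith
    · have := mul_pos (sub_pos.2 h) h3
      have := mul_nonneg (by linarith : 0 ≤ 1 + t) h2.le
      linarith
  have p2 : 0 < cross (R t - L t) (A 2 - A 1) := by
    have : cross (R t - L t) (A 2 - A 1) =
        1 / 2 * ((1 - t) * cross (A 1 - A 0) (A 2 - A 1) +
          (1 + t) * cross (A 2 - A 1) (A 3 - A 2)) := by
      simp [cross, hL, hR]; ring
    rw [this]
    rcases eq_or_lt_of_le ht2 with h | h
    · rw [h]; linarith
    · have := mul_pos (sub_pos.2 h) h0
      have := mul_nonneg (by linarith : 0 ≤ 1 + t) h1.le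
      linarith
  -- The position of `x` along the segment, read off as the ratio of the distances of `x` and `R t`
  -- from the line `A 3 A 0`, which contains `L t`. The reference coordinate is then `2 r - 1`.
  set r : ℝ := cross (A 0 - A 3) (x - L t) / cross (A 0 - A 3) (R t - L t) with hr
  have hxe : x = L t + r • (R t - L t) := by
    have key : ∀ i, (x - L t) i * cross (A 0 - A 3) (R t - L t) =
        cross (A 0 - A 3) (x - L t) * (R t - L t) i := by
      have hgt' : cross (R t - L t) (x - L t) = 0 := hgt
      simp only [cross] at hgt' ⊢
      intro i
      fin_cases i
      · simp only [Fin.zero_eta]; linear_combination -(A 0 - A 3) 0 * hgt'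
      · simp only [Fin.mk_one]; linear_combination -(A 0 - A 3) 1 * hgt'
    ext i
    have := key i
    have : (x - L t) i = r * (R t - L t) i := by
      rw [hr, div_mul_eq_mul_div, eq_div_iff p1.ne', this]
    rw [PiLp.sub_apply] at this
    simp only [PiLp.add_apply, PiLp.smul_apply, smul_eq_mul]
    linarith
  have hr0 : 0 ≤ r := by
    apply div_nonneg _ p1.le
    have : cross (A 0 - A 3) (x - L t) = cross (A 0 - A 3) (x - A 3) := by
      simp [cross, hL]; ring
    rw [this]; exact c3
  have hr1 : r ≤ 1 := by
    have e : cross (A 2 - A 1) (x - A 1) = (1 - r) * cross (R t - L t) (A 2 - A 1) := by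
      have : cross (A 2 - A 1) (x - A 1) = cross (A 2 - A 1) (x - R t) := by
        simp [cross, hR]; ring
      rw [this]
      conv_lhs => rw [hxe]
      simp [cross]; ring
    rw [e] at c1
    have := nonneg_of_mul_nonneg_left c1 p2
    linarith
  refine ⟨!₂[2 * r - 1, t], ?_, ?_⟩
  · intro i
    fin_cases i
    · simp; constructor <;> linarith
    · exact ⟨ht1, ht2⟩
  · rw [hxe]
    ext i
    simp [refMap, bilin, quadCoeff, nodalMatrix, Fin.sum_univ_four, hL, hR]
    ring

theorem refMap_image_closed {A : Fin 4 → Plane}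
    (hA : ∀ i : Fin 4, 0 < cross (A (i + 1) - A i) (A (i + 2) - A (i + 1))) :
    refMap (quadCoeff A) '' refSquareClosed = quad A := by
  refine Set.Subset.antisymm ?_ (quad_subset_image hA)
  rintro _ ⟨p, hp, rfl⟩
  exact quadMap_mem_quad A (hp 0) (hp 1)

/-- The open quadrilateral, as the image of the open reference square. -/
def elem (A : Fin 4 → Plane) : Set Plane := refMap (quadCoeff A) '' refSquare

theorem elem_subset_quad (A : Fin 4 → Plane) : elem A ⊆ quad A := by
  rintro _ ⟨p, hp, rfl⟩
  exact quadMap_mem_quad A (refSquare_subset_closed hp 0) (refSquare_subset_closed hp 1)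

/-- The derivative of `refMap`, as an equivalence where the Jacobian does not vanish. -/
def refEquiv (c : Fin 4 → Plane) (p : Plane) (h : jac c (p 0) (p 1) ≠ 0) : Plane ≃L[ℝ] Plane :=
  (refDeriv c p).toContinuousLinearEquivOfDetNeZero (by rwa [det_refDeriv])

theorem coe_refEquiv (c : Fin 4 → Plane) (p : Plane) (h : jac c (p 0) (p 1) ≠ 0) :
    (refEquiv c p h : Plane →L[ℝ] Plane) = refDeriv c p := by
  ext1 x; rfl

theorem jac_ne_zero_of_mem {A : Fin 4 → Plane}
    (hA : ∀ i : Fin 4, 0 < cross (A (i + 1) - A i) (A (i + 2) - A (i + 1)))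
    {p : Plane} (hp : p ∈ refSquare) : jac (quadCoeff A) (p 0) (p 1) ≠ 0 :=
  (jac_quadCoeff_pos hA (refSquare_subset_closed hp 0) (refSquare_subset_closed hp 1)).ne'

/-- The inverse function theorem: at each point of the open square the strict derivative is
invertible, so neighbourhoods are mapped onto neighbourhoods. -/
theorem isOpen_elem {A : Fin 4 → Plane}
    (hA : ∀ i : Fin 4, 0 < cross (A (i + 1) - A i) (A (i + 2) - A (i + 1))) :
    IsOpen (elem A) := by
  rw [isOpen_iff_mem_nhds]
  rintro _ ⟨p, hp, rfl⟩
  have hj := jac_ne_zero_of_mem hA hp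
  have h := hasStrictFDerivAt_refMap (quadCoeff A) p
  rw [← coe_refEquiv _ _ hj] at h
  rw [← h.map_nhds_eq_of_equiv]
  exact Filter.image_mem_map (isOpen_refSquare.mem_nhds hp)

theorem elem_subset_interior {A : Fin 4 → Plane}
    (hA : ∀ i : Fin 4, 0 < cross (A (i + 1) - A i) (A (i + 2) - A (i + 1))) :
    elem A ⊆ interior (quad A) := interior_maximal (elem_subset_quad A) (isOpen_elem hA)

/-- The inverse of the isoparametric bilinear map on the open quadrilateral. -/
def refInv (A : Fin 4 → Plane) : Plane → Plane := Function.invFunOn (refMap (quadCoeff A)) refSquare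

theorem refInv_mem {A : Fin 4 → Plane} {x : Plane} (hx : x ∈ elem A) : refInv A x ∈ refSquare :=
  Function.invFunOn_mem hx

theorem refMap_refInv {A : Fin 4 → Plane} {x : Plane} (hx : x ∈ elem A) :
    refMap (quadCoeff A) (refInv A x) = x :=
  Function.invFunOn_eq hx

theorem refInv_refMap {A : Fin 4 → Plane}
    (hA : ∀ i : Fin 4, 0 < cross (A (i + 1) - A i) (A (i + 2) - A (i + 1)))
    {p : Plane} (hp : p ∈ refSquare) : refInv A (refMap (quadCoeff A) p) = p :=
  ((injOn_refMap hA).mono refSquare_subset_closed).leftInvOn_invFunOn hp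

theorem hasStrictFDerivAt_refInv {A : Fin 4 → Plane}
    (hA : ∀ i : Fin 4, 0 < cross (A (i + 1) - A i) (A (i + 2) - A (i + 1)))
    {p : Plane} (hp : p ∈ refSquare) :
    HasStrictFDerivAt (refInv A)
      ((refEquiv (quadCoeff A) p (jac_ne_zero_of_mem hA hp)).symm : Plane →L[ℝ] Plane)
      (refMap (quadCoeff A) p) := by
  have h := hasStrictFDerivAt_refMap (quadCoeff A) p
  rw [← coe_refEquiv _ _ (jac_ne_zero_of_mem hA hp)] at h
  refine h.to_local_left_inverse ?_
  filter_upwards [isOpen_refSquare.mem_nhds hp] with x hx using refInv_refMap hA hx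

theorem continuousOn_refInv {A : Fin 4 → Plane}
    (hA : ∀ i : Fin 4, 0 < cross (A (i + 1) - A i) (A (i + 2) - A (i + 1))) :
    ContinuousOn (refInv A) (elem A) := by
  rintro _ ⟨p, hp, rfl⟩
  exact (hasStrictFDerivAt_refInv hA hp).hasFDerivAt.continuousAt.continuousWithinAt

/-! ### Integration over the reference square and over an element. -/

/-- The plane as a product, preserving the measure. -/
def planeProd : Plane ≃ᵐ ℝ × ℝ :=
  (MeasurableEquiv.toLp 2 (Fin 2 → ℝ)).symm.trans MeasurableEquiv.finTwoArrow

theorem planeProd_apply (p : Plane) : planeProd p = (p 0, p 1) := rfl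

theorem measurePreserving_planeProd : MeasurePreserving planeProd :=
  (volume_preserving_finTwoArrow ℝ).comp (EuclideanSpace.volume_preserving_symm_measurableEquiv_toLp (Fin 2))

theorem refSquare_eq_preimage :
    refSquare = planeProd ⁻¹' (Set.Ioo (-1 : ℝ) 1 ×ˢ Set.Ioo (-1 : ℝ) 1) := by
  ext p
  simp [refSquare, planeProd_apply, Fin.forall_fin_two]

theorem refSquareClosed_eq_preimage :
    refSquareClosed = planeProd ⁻¹' (Set.Icc (-1 : ℝ) 1 ×ˢ Set.Icc (-1 : ℝ) 1) := by
  ext p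
  simp only [refSquareClosed, Set.mem_ofPred_eq, Fin.forall_fin_two, Set.mem_preimage, planeProd_apply,
    Set.mem_prod]

theorem volume_refSquareClosed_diff : volume (refSquareClosed \ refSquare) = 0 := by
  rw [refSquare_eq_preimage, refSquareClosed_eq_preimage, ← Set.preimage_sdiff,
    measurePreserving_planeProd.measure_preimage_equiv]
  have h : (Set.Ioo (-1 : ℝ) 1 ×ˢ Set.Ioo (-1 : ℝ) 1 : Set (ℝ × ℝ)) =ᵐ[volume]
      (Set.Icc (-1 : ℝ) 1 ×ˢ Set.Icc (-1 : ℝ) 1 : Set (ℝ × ℝ)) :=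
    Measure.set_prod_ae_eq Ioo_ae_eq_Icc Ioo_ae_eq_Icc
  exact ae_le_set.1 h.symm.le

theorem setIntegral_refSquare (f : ℝ → ℝ → ℝ)
    (hf : Continuous fun p : ℝ × ℝ => f p.1 p.2) :
    ∫ p in refSquare, f (p 0) (p 1) = ∫ s in (-1 : ℝ)..1, ∫ t in (-1 : ℝ)..1, f s t := by
  have h := measurePreserving_planeProd.setIntegral_preimage_emb planeProd.measurableEmbedding
    (fun p : ℝ × ℝ => f p.1 p.2) (Set.Ioo (-1 : ℝ) 1 ×ˢ Set.Ioo (-1 : ℝ) 1)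
  rw [← refSquare_eq_preimage] at h
  simp only [planeProd_apply] at h
  have hi : IntegrableOn (fun p : ℝ × ℝ => f p.1 p.2)
      (Set.Ioo (-1 : ℝ) 1 ×ˢ Set.Ioo (-1 : ℝ) 1) (volume.prod volume) :=
    (hf.continuousOn.integrableOn_compact (isCompact_Icc.prod isCompact_Icc)).mono_set
      (Set.prod_mono Set.Ioo_subset_Icc_self Set.Ioo_subset_Icc_self)
  rw [h, Measure.volume_eq_prod, setIntegral_prod _ hi]
  simp only [intervalIntegral.integral_of_le (show (-1 : ℝ) ≤ 1 by norm_num), integral_Ioc_eq_integral_Ioo]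

theorem intervalIntegral_quadratic (a b c : ℝ) :
    ∫ x in (-1 : ℝ)..1, (a + b * x + c * x ^ 2) = 2 * a + 2 / 3 * c := by
  rw [intervalIntegral.integral_add (Continuous.intervalIntegrable (by fun_prop) _ _)
    (Continuous.intervalIntegrable (by fun_prop) _ _),
    intervalIntegral.integral_add (Continuous.intervalIntegrable (by fun_prop) _ _)
    (Continuous.intervalIntegrable (by fun_prop) _ _)]
  have h1 : ∫ x in (-1 : ℝ)..1, b * x = b * ∫ x in (-1 : ℝ)..1, x :=
    intervalIntegral.integral_const_mul b _
  rw [h1, integral_id]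
  simp only [intervalIntegral.integral_const_mul, intervalIntegral.integral_const, integral_pow]
  norm_num
  ring

/-- By parity, an affine function tested with `1`, `s` or `t` retains only its coefficient of the
same monomial. This and the next two facts evaluate all energies below. -/
theorem integral_affine_refSquare (α β γ : ℝ) :
    ∫ p in refSquare, (α + β * p 0 + γ * p 1) = 4 * α := by
  rw [setIntegral_refSquare (fun s t => α + β * s + γ * t) (by fun_prop)]
  have h : ∀ s : ℝ, ∫ t in (-1 : ℝ)..1, (α + β * s + γ * t) = 2 * α + 2 * β * s + 0 * s ^ 2 := by
    intro s
    have := intervalIntegral_quadratic (α + β * s) γ 0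
    simp only [zero_mul, add_zero] at this
    rw [this]; ring
  simp only [h, intervalIntegral_quadratic]
  ring

theorem integral_fst_mul_affine_refSquare (α β γ : ℝ) :
    ∫ p in refSquare, p 0 * (α + β * p 0 + γ * p 1) = 4 / 3 * β := by
  rw [setIntegral_refSquare (fun s t => s * (α + β * s + γ * t)) (by fun_prop)]
  have h : ∀ s : ℝ, ∫ t in (-1 : ℝ)..1, s * (α + β * s + γ * t) =
      0 + 2 * α * s + 2 * β * s ^ 2 := by
    intro s
    have := intervalIntegral_quadratic (s * (α + β * s)) (s * γ) 0
    simp only [zero_mul, add_zero] at this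
    simp only [mul_add s, ← mul_assoc] at this ⊢
    rw [this]; ring
  simp only [h, intervalIntegral_quadratic]
  ring

theorem integral_snd_mul_affine_refSquare (α β γ : ℝ) :
    ∫ p in refSquare, p 1 * (α + β * p 0 + γ * p 1) = 4 / 3 * γ := by
  rw [setIntegral_refSquare (fun s t => t * (α + β * s + γ * t)) (by fun_prop)]
  have h : ∀ s : ℝ, ∫ t in (-1 : ℝ)..1, t * (α + β * s + γ * t) =
      2 / 3 * γ + 0 * s + 0 * s ^ 2 := by
    intro s
    have e : ∀ t : ℝ, t * (α + β * s + γ * t) = 0 + (α + β * s) * t + γ * t ^ 2 :=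
      fun t => by ring
    simp only [e, intervalIntegral_quadratic]
    ring
  simp only [h, intervalIntegral_quadratic]
  ring

/-- The difference is covered by the image of the boundary of the square, and differentiable maps
preserve null sets. -/
theorem quad_diff_elem_null {A : Fin 4 → Plane}
    (hA : ∀ i : Fin 4, 0 < cross (A (i + 1) - A i) (A (i + 2) - A (i + 1))) :
    volume (quad A \ elem A) = 0 := by
  have h : volume (refMap (quadCoeff A) '' (refSquareClosed \ refSquare)) = 0 :=
    addHaar_image_eq_zero_of_differentiableOn_of_addHaar_eq_zero _
      (fun x _ => (hasFDerivAt_refMap _ x).differentiableAt.differentiableWithinAt)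
      volume_refSquareClosed_diff
  refine measure_mono_null ?_ h
  rw [← refMap_image_closed hA, elem]
  rintro _ ⟨⟨p, hp, rfl⟩, hn⟩
  exact ⟨p, ⟨hp, fun h => hn ⟨p, h, rfl⟩⟩, rfl⟩

theorem setIntegral_elem {A : Fin 4 → Plane}
    (hA : ∀ i : Fin 4, 0 < cross (A (i + 1) - A i) (A (i + 2) - A (i + 1))) (f : Plane → ℝ) :
    ∫ x in elem A, f x =
      ∫ p in refSquare, jac (quadCoeff A) (p 0) (p 1) * f (refMap (quadCoeff A) p) := by
  rw [elem, integral_image_eq_integral_abs_det_fderiv_smul volume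
    isOpen_refSquare.measurableSet (fun x _ => (hasFDerivAt_refMap _ x).hasFDerivWithinAt)
    ((injOn_refMap hA).mono refSquare_subset_closed)]
  refine setIntegral_congr_fun isOpen_refSquare.measurableSet fun p hp => ?_
  simp only [det_refDeriv, smul_eq_mul]
  rw [abs_of_pos (jac_quadCoeff_pos hA (refSquare_subset_closed hp 0)
    (refSquare_subset_closed hp 1))]

/-! ### The mesh -/

section Mesh
variable {P : PolygonalDomain} (M : QuadMesh P.D)

/-- The open elements of a mesh. -/
def QuadMesh.el {D : Set Plane} (M : QuadMesh D) (T : Fin M.m) : Set Plane := elem (M.A T)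

theorem QuadMesh.isOpen_el {D : Set Plane} (M : QuadMesh D) (T : Fin M.m) : IsOpen (M.el T) :=
  isOpen_elem (M.convex T)

theorem QuadMesh.disjoint_el {D : Set Plane} (M : QuadMesh D) :
    Pairwise fun T T' => Disjoint (M.el T) (M.el T') := fun T T' h =>
  (M.disjoint h).mono (elem_subset_interior (M.convex T)) (elem_subset_interior (M.convex T'))

theorem PolygonalDomain.isCompact_closure (P : PolygonalDomain) : IsCompact (closure P.D) := by
  obtain ⟨s, hs⟩ := P.polygon
  rw [hs]
  exact s.finite_toSet.isCompact_convexHull (𝕜 := ℝ)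

theorem PolygonalDomain.nonempty (P : PolygonalDomain) : P.D.Nonempty := by
  by_contra h
  rw [Set.not_nonempty_iff_eq_empty] at h
  have hb := P.boundary
  rw [h, frontier_empty] at hb
  have h0 : P.D0 = ∅ := Set.subset_empty_iff.1 (hb ▸ Set.subset_union_left)
  have := P.length_D0_pos
  simp [h0] at this

/-- Convexity excludes slits. The mesh covers `closure D`, and this places its open elements inside
`D`. -/
theorem PolygonalDomain.interior_closure (P : PolygonalDomain) : interior (closure P.D) = P.D := by
  rw [P.convex.interior_closure_eq_interior_of_nonempty_interior, P.isOpen.interior_eq]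
  rw [P.isOpen.interior_eq]; exact P.nonempty

theorem PolygonalDomain.D0_subset (P : PolygonalDomain) : P.D0 ⊆ closure P.D :=
  (P.boundary ▸ Set.subset_union_left : P.D0 ⊆ frontier P.D).trans frontier_subset_closure

theorem PolygonalDomain.D1_subset (P : PolygonalDomain) : P.D1 ⊆ closure P.D :=
  (P.boundary ▸ Set.subset_union_right : P.D1 ⊆ frontier P.D).trans frontier_subset_closure

instance (P : PolygonalDomain) : IsFiniteMeasure (volume.restrict P.D) :=
  ⟨by
    rw [Measure.restrict_apply_univ]
    exact (measure_mono subset_closure).trans_lt P.isCompact_closure.measure_lt_top⟩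

theorem QuadMesh.el_subset (T : Fin M.m) : M.el T ⊆ P.D := by
  have h : M.el T ⊆ interior (closure P.D) := by
    rw [← M.cover]
    exact interior_maximal ((elem_subset_quad _).trans (Set.subset_iUnion (fun T => quad (M.A T)) T))
      (M.isOpen_el T)
  rwa [P.interior_closure] at h

theorem QuadMesh.volume_diff_el : volume (P.D \ ⋃ T, M.el T) = 0 := by
  have h : volume (⋃ T, quad (M.A T) \ elem (M.A T)) = 0 :=
    measure_iUnion_null fun T => quad_diff_elem_null (M.convex T)
  refine measure_mono_null ?_ h
  rintro x ⟨hx, hn⟩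
  have : x ∈ ⋃ T, quad (M.A T) := M.cover ▸ subset_closure hx
  obtain ⟨T, hT⟩ := Set.mem_iUnion.1 this
  exact Set.mem_iUnion.2 ⟨T, hT, fun h => hn (Set.mem_iUnion.2 ⟨T, h⟩)⟩

theorem QuadMesh.ae_mem_el : ∀ᵐ x ∂(volume.restrict P.D), ∃ T, x ∈ M.el T := by
  rw [ae_restrict_iff' P.isOpen.measurableSet, ae_iff]
  refine measure_mono_null (fun x hx => ?_) M.volume_diff_el
  simp only [Set.mem_ofPred_eq, Classical.not_imp, not_exists] at hx
  exact ⟨hx.1, by simpa using hx.2⟩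

theorem QuadMesh.setIntegral_eq_sum {f : Plane → ℝ} (hf : IntegrableOn f P.D) :
    ∫ x in P.D, f x = ∑ T, ∫ x in M.el T, f x := by
  have hu : (⋃ T, M.el T : Set Plane) ⊆ P.D := Set.iUnion_subset M.el_subset
  have he : (⋃ T, M.el T : Set Plane) =ᵐ[volume] P.D :=
    Filter.EventuallyLE.antisymm hu.eventuallyLE (ae_le_set.2 M.volume_diff_el)
  rw [← setIntegral_congr_set he,
    integral_iUnion_fintype (fun T => (M.isOpen_el T).measurableSet) M.disjoint_el
      (fun T => hf.mono_set (M.el_subset T))]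

end Mesh

/-! ### The boundary has finite length -/

/-- By Carathéodory, `x` is a combination with positive weights of at most three affinely
independent points of `s`. Three such points would make `x` interior to a triangle, so at most two
occur. The resulting finite length of the boundary makes bounded traces square integrable on `D1`.
-/
theorem frontier_convexHull_subset (s : Finset Plane) :
    frontier (convexHull ℝ (s : Set Plane)) ⊆ ⋃ p ∈ s, ⋃ q ∈ s, segment ℝ p q := by
  intro x hx
  have hx1 : x ∈ convexHull ℝ (s : Set Plane) := by
    have := frontier_subset_closure hx
    rwa [(s.finite_toSet.isCompact_convexHull (𝕜 := ℝ)).isClosed.closure_eq] at this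
  obtain ⟨ι, _, z, w, hz, hai, hw, hw1, hsum⟩ := eq_pos_convex_span_of_mem_convexHull hx1
  have hcard : Fintype.card ι ≤ 3 := by
    have := hai.card_le_finrank_succ
    have h2 : Module.finrank ℝ (vectorSpan ℝ (Set.range z)) ≤ Module.finrank ℝ Plane :=
      Submodule.finrank_le _
    rw [finrank_euclideanSpace_fin] at h2
    omega
  by_cases h3 : Fintype.card ι = 3
  · exfalso
    have htop : affineSpan ℝ (Set.range z) = ⊤ := by
      rw [hai.affineSpan_eq_top_iff_card_eq_finrank_add_one, finrank_euclideanSpace_fin, h3]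
    let b : AffineBasis ι ℝ Plane := ⟨z, hai, htop⟩
    have hb : x ∈ interior (convexHull ℝ (Set.range b)) := by
      rw [b.interior_convexHull]
      intro i
      have hxc : x = Finset.univ.affineCombination ℝ b w := by
        rw [Finset.affineCombination_eq_linear_combination _ _ _ hw1, ← hsum]; rfl
      rw [hxc, b.coord_apply_combination_of_mem (Finset.mem_univ i) hw1]
      exact hw i
    exact hx.2 (interior_mono (convexHull_mono hz) hb)
  · have : ∃ p ∈ s, ∃ q ∈ s, x ∈ segment ℝ p q := by
      have hne : Nonempty ι := by
        by_contra h
        rw [not_nonempty_iff] at h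
        simp at hw1
      obtain ⟨i⟩ := hne
      by_cases h1 : ∃ j, j ≠ i
      · obtain ⟨j, hj⟩ := h1
        classical
        have hu : (Finset.univ : Finset ι) = {j, i} := by
          symm
          apply Finset.eq_univ_of_card
          rw [Finset.card_pair hj]
          have : Finset.card ({j, i} : Finset ι) ≤ Fintype.card ι := Finset.card_le_univ _
          rw [Finset.card_pair hj] at this
          omega
        refine ⟨z j, hz ⟨j, rfl⟩, z i, hz ⟨i, rfl⟩, w j, w i, (hw j).le, (hw i).le, ?_, ?_⟩
        · rw [← hw1, hu, Finset.sum_pair hj]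
        · rw [← hsum, hu, Finset.sum_pair hj]
      · push Not at h1
        have hu : (Finset.univ : Finset ι) = {i} := by
          ext k; simp [h1 k]
        rw [hu, Finset.sum_singleton] at hw1 hsum
        rw [hw1, one_smul] at hsum
        exact ⟨z i, hz ⟨i, rfl⟩, z i, hz ⟨i, rfl⟩, by rw [← hsum]; exact left_mem_segment _ _ _⟩
    simpa using this

theorem PolygonalDomain.hausdorffMeasure_frontier_lt_top (P : PolygonalDomain) :
    Measure.hausdorffMeasure (X := Plane) 1 (frontier P.D) < ⊤ := by
  obtain ⟨s, hs⟩ := P.polygon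
  have h1 : frontier P.D ⊆ frontier (convexHull ℝ (s : Set Plane)) := by
    rw [← hs, frontier, frontier, closure_closure, P.interior_closure, P.isOpen.interior_eq]
  refine (measure_mono (h1.trans (frontier_convexHull_subset s))).trans_lt ?_
  refine (measure_biUnion_lt_top s.finite_toSet fun p _ => ?_)
  refine (measure_biUnion_lt_top s.finite_toSet fun q _ => ?_)
  rw [hausdorffMeasure_segment]
  exact edist_lt_top _ _

instance (P : PolygonalDomain) :
    IsFiniteMeasure ((Measure.hausdorffMeasure (X := Plane) 1).restrict P.D1) :=
  ⟨by
    rw [Measure.restrict_apply_univ]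
    exact (measure_mono (P.boundary ▸ Set.subset_union_right)).trans_lt
      P.hausdorffMeasure_frontier_lt_top⟩

/-! ### Weak gradients -/

section WeakGradient
variable {D : Set Plane} {v w : Plane → Plane} {G H : Plane → Tensor}

theorem memLp_coord {α : Type*} [MeasurableSpace α] {μ : Measure α} {v : α → Plane}
    (hv : MemLp v 2 μ) (i : Fin 2) : MemLp (fun x => v x i) 2 μ :=
  hv.continuousLinearMap_comp (EuclideanSpace.proj (𝕜 := ℝ) i)

theorem memLp_two_of_hasCompactSupport {φ : Plane → ℝ} (hφ : Continuous φ)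
    (hs : HasCompactSupport φ) (D : Set Plane) : MemLp φ 2 (volume.restrict D) :=
  (hφ.memLp_of_hasCompactSupport hs).restrict D

theorem integrableOn_mul_fderiv (hv : MemLp v 2 (volume.restrict D)) (i j : Fin 2) {φ : Plane → ℝ}
    (hφ : ContDiff ℝ ∞ φ) (hs : HasCompactSupport φ) :
    IntegrableOn (fun x => v x i * fderiv ℝ φ x (EuclideanSpace.single j 1)) D := by
  have hc : Continuous fun x => fderiv ℝ φ x (EuclideanSpace.single j 1) :=
    (hφ.continuous_fderiv (by simp)).clm_apply continuous_const
  have hcs : HasCompactSupport fun x => fderiv ℝ φ x (EuclideanSpace.single j 1) :=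
    (hs.fderiv ℝ).comp_left (g := fun L : Plane →L[ℝ] ℝ => L (EuclideanSpace.single j 1)) rfl
  exact (memLp_coord hv i).integrable_mul (memLp_two_of_hasCompactSupport hc hcs D)

theorem IsWeakGradient.integrableOn_mul (hG : IsWeakGradient D v G) (i j : Fin 2) {φ : Plane → ℝ}
    (hφ : ContDiff ℝ ∞ φ) (hs : HasCompactSupport φ) :
    IntegrableOn (fun x => G x i j * φ x) D :=
  (hG.1 i j).integrable_mul (memLp_two_of_hasCompactSupport hφ.continuous hs D)

theorem isWeakGradient_zero : IsWeakGradient D 0 0 :=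
  ⟨fun i j => by simp, fun i j φ _ _ _ => by simp⟩

theorem IsWeakGradient.add (hv : MemLp v 2 (volume.restrict D)) (hw : MemLp w 2 (volume.restrict D))
    (hG : IsWeakGradient D v G) (hH : IsWeakGradient D w H) :
    IsWeakGradient D (v + w) (G + H) := by
  refine ⟨fun i j => (hG.1 i j).add (hH.1 i j), fun i j φ hφ hs ht => ?_⟩
  simp only [Pi.add_apply, PiLp.add_apply, Matrix.add_apply, add_mul]
  rw [integral_add (integrableOn_mul_fderiv hv i j hφ hs) (integrableOn_mul_fderiv hw i j hφ hs),
    integral_add (hG.integrableOn_mul i j hφ hs) (hH.integrableOn_mul i j hφ hs),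
    hG.2 i j φ hφ hs ht, hH.2 i j φ hφ hs ht]
  ring

theorem IsWeakGradient.smul (r : ℝ) (hG : IsWeakGradient D v G) :
    IsWeakGradient D (r • v) (r • G) := by
  refine ⟨fun i j => (hG.1 i j).const_smul r, fun i j φ hφ hs ht => ?_⟩
  simp only [Pi.smul_apply, PiLp.smul_apply, Matrix.smul_apply, smul_eq_mul, mul_assoc]
  rw [integral_const_mul, integral_const_mul, hG.2 i j φ hφ hs ht]
  ring

theorem locallyIntegrableOn_of_memLp {f : Plane → ℝ} (hf : MemLp f 2 (volume.restrict D))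
    {U : Set Plane} (hU : U ⊆ D) : LocallyIntegrableOn f U := (locallyIntegrableOn_of_locallyIntegrable_restrict
    (hf.locallyIntegrable (by norm_num))).mono_set hU

theorem setIntegral_mul_eq_integral {φ f : Plane → ℝ} (ht : tsupport φ ⊆ D) :
    ∫ x in D, f x * φ x = ∫ x, f x * φ x := by
  refine setIntegral_eq_integral_of_forall_compl_eq_zero fun x hx => ?_
  rw [image_eq_zero_of_notMem_tsupport fun h => hx (ht h), mul_zero]

/-- On an open set where `v` is continuously differentiable, the weak gradient is the classical
one. -/
theorem IsWeakGradient.ae_eq_fderiv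
    (hG : IsWeakGradient D v G) {U : Set Plane} (hU : IsOpen U) (hUD : U ⊆ D)
    {v' : Plane → Plane →L[ℝ] Plane} (hd : ∀ x ∈ U, HasFDerivAt v (v' x) x)
    (hc : ContinuousOn v' U) :
    ∀ᵐ x ∂volume, x ∈ U → ∀ i j, G x i j = v' x (EuclideanSpace.single j 1) i := by
  have key : ∀ i j, ∀ᵐ x ∂volume, x ∈ U → G x i j - v' x (EuclideanSpace.single j 1) i = 0 := by
    intro i j
    have hcc : ContinuousOn (fun x => v' x (EuclideanSpace.single j 1) i) U :=
      (EuclideanSpace.proj (𝕜 := ℝ) i).continuous.comp_continuousOn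
        (hc.clm_apply continuousOn_const)
    refine hU.ae_eq_zero_of_integral_contDiff_smul_eq_zero ?_ fun φ hφ hs ht => ?_
    · exact (locallyIntegrableOn_of_memLp (hG.1 i j) hUD).sub
        (hcc.locallyIntegrableOn hU.measurableSet)
    -- The fields are controlled only on `U`; integrability comes from the compact support of `φ`
    -- inside `U`.
    have hin : ∀ {f : Plane → ℝ}, ContinuousOn f U → Integrable (fun x => f x * φ x) := by
      intro f hf
      have h1 : IntegrableOn (fun x => f x * φ x) (tsupport φ) :=
        ((hf.mono ht).mul hφ.continuous.continuousOn).integrableOn_compact hs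
      refine (integrableOn_iff_integrable_of_support_subset fun x hx => ?_).1 h1
      exact subset_tsupport _ (right_ne_zero_of_mul hx)
    have hder : ∀ x ∈ U, HasFDerivAt (fun x => v x i)
        ((EuclideanSpace.proj (𝕜 := ℝ) i).comp (v' x)) x := fun x hx =>
      (EuclideanSpace.proj (𝕜 := ℝ) i).hasFDerivAt.comp x (hd x hx)
    have hvc : ContinuousOn (fun x => v x i) U := fun x hx =>
      (hder x hx).continuousAt.continuousWithinAt
    have e0 : ∀ x, fderiv ℝ (fun x => v x i) x (EuclideanSpace.single j 1) * φ x =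
        v' x (EuclideanSpace.single j 1) i * φ x := by
      intro x
      by_cases hx : x ∈ U
      · rw [(hder x hx).fderiv]; rfl
      · rw [image_eq_zero_of_notMem_tsupport fun h => hx (ht h), mul_zero, mul_zero]
    have hI1 := hin hcc
    have hI2 : Integrable (fun x => v x i * fderiv ℝ φ x (EuclideanSpace.single j 1)) := by
      have hcf : Continuous fun x => fderiv ℝ φ x (EuclideanSpace.single j 1) :=
        (hφ.continuous_fderiv (by simp)).clm_apply continuous_const
      have h1 : IntegrableOn (fun x => v x i * fderiv ℝ φ x (EuclideanSpace.single j 1))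
          (tsupport φ) := ((hvc.mono ht).mul hcf.continuousOn).integrableOn_compact hs
      refine (integrableOn_iff_integrable_of_support_subset fun x hx => ?_).1 h1
      by_contra h
      apply right_ne_zero_of_mul hx
      rw [fderiv_of_notMem_tsupport ℝ h]; rfl
    have hibp := integral_mul_fderiv_eq_neg_fderiv_mul_of_integrable (μ := volume)
      (f := fun x => v x i) (g := φ) (v := EuclideanSpace.single j 1)
      (by simpa only [e0] using hI1) hI2 (hin hvc)
      (fun x hx => (hder x (ht hx)).differentiableAt)
      (fun x _ => (hφ.differentiable (by simp)).differentiableAt)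
    have hw := hG.2 i j φ hφ hs (ht.trans hUD)
    rw [setIntegral_mul_eq_integral (ht.trans hUD),
      setIntegral_eq_integral_of_forall_compl_eq_zero] at hw
    · simp only [e0] at hibp
      have hI3 : Integrable (fun x => G x i j * φ x) := by
        refine (integrableOn_iff_integrable_of_support_subset fun x hx => ?_).1
          (hG.integrableOn_mul i j hφ hs)
        exact hUD (ht (subset_tsupport _ (right_ne_zero_of_mul hx)))
      simp only [smul_eq_mul, mul_sub]
      simp only [mul_comm (φ _)]
      rw [integral_sub hI3 hI1]
      linarith
    · intro x hx
      rw [fderiv_of_notMem_tsupport ℝ fun h => hx (hUD (ht h))]; simp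
  filter_upwards [ae_all_iff.2 fun i => ae_all_iff.2 (key i)] with x hx hxU i j
  exact sub_eq_zero.1 (hx i j hxU)

/-- `weakGradient` is an arbitrary choice and need not depend linearly on the field. This
uniqueness, from the fundamental lemma of the calculus of variations, allows any convenient weak
gradient in its place. -/
theorem IsWeakGradient.ae_eq (hD : IsOpen D) (hG : IsWeakGradient D v G)
    (hH : IsWeakGradient D v H) : ∀ᵐ x ∂(volume.restrict D), G x = H x := by
  rw [ae_restrict_iff' hD.measurableSet]
  have key : ∀ i j, ∀ᵐ x ∂volume, x ∈ D → G x i j - H x i j = 0 := by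
    intro i j
    refine hD.ae_eq_zero_of_integral_contDiff_smul_eq_zero ?_ fun φ hφ hs ht => ?_
    · exact (locallyIntegrableOn_of_memLp (hG.1 i j) subset_rfl).sub
        (locallyIntegrableOn_of_memLp (hH.1 i j) subset_rfl)
    have h1 := hG.2 i j φ hφ hs ht
    have h2 := hH.2 i j φ hφ hs ht
    have e : ∫ x, φ x • (G x i j - H x i j) = ∫ x in D, (G x i j * φ x - H x i j * φ x) := by
      simp only [← sub_mul]
      rw [setIntegral_mul_eq_integral ht]
      simp only [smul_eq_mul, mul_comm]
    rw [e, integral_sub (hG.integrableOn_mul i j hφ hs) (hH.integrableOn_mul i j hφ hs)]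
    linarith
  filter_upwards [ae_all_iff.2 fun i => ae_all_iff.2 (key i)] with x hx hxU
  ext i j
  exact sub_eq_zero.1 (hx i j hxU)

theorem isWeakGradient_weakGradient (h : MemH1 D v) : IsWeakGradient D v (weakGradient D v) := by
  rw [weakGradient, dif_pos h.2]
  exact h.2.choose_spec

theorem MemH1.add (hv : MemH1 D v) (hw : MemH1 D w) : MemH1 D (v + w) :=
  ⟨hv.1.add hw.1, _, IsWeakGradient.add hv.1 hw.1 hv.2.choose_spec hw.2.choose_spec⟩

theorem MemH1.smul (r : ℝ) (hv : MemH1 D v) : MemH1 D (r • v) :=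
  ⟨hv.1.const_smul r, _, IsWeakGradient.smul r hv.2.choose_spec⟩

theorem memH1_zero : MemH1 D 0 := ⟨MemLp.zero, 0, isWeakGradient_zero⟩

/-- The symmetric part of a tensor. -/
def symPart (G : Tensor) : Tensor := (1 / 2 : ℝ) • (G + G.transpose)

theorem symPart_apply (G : Tensor) (i j : Fin 2) : symPart G i j = 1 / 2 * (G i j + G j i) := rfl

theorem IsWeakGradient.ae_strain (hD : IsOpen D) (hG : IsWeakGradient D v G) :
    ∀ᵐ x ∂(volume.restrict D), strain D v x = symPart (G x) := by
  have h : ∃ G, IsWeakGradient D v G := ⟨G, hG⟩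
  have h' : IsWeakGradient D v (weakGradient D v) := by
    rw [weakGradient, dif_pos h]
    exact h.choose_spec
  filter_upwards [h'.ae_eq hD hG] with x hx
  rw [strain, hx, symPart]

end WeakGradient

/-! ### Gradients of isoparametric bilinear fields -/

/-- The gradient, at the image of `p`, of the field `bilin c` transported by `bilin q`. -/
def elGrad (q c : Fin 4 → Plane) (p : Plane) : Plane →L[ℝ] Plane :=
  (refDeriv c p).comp (refDeriv q p).inverse

/-- The Jacobian determinant times the gradient of the field `bilin c` transported by `bilin q`. -/
def gradPoly (q c : Fin 4 → Plane) (s t : ℝ) : Tensor := fun i j =>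
  if j = 0 then (c 1 + t • c 2) i * (q 3 + s • q 2) 1 - (c 3 + s • c 2) i * (q 1 + t • q 2) 1
  else (c 3 + s • c 2) i * (q 1 + t • q 2) 0 - (c 1 + t • c 2) i * (q 3 + s • q 2) 0

theorem inverse_refDeriv (q : Fin 4 → Plane) (p : Plane) (h : jac q (p 0) (p 1) ≠ 0) :
    (refDeriv q p).inverse = ((refEquiv q p h).symm : Plane →L[ℝ] Plane) := by
  rw [← coe_refEquiv q p h, ContinuousLinearMap.inverse_equiv]

/-- The determinant turns the inverse matrix into its cofactors. Since the change of variables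
supplies this very factor, the energies become integrals of polynomials. -/
theorem jac_mul_elGrad (q c : Fin 4 → Plane) (p : Plane) (h : jac q (p 0) (p 1) ≠ 0)
    (i j : Fin 2) :
    jac q (p 0) (p 1) * elGrad q c p (EuclideanSpace.single j 1) i =
      gradPoly q c (p 0) (p 1) i j := by
  rw [elGrad, inverse_refDeriv q p h]
  -- Column `j` of the inverse; its two defining scalar equations are solved below by Cramer's rule.
  set e := (refEquiv q p h).symm (EuclideanSpace.single j 1) with he
  have h1 : refDeriv q p e = EuclideanSpace.single j 1 := by
    rw [← coe_refEquiv q p h]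
    exact (refEquiv q p h).apply_symm_apply _
  rw [refDeriv_apply] at h1
  have g0 := congrArg (fun v : Plane => v 0) h1
  have g1 := congrArg (fun v : Plane => v 1) h1
  have e2 : ((refDeriv c p).comp ((refEquiv q p h).symm : Plane →L[ℝ] Plane))
      (EuclideanSpace.single j 1) = refDeriv c p e := rfl
  rw [e2, refDeriv_apply]
  simp only [PiLp.add_apply, PiLp.smul_apply, smul_eq_mul] at g0 g1
  fin_cases j
  · simp at g0 g1
    simp [jac, cross, gradPoly]
    linear_combination ((c 1 i + p 1 * c 2 i) * (q 3 1 + p 0 * q 2 1) -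
      (c 3 i + p 0 * c 2 i) * (q 1 1 + p 1 * q 2 1)) * g0 +
      ((c 3 i + p 0 * c 2 i) * (q 1 0 + p 1 * q 2 0) -
      (c 1 i + p 1 * c 2 i) * (q 3 0 + p 0 * q 2 0)) * g1
  · simp at g0 g1
    simp [jac, cross, gradPoly]
    linear_combination ((c 1 i + p 1 * c 2 i) * (q 3 1 + p 0 * q 2 1) -
      (c 3 i + p 0 * c 2 i) * (q 1 1 + p 1 * q 2 1)) * g0 +
      ((c 3 i + p 0 * c 2 i) * (q 1 0 + p 1 * q 2 0) -
      (c 1 i + p 1 * c 2 i) * (q 3 0 + p 0 * q 2 0)) * g1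

theorem continuous_refDeriv (c : Fin 4 → Plane) : Continuous (refDeriv c) := by
  unfold refDeriv
  have h0 : Continuous fun p : Plane => c 1 + p 1 • c 2 := by fun_prop
  have h1 : Continuous fun p : Plane => c 3 + p 0 • c 2 := by fun_prop
  exact (((ContinuousLinearMap.smulRightL ℝ Plane Plane
    (EuclideanSpace.proj (𝕜 := ℝ) (0 : Fin 2))).continuous.comp h0).add
    ((ContinuousLinearMap.smulRightL ℝ Plane Plane
    (EuclideanSpace.proj (𝕜 := ℝ) (1 : Fin 2))).continuous.comp h1))

theorem continuousOn_elGrad_refInv {A : Fin 4 → Plane}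
    (hA : ∀ i : Fin 4, 0 < cross (A (i + 1) - A i) (A (i + 2) - A (i + 1))) (c : Fin 4 → Plane) :
    ContinuousOn (fun x => elGrad (quadCoeff A) c (refInv A x)) (elem A) := by
  have h : ContinuousOn (elGrad (quadCoeff A) c) refSquare := by
    intro p hp
    have hi : ContinuousAt ContinuousLinearMap.inverse (refDeriv (quadCoeff A) p) := by
      rw [← coe_refEquiv _ _ (jac_ne_zero_of_mem hA hp)]
      exact (contDiffAt_map_inverse (n := 0) _).continuousAt
    have h2 : ContinuousAt (fun p => (refDeriv (quadCoeff A) p).inverse) p :=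
      hi.comp (continuous_refDeriv _).continuousAt
    exact ((continuous_refDeriv c).continuousAt.clm_comp h2).continuousWithinAt
  exact h.comp (continuousOn_refInv hA) fun x hx => refInv_mem hx

theorem hasFDerivAt_of_bilin {A : Fin 4 → Plane}
    (hA : ∀ i : Fin 4, 0 < cross (A (i + 1) - A i) (A (i + 2) - A (i + 1))) {c : Fin 4 → Plane}
    {v : Plane → Plane} (hv : ∀ s ∈ Set.Icc (-1 : ℝ) 1, ∀ t ∈ Set.Icc (-1 : ℝ) 1,
      v (quadMap A s t) = bilin c s t) {x : Plane} (hx : x ∈ elem A) :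
    HasFDerivAt v (elGrad (quadCoeff A) c (refInv A x)) x := by
  have h1 : v =ᶠ[nhds x] refMap c ∘ refInv A := by
    filter_upwards [(isOpen_elem hA).mem_nhds hx] with y hy
    have hm := refSquare_subset_closed (refInv_mem hy)
    have := hv _ (hm 0) _ (hm 1)
    rw [show quadMap A (refInv A y 0) (refInv A y 1) = y from refMap_refInv hy] at this
    rw [this]; rfl
  refine HasFDerivAt.congr_of_eventuallyEq ?_ h1
  have h2 := (hasStrictFDerivAt_refInv hA (refInv_mem hx)).hasFDerivAt
  rw [refMap_refInv hx, ← inverse_refDeriv _ _ (jac_ne_zero_of_mem hA (refInv_mem hx))] at h2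
  exact (hasFDerivAt_refMap c (refInv A x)).comp x h2

/-! ### The Pian-Sumihara energy of a bilinear field on one element -/

/-- The integral of a Pian-Sumihara mode against the gradient of a bilinear field. -/
def modeEnergy (q c : Fin 4 → Plane) (β : Fin 5 → ℝ) : ℝ :=
  ∫ p in refSquare, contract (psMode q β (p 0) (p 1)) (gradPoly q c (p 0) (p 1))

/-- The terms in `s t` of `gradPoly` cancel, so its entries are affine. By parity the constant modes
see only its value at the centre, the mode in `t` only its coefficient of `t`, and the mode in `s`
only its coefficient of `s`. -/
theorem modeEnergy_eq (q c : Fin 4 → Plane) (β : Fin 5 → ℝ) : modeEnergy q c β =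
    4 * (β 0 * (c 1 0 * q 3 1 - c 3 0 * q 1 1) + β 1 * (c 3 1 * q 1 0 - c 1 1 * q 3 0) +
      β 2 * ((c 1 1 * q 3 1 - c 3 1 * q 1 1) + (c 3 0 * q 1 0 - c 1 0 * q 3 0))) +
    4 / 3 * β 3 * ((c 2 0 * q 3 1 - c 3 0 * q 2 1) +
      q 1 1 ^ 2 / q 1 0 ^ 2 * (c 3 1 * q 2 0 - c 2 1 * q 3 0) +
      q 1 1 / q 1 0 * ((c 2 1 * q 3 1 - c 3 1 * q 2 1) + (c 3 0 * q 2 0 - c 2 0 * q 3 0))) +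
    4 / 3 * β 4 * (q 3 0 ^ 2 / q 3 1 ^ 2 * (c 1 0 * q 2 1 - c 2 0 * q 1 1) +
      (c 2 1 * q 1 0 - c 1 1 * q 2 0) +
      q 3 0 / q 3 1 * ((c 1 1 * q 2 1 - c 2 1 * q 1 1) + (c 2 0 * q 1 0 - c 1 0 * q 2 0))) := by
  set r := q 1 1 / q 1 0 with hr
  set r' := q 3 0 / q 3 1 with hr'
  have hi : ∀ f : ℝ → ℝ → ℝ, Continuous (fun p : ℝ × ℝ => f p.1 p.2) →
      IntegrableOn (fun p : Plane => f (p 0) (p 1)) refSquare := by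
    intro f hf
    have hb : Bornology.IsBounded refSquare := by
      refine (Metric.isBounded_closedBall (x := (0 : Plane)) (r := 2)).subset fun p hp => ?_
      have h0 := hp 0
      have h1 := hp 1
      rw [mem_closedBall_zero_iff, EuclideanSpace.norm_eq, Real.sqrt_le_left (by norm_num)]
      simp only [Fin.sum_univ_two, Real.norm_eq_abs, sq_abs]
      have a0 : p 0 ^ 2 ≤ 1 := by rw [sq_le_one_iff_abs_le_one, abs_le]; exact ⟨h0.1.le, h0.2.le⟩
      have a1 : p 1 ^ 2 ≤ 1 := by rw [sq_le_one_iff_abs_le_one, abs_le]; exact ⟨h1.1.le, h1.2.le⟩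
      linarith
    have hc : Continuous fun p : Plane => f (p 0) (p 1) :=
      hf.comp (by fun_prop : Continuous fun p : Plane => (p 0, p 1))
    exact (hc.continuousOn.integrableOn_compact hb.isCompact_closure).mono_set subset_closure
  -- `α`, `t` and `s` denote the constant part of `gradPoly` and its coefficients of `t` and `s`;
  -- the index `01` is the sum of the two off-diagonal entries, which is what a symmetric stress
  -- sees.
  set α00 := c 1 0 * q 3 1 - c 3 0 * q 1 1
  set α11 := c 3 1 * q 1 0 - c 1 1 * q 3 0
  set α01 := (c 1 1 * q 3 1 - c 3 1 * q 1 1) + (c 3 0 * q 1 0 - c 1 0 * q 3 0)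
  set t00 := c 2 0 * q 3 1 - c 3 0 * q 2 1
  set t11 := c 3 1 * q 2 0 - c 2 1 * q 3 0
  set t01 := (c 2 1 * q 3 1 - c 3 1 * q 2 1) + (c 3 0 * q 2 0 - c 2 0 * q 3 0)
  set s00 := c 1 0 * q 2 1 - c 2 0 * q 1 1
  set s11 := c 2 1 * q 1 0 - c 1 1 * q 2 0
  set s01 := (c 1 1 * q 2 1 - c 2 1 * q 1 1) + (c 2 0 * q 1 0 - c 1 0 * q 2 0)
  have e : ∀ s t : ℝ, contract (psMode q β s t) (gradPoly q c s t) =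
      ((β 0 * α00 + β 1 * α11 + β 2 * α01) + (β 0 * s00 + β 1 * s11 + β 2 * s01) * s +
        (β 0 * t00 + β 1 * t11 + β 2 * t01) * t) +
      t * (β 3 * (α00 + r ^ 2 * α11 + r * α01) + β 3 * (s00 + r ^ 2 * s11 + r * s01) * s +
        β 3 * (t00 + r ^ 2 * t11 + r * t01) * t) +
      s * (β 4 * (r' ^ 2 * α00 + α11 + r' * α01) + β 4 * (r' ^ 2 * s00 + s11 + r' * s01) * s +
        β 4 * (r' ^ 2 * t00 + t11 + r' * t01) * t) := by
    intro s t
    simp only [contract, psMode, gradPoly, Fin.sum_univ_two, ← div_pow, ← hr, ← hr']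
    simp [α00, α11, α01, t00, t11, t01, s00, s11, s01]
    ring
  rw [modeEnergy]
  simp only [e, ← div_pow]
  have ha : ∀ α β γ : ℝ, IntegrableOn (fun p : Plane => α + β * p 0 + γ * p 1) refSquare :=
    fun α β γ => hi (fun s t => α + β * s + γ * t) (by fun_prop)
  have hs : ∀ α β γ : ℝ, IntegrableOn (fun p : Plane => p 0 * (α + β * p 0 + γ * p 1)) refSquare :=
    fun α β γ => hi (fun s t => s * (α + β * s + γ * t)) (by fun_prop)
  have ht : ∀ α β γ : ℝ, IntegrableOn (fun p : Plane => p 1 * (α + β * p 0 + γ * p 1)) refSquare :=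
    fun α β γ => hi (fun s t => t * (α + β * s + γ * t)) (by fun_prop)
  rw [integral_add, integral_add, integral_affine_refSquare, integral_snd_mul_affine_refSquare,
    integral_fst_mul_affine_refSquare]
  · ring
  · exact ha _ _ _
  · exact ht _ _ _
  · exact (ha _ _ _).add (ht _ _ _)
  · exact hs _ _ _

/-- The three constant modes fix the gradient at the centre up to a rotation, hence `c 1` and `c 3`.
The two linear modes are multiples of `t (q 1 ⊗ q 1)` and `s (q 3 ⊗ q 3)`; they test the remaining
deviation of `c 2` against `q 1` and `q 3`, which are independent. -/
theorem exists_rigid_of_modeEnergy_eq {q c : Fin 4 → Plane} {μ : ℝ} (h1 : q 1 0 ≠ 0)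
    (h3 : q 3 1 ≠ 0) (hJ : cross (q 1) (q 3) ≠ 0)
    (h : ∀ β, modeEnergy q c β = μ * modeEnergy q q β) :
    ∃ k : ℝ, ∀ n, n ≠ 0 → c n 0 = μ * q n 0 - k * q n 1 ∧ c n 1 = μ * q n 1 + k * q n 0 := by
  simp only [modeEnergy_eq] at h
  have e0 := h ![1, 0, 0, 0, 0]
  have e1 := h ![0, 1, 0, 0, 0]
  have e2 := h ![0, 0, 1, 0, 0]
  have e3 := h ![0, 0, 0, 1, 0]
  have e4 := h ![0, 0, 0, 0, 1]
  simp at e0 e1 e2 e3 e4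
  -- The rotation rate is the one free parameter; it is read off from the second component of `c 1`.
  obtain ⟨k, hk⟩ : ∃ k, k = (c 1 1 - μ * q 1 1) / q 1 0 := ⟨_, rfl⟩
  have g11 : c 1 1 = μ * q 1 1 + k * q 1 0 := by rw [hk]; field_simp; ring
  have g31 : c 3 1 = μ * q 3 1 + k * q 3 0 := by
    apply mul_right_cancel₀ h1
    linear_combination e1 / 4 + g11 * q 3 0
  simp only [cross] at hJ
  have g30 : c 3 0 = μ * q 3 0 - k * q 3 1 := by
    apply mul_right_cancel₀ hJ
    linear_combination (e2 / 4 - g11 * q 3 1 + g31 * q 1 1) * q 3 1 + e0 / 4 * q 3 0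
  have g10 : c 1 0 = μ * q 1 0 - k * q 1 1 := by
    apply mul_right_cancel₀ h3
    linear_combination e0 / 4 + g30 * q 1 1
  refine ⟨k, ?_⟩
  have f3 : q 1 0 * (c 2 0 - (μ * q 2 0 - k * q 2 1)) +
      q 1 1 * (c 2 1 - (μ * q 2 1 + k * q 2 0)) = 0 := by
    apply mul_right_cancel₀ hJ
    rw [g30, g31] at e3
    field_simp at e3
    linear_combination e3
  have f4 : q 3 0 * (c 2 0 - (μ * q 2 0 - k * q 2 1)) +
      q 3 1 * (c 2 1 - (μ * q 2 1 + k * q 2 0)) = 0 := by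
    apply mul_right_cancel₀ hJ
    rw [g10, g11] at e4
    field_simp at e4
    linear_combination e4
  have g20 : c 2 0 = μ * q 2 0 - k * q 2 1 := by
    apply mul_right_cancel₀ hJ
    linear_combination q 3 1 * f3 - q 1 1 * f4
  have g21 : c 2 1 = μ * q 2 1 + k * q 2 0 := by
    apply mul_right_cancel₀ hJ
    linear_combination q 1 0 * f4 - q 3 0 * f3
  intro n hn
  fin_cases n
  · exact absurd rfl hn
  · exact ⟨g10, g11⟩
  · exact ⟨g20, g21⟩
  · exact ⟨g30, g31⟩

/-! ### Piecewise Pian-Sumihara stresses -/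

theorem contract_symPart {σ : Tensor} (h : σ.IsSymm) (G : Tensor) :
    contract σ (symPart G) = contract σ G := by
  have := h.apply 0 1
  simp only [contract, symPart_apply, Fin.sum_univ_two]
  rw [this]; ring

theorem psMode_isSymm (q : Fin 4 → Plane) (β : Fin 5 → ℝ) (s t : ℝ) : (psMode q β s t).IsSymm := by
  ext i j
  fin_cases i <;> fin_cases j <;> rfl

theorem psMode_add (q : Fin 4 → Plane) (β β' : Fin 5 → ℝ) (s t : ℝ) :
    psMode q (β + β') s t = psMode q β s t + psMode q β' s t := by
  ext i j
  fin_cases i <;> fin_cases j <;> simp [psMode] <;> ring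

theorem psMode_smul (q : Fin 4 → Plane) (r : ℝ) (β : Fin 5 → ℝ) (s t : ℝ) :
    psMode q (r • β) s t = r • psMode q β s t := by
  ext i j
  fin_cases i <;> fin_cases j <;> simp [psMode] <;> ring

theorem continuous_psMode (q : Fin 4 → Plane) (β : Fin 5 → ℝ) (i j : Fin 2) :
    Continuous fun p : ℝ × ℝ => psMode q β p.1 p.2 i j := by
  fin_cases i <;> fin_cases j <;> simp [psMode] <;> fun_prop

section
variable {P : PolygonalDomain} (M : QuadMesh P.D)

/-- The stress with the given Pian-Sumihara parameters on each element. -/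
def pwStress (β : Fin M.m → Fin 5 → ℝ) : Plane → Tensor := fun x =>
  ∑ T, (M.el T).indicator (fun x => psMode (quadCoeff (M.A T)) (β T)
    (refInv (M.A T) x 0) (refInv (M.A T) x 1)) x

variable {M} in
theorem pwStress_of_mem (β : Fin M.m → Fin 5 → ℝ) {T : Fin M.m} {x : Plane} (hx : x ∈ M.el T) :
    pwStress M β x = psMode (quadCoeff (M.A T)) (β T)
      (refInv (M.A T) x 0) (refInv (M.A T) x 1) := by
  rw [pwStress, Finset.sum_eq_single T, Set.indicator_of_mem hx]
  · intro T' _ hT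
    exact Set.indicator_of_notMem (fun h => Set.disjoint_left.1 (M.disjoint_el hT) h hx) _
  · simp

theorem pwStress_quadMap (β : Fin M.m → Fin 5 → ℝ) (T : Fin M.m) {s t : ℝ}
    (hs : s ∈ Set.Ioo (-1 : ℝ) 1) (ht : t ∈ Set.Ioo (-1 : ℝ) 1) :
    pwStress M β (quadMap (M.A T) s t) = psMode (quadCoeff (M.A T)) (β T) s t := by
  have hp : (!₂[s, t] : Plane) ∈ refSquare := by
    intro i; fin_cases i
    · exact hs
    · exact ht
  have hx : quadMap (M.A T) s t = refMap (quadCoeff (M.A T)) !₂[s, t] := rfl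
  have hm : quadMap (M.A T) s t ∈ M.el T := ⟨_, hp, rfl⟩
  rw [pwStress_of_mem β hm, hx, refInv_refMap (M.convex T) hp]
  rfl

theorem pwStress_add (β β' : Fin M.m → Fin 5 → ℝ) :
    pwStress M (β + β') = pwStress M β + pwStress M β' := by
  ext1 x
  simp only [pwStress, Pi.add_apply, ← Finset.sum_add_distrib]
  refine Finset.sum_congr rfl fun T _ => ?_
  by_cases h : x ∈ M.el T <;> simp [h, psMode_add]

theorem pwStress_smul (r : ℝ) (β : Fin M.m → Fin 5 → ℝ) :
    pwStress M (r • β) = r • pwStress M β := by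
  ext1 x
  simp only [pwStress, Pi.smul_apply, Finset.smul_sum]
  refine Finset.sum_congr rfl fun T _ => ?_
  by_cases h : x ∈ M.el T <;> simp [h, psMode_smul]

theorem pwStress_isSymm (β : Fin M.m → Fin 5 → ℝ) (x : Plane) : (pwStress M β x).IsSymm := by
  by_cases h : ∃ T, x ∈ M.el T
  · obtain ⟨T, hT⟩ := h
    rw [pwStress_of_mem β hT]; exact psMode_isSymm _ _ _ _
  · push Not at h
    have : pwStress M β x = 0 := Finset.sum_eq_zero fun T _ => Set.indicator_of_notMem (h T) _
    rw [this]; exact Matrix.isSymm_zero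

theorem memLp_indicator_refInv (T : Fin M.m) {g : ℝ × ℝ → ℝ} (hg : Continuous g) :
    MemLp ((M.el T).indicator fun x => g (refInv (M.A T) x 0, refInv (M.A T) x 1)) 2
      (volume.restrict P.D) := by
  have h1 : ContinuousOn (fun x => (refInv (M.A T) x 0, refInv (M.A T) x 1)) (M.el T) :=
    (by fun_prop : Continuous fun p : Plane => (p 0, p 1)).comp_continuousOn
      (continuousOn_refInv (M.convex T))
  have hc := hg.comp_continuousOn h1
  obtain ⟨C, hC⟩ := (isCompact_Icc.prod isCompact_Icc :
    IsCompact (Set.Icc (-1 : ℝ) 1 ×ˢ Set.Icc (-1 : ℝ) 1)).exists_bound_of_continuousOn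
    hg.continuousOn
  have hmeas := (M.isOpen_el T).measurableSet
  refine MemLp.of_bound (C := max C 0) ?_ ?_
  · rw [aestronglyMeasurable_indicator_iff hmeas]
    exact (hc.aestronglyMeasurable hmeas).mono_measure
      (Measure.restrict_mono_measure Measure.restrict_le_self _)
  · refine Filter.Eventually.of_forall fun x => ?_
    by_cases h : x ∈ M.el T
    · rw [Set.indicator_of_mem h]
      have := refSquare_subset_closed (refInv_mem h)
      exact (hC (_, _) ⟨this 0, this 1⟩).trans (le_max_left _ _)
    · rw [Set.indicator_of_notMem h]; simp

theorem memLp_pwStress (β : Fin M.m → Fin 5 → ℝ) (i j : Fin 2) :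
    MemLp (fun x => pwStress M β x i j) 2 (volume.restrict P.D) := by
  have e : (fun x => pwStress M β x i j) = fun x => ∑ T, (M.el T).indicator
      (fun x => psMode (quadCoeff (M.A T)) (β T) (refInv (M.A T) x 0) (refInv (M.A T) x 1) i j) x := by
    funext x
    rw [pwStress, Matrix.sum_apply]
    refine Finset.sum_congr rfl fun T _ => ?_
    by_cases h : x ∈ M.el T <;> simp [h]
  rw [e]
  refine memLp_finsetSum _ fun T _ => ?_
  exact memLp_indicator_refInv M T (continuous_psMode (quadCoeff (M.A T)) (β T) i j)

theorem pwStress_mem_stressSpaceH {β : Fin M.m → Fin 5 → ℝ}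
    (h : Measure.hausdorffMeasure (X := Plane) 1 P.D1 = 0 →
      ∫ x in P.D, (pwStress M β x).trace = 0) : pwStress M β ∈ StressSpaceH P M :=
  ⟨⟨memLp_pwStress M β, Filter.Eventually.of_forall (pwStress_isSymm M β), h⟩,
    fun T => ⟨β T, fun _ hs _ ht => pwStress_quadMap M β T hs ht⟩⟩

/-- Members of `StressSpaceH` are arbitrary on the element edges and outside the domain, so five
parameters per element describe them only almost everywhere in `D`. -/
theorem ae_eq_pwStress {τ : Plane → Tensor} (h : τ ∈ StressSpaceH P M) :
    ∃ β, ∀ᵐ x ∂(volume.restrict P.D), τ x = pwStress M β x := by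
  choose β hβ using h.2
  refine ⟨β, ?_⟩
  filter_upwards [M.ae_mem_el] with x ⟨T, p, hp, hx⟩
  rw [← hx]
  exact (hβ T _ (hp 0) _ (hp 1)).trans (pwStress_quadMap M β T (hp 0) (hp 1)).symm

theorem integrable_contract {α : Type*} [MeasurableSpace α] {μ : Measure α} {σ τ : α → Tensor}
    (hσ : ∀ i j, MemLp (fun x => σ x i j) 2 μ) (hτ : ∀ i j, MemLp (fun x => τ x i j) 2 μ) :
    Integrable (fun x => contract (σ x) (τ x)) μ :=
  integrable_finsetSum _ fun i _ => integrable_finsetSum _ fun j _ =>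
    (hσ i j).integrable_mul (hτ i j)

/-- On an open element the weak gradient is the classical one, and the Jacobian of the pullback to
the square combines with it to give `gradPoly`. -/
theorem integral_pwStress_grad (β : Fin M.m → Fin 5 → ℝ) {v : Plane → Plane}
    {G : Plane → Tensor} (hG : IsWeakGradient P.D v G) {c : Fin M.m → Fin 4 → Plane}
    (hc : ∀ T, ∀ s ∈ Set.Icc (-1 : ℝ) 1, ∀ t ∈ Set.Icc (-1 : ℝ) 1,
      v (quadMap (M.A T) s t) = bilin (c T) s t) :
    ∫ x in P.D, contract (pwStress M β x) (G x) =
      ∑ T, modeEnergy (quadCoeff (M.A T)) (c T) (β T) := by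
  rw [M.setIntegral_eq_sum (integrable_contract (memLp_pwStress M β) hG.1)]
  refine Finset.sum_congr rfl fun T _ => ?_
  have h1 : ∫ x in M.el T, contract (pwStress M β x) (G x) =
      ∫ x in M.el T, contract (psMode (quadCoeff (M.A T)) (β T)
      (refInv (M.A T) x 0) (refInv (M.A T) x 1)) (fun i j =>
        elGrad (quadCoeff (M.A T)) (c T) (refInv (M.A T) x) (EuclideanSpace.single j 1) i) := by
    refine setIntegral_congr_ae (M.isOpen_el T).measurableSet ?_
    filter_upwards [hG.ae_eq_fderiv (M.isOpen_el T) (M.el_subset T)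
      (fun x hx => hasFDerivAt_of_bilin (M.convex T) (hc T) hx)
      (continuousOn_elGrad_refInv (M.convex T) (c T))] with x hx hxT
    rw [pwStress_of_mem β hxT]
    congr 1
    ext i j
    exact hx hxT i j
  rw [h1, QuadMesh.el, setIntegral_elem (M.convex T), modeEnergy]
  refine setIntegral_congr_fun isOpen_refSquare.measurableSet fun p hp => ?_
  simp only [refInv_refMap (M.convex T) hp, contract, Finset.mul_sum]
  refine Finset.sum_congr rfl fun i _ => Finset.sum_congr rfl fun j _ => ?_
  rw [← jac_mul_elGrad _ _ _ (jac_ne_zero_of_mem (M.convex T) hp)]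
  ring

end

/-! ### From rigidity on each element to a vanishing displacement. -/

theorem plane_ext {x y : Plane} (h0 : x 0 = y 0) (h1 : x 1 = y 1) : x = y := by
  ext i
  fin_cases i
  · exact h0
  · exact h1

theorem contract_one (σ : Tensor) : contract σ 1 = σ.trace := by
  simp [contract, Matrix.trace, Fin.sum_univ_two]

/-- The trace of a stress is its contraction with the gradient of the identity, itself a bilinear
field on each element. The mean value constraint thus becomes an instance of the energy formula. -/
theorem isWeakGradient_id {D : Set Plane} [IsFiniteMeasure (volume.restrict D)] :
    IsWeakGradient D id 1 := by
  refine ⟨fun i j => memLp_const _, fun i j φ hφ hs ht => ?_⟩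
  have hc : Continuous fun x => fderiv ℝ φ x (EuclideanSpace.single j 1) :=
    (hφ.continuous_fderiv (by simp)).clm_apply continuous_const
  have hcs : HasCompactSupport fun x => fderiv ℝ φ x (EuclideanSpace.single j 1) :=
    (hs.fderiv ℝ).comp_left (g := fun L : Plane →L[ℝ] ℝ => L (EuclideanSpace.single j 1)) rfl
  have hd : ∀ x : Plane, HasFDerivAt (fun x : Plane => x i) (EuclideanSpace.proj (𝕜 := ℝ) i) x :=
    fun x => (EuclideanSpace.proj (𝕜 := ℝ) i).hasFDerivAt
  have hi : Continuous fun x : Plane => x i := by fun_prop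
  have e : ∀ x : Plane, fderiv ℝ (fun x : Plane => x i) x (EuclideanSpace.single j 1) =
      (1 : Plane → Tensor) x i j := by
    intro x
    rw [(hd x).fderiv]
    simp [Matrix.one_apply]
  have hibp := integral_mul_fderiv_eq_neg_fderiv_mul_of_integrable (μ := volume)
    (f := fun x : Plane => x i) (g := φ) (v := EuclideanSpace.single j 1)
    (by simp only [e]
        exact (continuous_const.mul hφ.continuous).integrable_of_hasCompactSupport hs.mul_left)
    ((hi.mul hc).integrable_of_hasCompactSupport hcs.mul_left)
    ((hi.mul hφ.continuous).integrable_of_hasCompactSupport hs.mul_left)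
    (fun x _ => (hd x).differentiableAt)
    (fun x _ => (hφ.differentiable (by simp)).differentiableAt)
  simp only [e] at hibp
  rw [setIntegral_mul_eq_integral ht, ← hibp]
  refine setIntegral_eq_integral_of_forall_compl_eq_zero fun x hx => ?_
  rw [fderiv_of_notMem_tsupport ℝ fun h => hx (ht h)]; simp

/-- The increments of a continuous field on a convex set that is rigid on each of finitely many
covering pieces are orthogonal to those of the position. -/
theorem inner_eq_of_piecewise_rigid {S : Set Plane} (hS : Convex ℝ S) {z : Plane → Plane}
    (hz : ContinuousOn z S) {ι : Type*} [Finite ι] (d : ι → Plane) (k : ι → ℝ)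
    (h : ∀ x ∈ S, ∃ T, z x 0 = d T 0 - k T * x 1 ∧ z x 1 = d T 1 + k T * x 0)
    {x y : Plane} (hx : x ∈ S) (hy : y ∈ S) :
    (z x 0 - z y 0) * (x 0 - y 0) + (z x 1 - z y 1) * (x 1 - y 1) = 0 := by
  set φ : ℝ → ℝ := fun t => z (AffineMap.lineMap y x t) 0 * (x 0 - y 0) +
    z (AffineMap.lineMap y x t) 1 * (x 1 - y 1) with hφ
  have hm : Set.MapsTo (fun t : ℝ => (AffineMap.lineMap y x t : Plane)) (Set.Icc 0 1) S := by
    intro t ht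
    exact hS.segment_subset hy hx (by rw [segment_eq_image_lineMap]; exact ⟨t, ht, rfl⟩)
  have hc : ContinuousOn φ (Set.Icc 0 1) := by
    have h1 : ContinuousOn (fun t : ℝ => z (AffineMap.lineMap y x t)) (Set.Icc 0 1) :=
      hz.comp AffineMap.lineMap_continuous.continuousOn hm
    have hi : ∀ i, ContinuousOn (fun t : ℝ => z (AffineMap.lineMap y x t) i) (Set.Icc 0 1) :=
      fun i => (EuclideanSpace.proj (𝕜 := ℝ) i).continuous.comp_continuousOn h1
    exact ((hi 0).mul continuousOn_const).add ((hi 1).mul continuousOn_const)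
  -- On one piece the value is independent of `t`, because the rotation of the direction `x - y` is
  -- orthogonal to `x - y`; so there is at most one value for each piece. A connected finite set is
  -- a point.
  have hfin : (φ '' Set.Icc 0 1).Finite := by
    refine (Set.finite_range fun T : ι => (d T 0 - k T * y 1) * (x 0 - y 0) +
      (d T 1 + k T * y 0) * (x 1 - y 1)).subset ?_
    rintro _ ⟨t, ht, rfl⟩
    obtain ⟨T, h0, h1⟩ := h _ (hm ht)
    refine ⟨T, ?_⟩
    simp only [hφ, h0, h1]
    simp [AffineMap.lineMap_apply]
    ring
  have hsub := hfin.countable.isTotallyDisconnected _ subset_rfl (isPreconnected_Icc.image φ hc)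
  have := hsub ⟨1, by simp, rfl⟩ ⟨0, by simp, rfl⟩
  simp [hφ] at this
  linarith

/-- Rigid motions satisfy the same identity, so the deviation `g` of `z x` from the motion is
orthogonal to `x - y` for every `y` in the open set `U`. Moving `y` from `y₀` to `y₀ + ε g` gives `ε
|g|² = 0`. -/
theorem eq_rigid_of_inner_eq {S U : Set Plane} {z : Plane → Plane} (hU : IsOpen U) (hUS : U ⊆ S)
    {y₀ : Plane} (hy₀ : y₀ ∈ U) {d : Plane} {k : ℝ}
    (hz : ∀ x ∈ S, ∀ y ∈ S,
      (z x 0 - z y 0) * (x 0 - y 0) + (z x 1 - z y 1) * (x 1 - y 1) = 0)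
    (h : ∀ y ∈ U, z y 0 = d 0 - k * y 1 ∧ z y 1 = d 1 + k * y 0) {x : Plane} (hx : x ∈ S) :
    z x 0 = d 0 - k * x 1 ∧ z x 1 = d 1 + k * x 0 := by
  set g : Plane := !₂[z x 0 - (d 0 - k * x 1), z x 1 - (d 1 + k * x 0)] with hg
  have key : ∀ y ∈ U, g 0 * (x 0 - y 0) + g 1 * (x 1 - y 1) = 0 := by
    intro y hy
    have h1 := hz x hx y (hUS hy)
    obtain ⟨e0, e1⟩ := h y hy
    rw [e0, e1] at h1
    simp [hg]
    linear_combination h1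
  have ht : Filter.Tendsto (fun ε : ℝ => y₀ + ε • g) (nhdsWithin 0 (Set.Ioi 0)) (nhds y₀) := by
    have : Continuous fun ε : ℝ => y₀ + ε • g := by fun_prop
    exact (this.tendsto' 0 y₀ (by simp)).mono_left nhdsWithin_le_nhds
  obtain ⟨ε, hε, hεp⟩ := ((ht.eventually (hU.mem_nhds hy₀)).and
    (self_mem_nhdsWithin : Set.Ioi (0 : ℝ) ∈ nhdsWithin 0 (Set.Ioi 0))).exists
  have a := key _ hy₀
  have b := key _ hε
  simp only [PiLp.add_apply, PiLp.smul_apply, smul_eq_mul] at b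
  have hs : ε * (g 0 ^ 2 + g 1 ^ 2) = 0 := by linear_combination a - b
  have hs' := (mul_eq_zero.1 hs).resolve_left (ne_of_gt hεp)
  have g0 : g 0 = 0 := by nlinarith [sq_nonneg (g 0), sq_nonneg (g 1)]
  have g1 : g 1 = 0 := by nlinarith [sq_nonneg (g 0), sq_nonneg (g 1)]
  simp [hg] at g0 g1
  exact ⟨sub_eq_zero.1 g0, sub_eq_zero.1 g1⟩

section
variable {P : PolygonalDomain} (M : QuadMesh P.D)

/-- A single point has length zero, whereas `D0` has positive length. -/
theorem exists_two_zeros {v : Plane → Plane}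
    (hv : ∀ᵐ x ∂((Measure.hausdorffMeasure (X := Plane) 1).restrict P.D0), v x = 0) :
    ∃ x ∈ P.D0, ∃ y ∈ P.D0, x ≠ y ∧ v x = 0 ∧ v y = 0 := by
  by_contra h
  push Not at h
  rw [ae_restrict_iff' P.measurable_D0, ae_iff] at hv
  have hs : (P.D0 ∩ {x | v x = 0}).Subsingleton := by
    rintro x ⟨hx, hx0⟩ y ⟨hy, hy0⟩
    by_contra hne
    exact h x hx y hy hne hx0 hy0
  have h1 : Measure.hausdorffMeasure (X := Plane) 1 (P.D0 ∩ {x | v x = 0}) = 0 :=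
    haveI := Measure.nullSingletonClass_hausdorff Plane (one_pos : (0 : ℝ) < 1)
    hs.measure_zero _
  have h2 := measure_union_null h1 hv
  refine P.length_D0_pos.ne' (measure_mono_null (fun x hx => ?_) h2)
  by_cases h0 : v x = 0
  · exact Or.inl ⟨hx, h0⟩
  · exact Or.inr fun hh => h0 (hh hx)

theorem integral_contract_strain (β : Fin M.m → Fin 5 → ℝ) {v : Plane → Plane}
    {G : Plane → Tensor} (hG : IsWeakGradient P.D v G) :
    ∫ x in P.D, contract (pwStress M β x) (strain P.D v x) =
      ∫ x in P.D, contract (pwStress M β x) (G x) := by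
  refine integral_congr_ae ?_
  filter_upwards [hG.ae_strain P.isOpen] with x hx
  rw [hx, contract_symPart (pwStress_isSymm M β x)]

theorem modeEnergy_add (q c : Fin 4 → Plane) (β β' : Fin 5 → ℝ) :
    modeEnergy q c (β + β') = modeEnergy q c β + modeEnergy q c β' := by
  simp only [modeEnergy_eq, Pi.add_apply]; ring

theorem modeEnergy_smul (q c : Fin 4 → Plane) (r : ℝ) (β : Fin 5 → ℝ) :
    modeEnergy q c (r • β) = r * modeEnergy q c β := by
  simp only [modeEnergy_eq, Pi.smul_apply, smul_eq_mul]; ring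

/-- The energy of a displacement with coefficients `c` against all piecewise Pian-Sumihara
stresses. -/
def totalEnergy (c : Fin M.m → Fin 4 → Plane) : (Fin M.m → Fin 5 → ℝ) →ₗ[ℝ] ℝ where
  toFun β := ∑ T, modeEnergy (quadCoeff (M.A T)) (c T) (β T)
  map_add' β β' := by simp [modeEnergy_add, Finset.sum_add_distrib]
  map_smul' r β := by simp [modeEnergy_smul, Finset.mul_sum]

theorem totalEnergy_single (c : Fin M.m → Fin 4 → Plane) (T : Fin M.m) (b : Fin 5 → ℝ) :
    totalEnergy M c (Pi.single T b) = modeEnergy (quadCoeff (M.A T)) (c T) b := by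
  rw [totalEnergy, LinearMap.coe_mk, AddHom.coe_mk, Finset.sum_eq_single T]
  · simp
  · intro T' _ hT
    have h0 : modeEnergy (quadCoeff (M.A T')) (c T') 0 = 0 := by simp [modeEnergy_eq]
    rw [Pi.single_eq_of_ne hT, h0]
  · simp

/-- This produces the Lagrange multiplier of the constraint on the mean trace. -/
theorem exists_eq_smul_of_forall_eq_zero {V : Type*} [AddCommGroup V] [Module ℝ V] (f g : V →ₗ[ℝ] ℝ)
    (h : ∀ x, g x = 0 → f x = 0) : ∃ μ : ℝ, ∀ x, f x = μ * g x := by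
  by_cases hg : ∃ x, g x ≠ 0
  · obtain ⟨x₀, hx₀⟩ := hg
    refine ⟨f x₀ / g x₀, fun x => ?_⟩
    have h1 := h (x - (g x / g x₀) • x₀) (by simp [hx₀])
    simp only [map_sub, map_smul, smul_eq_mul] at h1
    field_simp at h1 ⊢
    linarith
  · push Not at hg
    exact ⟨0, fun x => by rw [h x (hg x)]; simp⟩

theorem integral_pwStress_strain (β : Fin M.m → Fin 5 → ℝ) {v : Plane → Plane} (hv : MemH1 P.D v)
    {c : Fin M.m → Fin 4 → Plane} (hc : ∀ T, ∀ s ∈ Set.Icc (-1 : ℝ) 1, ∀ t ∈ Set.Icc (-1 : ℝ) 1,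
      v (quadMap (M.A T) s t) = bilin (c T) s t) :
    ∫ x in P.D, contract (pwStress M β x) (strain P.D v x) = totalEnergy M c β := by
  have hG := isWeakGradient_weakGradient hv
  rw [integral_contract_strain M β hG, integral_pwStress_grad M β hG hc]; rfl

theorem integral_trace_pwStress (β : Fin M.m → Fin 5 → ℝ) :
    ∫ x in P.D, (pwStress M β x).trace = totalEnergy M (fun T => quadCoeff (M.A T)) β := by
  have := integral_pwStress_grad M β (isWeakGradient_id (D := P.D)) (v := id)
    (c := fun T => quadCoeff (M.A T)) (fun T s _ t _ => rfl)
  simp only [Pi.one_apply, contract_one] at this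
  rw [this]; rfl

/-- A discrete displacement whose strain is orthogonal to all admissible piecewise Pian-Sumihara
stresses vanishes. -/
theorem eq_zero_of_forall_integral_strain_eq_zero {v : Plane → Plane} (hv : v ∈ DisplSpaceH P M)
    (h : ∀ β, pwStress M β ∈ StressSpaceH P M →
      ∫ x in P.D, contract (pwStress M β x) (strain P.D v x) = 0) :
    ∀ x ∈ closure P.D, v x = 0 := by
  obtain ⟨hH1, hcont, hzero, hel⟩ := hv
  choose c hc using hel
  -- Only stresses with vanishing mean trace are used as tests. They are admissible whether or not
  -- there is a traction boundary, so both cases are treated together.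
  obtain ⟨μ, hμ⟩ := exists_eq_smul_of_forall_eq_zero (totalEnergy M c)
    (totalEnergy M fun T => quadCoeff (M.A T)) (fun β hβ => by
      rw [← integral_pwStress_strain M β hH1 hc]
      exact h β (pwStress_mem_stressSpaceH M fun _ => by rw [integral_trace_pwStress, hβ]))
  have hrig : ∀ T, ∃ k : ℝ, ∀ n, n ≠ 0 → c T n 0 = μ * quadCoeff (M.A T) n 0 -
      k * quadCoeff (M.A T) n 1 ∧ c T n 1 = μ * quadCoeff (M.A T) n 1 + k * quadCoeff (M.A T) n 0 := by
    intro T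
    refine exists_rigid_of_modeEnergy_eq (M.a1_ne_zero T) (M.b3_ne_zero T) ?_ fun b => ?_
    · have := jac_quadCoeff_pos (M.convex T) (s := 0) (t := 0) (by norm_num) (by norm_num)
      simp only [jac, zero_smul, add_zero] at this
      exact this.ne'
    -- With the multiplier in place the constraint is gone, and stresses supported on one element
    -- localise the identity.
    · simpa only [totalEnergy_single] using hμ (Pi.single T b)
  choose k hk using hrig
  set z : Plane → Plane := fun x => v x - μ • x with hz
  set d : Fin M.m → Plane := fun T =>
    !₂[c T 0 0 - μ * quadCoeff (M.A T) 0 0 + k T * quadCoeff (M.A T) 0 1,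
      c T 0 1 - μ * quadCoeff (M.A T) 0 1 - k T * quadCoeff (M.A T) 0 0] with hd
  have hquad : ∀ T, ∀ x ∈ quad (M.A T),
      z x 0 = d T 0 - k T * x 1 ∧ z x 1 = d T 1 + k T * x 0 := by
    intro T x hx
    rw [← refMap_image_closed (M.convex T)] at hx
    obtain ⟨p, hp, rfl⟩ := hx
    have e := hc T _ (hp 0) _ (hp 1)
    have e' : v (refMap (quadCoeff (M.A T)) p) = bilin (c T) (p 0) (p 1) := e
    obtain ⟨a1, b1⟩ := hk T 1 (by decide)
    obtain ⟨a2, b2⟩ := hk T 2 (by decide)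
    obtain ⟨a3, b3⟩ := hk T 3 (by decide)
    simp only [hz, e']
    simp only [hd, refMap, bilin, PiLp.add_apply, PiLp.sub_apply, PiLp.smul_apply, smul_eq_mul,
      a1, a2, a3, b1, b2, b3]
    constructor
    · simp; ring
    · simp; ring
  have hcover : ∀ x ∈ closure P.D, ∃ T, x ∈ quad (M.A T) := fun x hx => by
    rw [← M.cover] at hx; exact Set.mem_iUnion.1 hx
  have hzc : ContinuousOn z (closure P.D) := hcont.sub (by fun_prop)
  have hinner : ∀ x ∈ closure P.D, ∀ y ∈ closure P.D,
      (z x 0 - z y 0) * (x 0 - y 0) + (z x 1 - z y 1) * (x 1 - y 1) = 0 := fun x hx y hy =>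
    inner_eq_of_piecewise_rigid P.convex.closure hzc d k
      (fun x hx => (hcover x hx).imp fun T hT => hquad T x hT) hx hy
  obtain ⟨x₀, hx₀⟩ := P.nonempty
  obtain ⟨T, _⟩ := hcover x₀ (subset_closure hx₀)
  have hglob : ∀ x ∈ closure P.D, z x 0 = d T 0 - k T * x 1 ∧ z x 1 = d T 1 + k T * x 0 :=
    fun x hx => eq_rigid_of_inner_eq (M.isOpen_el T) ((M.el_subset T).trans subset_closure)
      (y₀ := refMap (quadCoeff (M.A T)) 0) ⟨0, fun i => by simp, rfl⟩ hinner
      (fun y hy => hquad T y (elem_subset_quad _ hy)) hx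
  obtain ⟨x, hx, y, hy, hxy, hvx, hvy⟩ := exists_two_zeros hzero
  obtain ⟨x0, x1⟩ := hglob x (P.D0_subset hx)
  obtain ⟨y0, y1⟩ := hglob y (P.D0_subset hy)
  simp [hz, hvx] at x0 x1
  simp [hz, hvy] at y0 y1
  have hpos : 0 < (x 0 - y 0) ^ 2 + (x 1 - y 1) ^ 2 := by
    by_contra hn
    apply hxy
    have s0 := sq_nonneg (x 0 - y 0)
    have s1 := sq_nonneg (x 1 - y 1)
    have e0 : (x 0 - y 0) ^ 2 = 0 := by linarith
    have e1 : (x 1 - y 1) ^ 2 = 0 := by linarith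
    exact plane_ext (sub_eq_zero.1 (pow_eq_zero_iff two_ne_zero |>.1 e0))
      (sub_eq_zero.1 (pow_eq_zero_iff two_ne_zero |>.1 e1))
  -- Subtracting the equations at the two zeros gives `(μ I + k J)(x - y) = 0`. Pairing with `x - y`
  -- isolates `μ`, and pairing with its rotation isolates `k`.
  have hμ0 : μ = 0 := by
    apply (mul_eq_zero.1 (_ : μ * ((x 0 - y 0) ^ 2 + (x 1 - y 1) ^ 2) = 0)).resolve_right hpos.ne'
    linear_combination -(x 0 - y 0) * (x0 - y0) - (x 1 - y 1) * (x1 - y1)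
  have hk0 : k T = 0 := by
    apply (mul_eq_zero.1 (_ : k T * ((x 0 - y 0) ^ 2 + (x 1 - y 1) ^ 2) = 0)).resolve_right hpos.ne'
    linear_combination (x 1 - y 1) * (x0 - y0) - (x 0 - y 0) * (x1 - y1)
  rw [hμ0, hk0] at x0 x1
  intro w hw
  obtain ⟨w0, w1⟩ := hglob w hw
  simp only [hz, hμ0, hk0, zero_smul, sub_zero] at w0 w1
  exact plane_ext (w0.trans (by rw [PiLp.zero_apply]; linarith))
    (w1.trans (by rw [PiLp.zero_apply]; linarith))

end

/-! ### Finite-dimensional saddle point problems modulo null vectors -/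

/-- The quotient embeds in `E ⧸ N`, with values in the image of `R`. In the application `S` itself
is a space of functions with irrelevant values and may be infinite-dimensional. -/
theorem finite_quotient_comap {E : Type*} [AddCommGroup E] [Module ℝ E] {S R N : Submodule ℝ E}
    (hR : R.FG) (h : S ≤ R ⊔ N) : Module.Finite ℝ (S ⧸ N.comap S.subtype) := by
  have hfin : Module.Finite ℝ (R.map N.mkQ) := Module.Finite.iff_fg.2 (hR.map _)
  let f : (S ⧸ N.comap S.subtype) →ₗ[ℝ] E ⧸ N := Submodule.mapQ _ _ S.subtype le_rfl
  have hf : Function.Injective f := by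
    rw [← LinearMap.ker_eq_bot, Submodule.ker_mapQ]
    exact (Submodule.mkQ_map_self _)
  have hr : ∀ x, f x ∈ R.map N.mkQ := by
    intro x
    obtain ⟨s, rfl⟩ := Submodule.mkQ_surjective _ x
    obtain ⟨r, hr, n, hn, e⟩ := Submodule.mem_sup.1 (h s.2)
    refine ⟨r, hr, ?_⟩
    have : f (Submodule.mkQ _ s) = N.mkQ (s : E) := rfl
    rw [this, ← e, map_add, Submodule.mkQ_apply N n, (Submodule.Quotient.mk_eq_zero N).2 hn, add_zero]
  exact Module.Finite.of_injective (f.codRestrict _ hr) fun x y hxy => hf (congrArg Subtype.val hxy)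

/-- A mixed problem that is finite-dimensional and uniquely solvable for zero loads, both modulo
null vectors, is uniquely solvable modulo null vectors. -/
theorem exists_saddle {S V : Type*} [AddCommGroup S] [Module ℝ S] [AddCommGroup V] [Module ℝ V]
    (a : S →ₗ[ℝ] S →ₗ[ℝ] ℝ) (b : S →ₗ[ℝ] V →ₗ[ℝ] ℝ) (l : V →ₗ[ℝ] ℝ)
    (S₀ : Submodule ℝ S) (V₀ : Submodule ℝ V) [Module.Finite ℝ (S ⧸ S₀)] [Module.Finite ℝ (V ⧸ V₀)]
    (ha₁ : ∀ σ ∈ S₀, ∀ τ, a σ τ = 0) (ha₂ : ∀ σ, ∀ τ ∈ S₀, a σ τ = 0)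
    (hb₁ : ∀ τ ∈ S₀, ∀ u, b τ u = 0) (hb₂ : ∀ τ, ∀ u ∈ V₀, b τ u = 0)
    (hl : ∀ u ∈ V₀, l u = 0)
    (hpos : ∀ σ, a σ σ = 0 → σ ∈ S₀) (hinj : ∀ u, (∀ τ, b τ u = 0) → u ∈ V₀) :
    ∃ σ u, ((∀ τ, a σ τ - b τ u = 0) ∧ ∀ v, b σ v = l v) ∧
      ∀ σ' u', (∀ τ, a σ' τ - b τ u' = 0) → (∀ v, b σ' v = l v) → σ' - σ ∈ S₀ ∧ u' - u ∈ V₀ := by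
  have key : ∀ σ u, (∀ τ, a σ τ - b τ u = 0) → (∀ v, b σ v = 0) → σ ∈ S₀ ∧ u ∈ V₀ := by
    intro σ u h1 h2
    have hσ : σ ∈ S₀ := hpos σ (by have := h1 σ; rw [h2 u] at this; linarith)
    refine ⟨hσ, hinj u fun τ => ?_⟩
    have := h1 τ
    rw [ha₁ σ hσ τ] at this; linarith
  let a' : (S ⧸ S₀) →ₗ[ℝ] (S ⧸ S₀) →ₗ[ℝ] ℝ := S₀.liftQ
    { toFun := fun σ => S₀.liftQ (a σ) (fun τ hτ => ha₂ σ τ hτ)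
      map_add' := fun σ σ' => by ext τ; exact LinearMap.congr_fun (map_add a σ σ') τ
      map_smul' := fun r σ => by ext τ; exact LinearMap.congr_fun (map_smul a r σ) τ }
    (fun σ hσ => by ext τ; exact ha₁ σ hσ τ)
  let b' : (S ⧸ S₀) →ₗ[ℝ] (V ⧸ V₀) →ₗ[ℝ] ℝ := S₀.liftQ
    { toFun := fun σ => V₀.liftQ (b σ) (fun u hu => hb₂ σ u hu)
      map_add' := fun σ σ' => by ext u; exact LinearMap.congr_fun (map_add b σ σ') u
      map_smul' := fun r σ => by ext u; exact LinearMap.congr_fun (map_smul b r σ) u }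
    (fun σ hσ => by ext u; exact hb₁ σ hσ u)
  let l' : (V ⧸ V₀) →ₗ[ℝ] ℝ := V₀.liftQ l fun u hu => hl u hu
  -- The operator of the whole system on the quotients. Source and target have equal dimension, so
  -- `key`, which is injectivity, also gives existence.
  let L : ((S ⧸ S₀) × (V ⧸ V₀)) →ₗ[ℝ] Module.Dual ℝ (S ⧸ S₀) × Module.Dual ℝ (V ⧸ V₀) :=
    (a'.comp (LinearMap.fst ℝ _ _) - b'.flip.comp (LinearMap.snd ℝ _ _)).prod
      (b'.comp (LinearMap.fst ℝ _ _))
  have hL : Function.Injective L := by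
    rw [← LinearMap.ker_eq_bot, LinearMap.ker_eq_bot']
    rintro ⟨x, y⟩ hxy
    obtain ⟨σ, rfl⟩ := S₀.mkQ_surjective x
    obtain ⟨u, rfl⟩ := V₀.mkQ_surjective y
    have h1 := congrArg Prod.fst hxy
    have h2 := congrArg Prod.snd hxy
    obtain ⟨hσ, hu⟩ := key σ u
      (fun τ => LinearMap.congr_fun h1 (S₀.mkQ τ)) (fun v => LinearMap.congr_fun h2 (V₀.mkQ v))
    exact Prod.ext ((Submodule.Quotient.mk_eq_zero _).2 hσ) ((Submodule.Quotient.mk_eq_zero _).2 hu)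
  have hdim : Module.finrank ℝ ((S ⧸ S₀) × (V ⧸ V₀)) =
      Module.finrank ℝ (Module.Dual ℝ (S ⧸ S₀) × Module.Dual ℝ (V ⧸ V₀)) := by
    rw [Module.finrank_prod, Module.finrank_prod, Subspace.dual_finrank_eq,
      Subspace.dual_finrank_eq]
  obtain ⟨⟨x, y⟩, hxy⟩ := (LinearMap.injective_iff_surjective_of_finrank_eq_finrank hdim).1 hL (0, l')
  obtain ⟨σ, rfl⟩ := S₀.mkQ_surjective x
  obtain ⟨u, rfl⟩ := V₀.mkQ_surjective y
  have h1 : ∀ τ, a σ τ - b τ u = 0 := fun τ =>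
    LinearMap.congr_fun (congrArg Prod.fst hxy) (S₀.mkQ τ)
  have h2 : ∀ v, b σ v = l v := fun v => LinearMap.congr_fun (congrArg Prod.snd hxy) (V₀.mkQ v)
  refine ⟨σ, u, ⟨h1, h2⟩, fun σ' u' h1' h2' => key _ _ (fun τ => ?_) fun v => ?_⟩
  · have e1 := h1 τ
    have e2 := h1' τ
    simp only [map_sub, LinearMap.sub_apply]
    linarith
  · simp only [map_sub, LinearMap.sub_apply, h2 v, h2' v, sub_self]

/-! ### Functions of the stochastic variable -/

section Stochastic
variable {N : ℕ} {Γ : Fin N → Set ℝ} (K : BoxPartition Γ) (q : Fin N → ℕ)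
  {ρ : (Fin N → ℝ) → ℝ}

/-- The open boxes of the partition. -/
def BoxPartition.cell (γ : Fin K.m) : Set (Fin N → ℝ) :=
  box fun n => Set.Ioo (K.lo γ n) (K.hi γ n)

/-- The union of the open boxes. -/
def BoxPartition.cells : Set (Fin N → ℝ) := ⋃ γ, K.cell γ

theorem BoxPartition.isOpen_cell (γ : Fin K.m) : IsOpen (K.cell γ) :=
  isOpen_set_pi Set.finite_univ fun _ _ => isOpen_Ioo

theorem BoxPartition.measurableSet_cells : MeasurableSet K.cells :=
  (isOpen_iUnion K.isOpen_cell).measurableSet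

theorem BoxPartition.cells_subset : K.cells ⊆ box Γ :=
  Set.iUnion_subset fun γ => Set.pi_mono fun n _ => K.subset γ n

/-- The set `box Γ` is not assumed measurable; up to a null set it is the union of the open boxes,
which is open. -/
theorem BoxPartition.restrict_eq :
    (volume : Measure (Fin N → ℝ)).restrict (box Γ) = volume.restrict K.cells :=
  Measure.restrict_congr_set
    ((ae_le_set.2 K.cover).antisymm K.cells_subset.eventuallyLE)

theorem BoxPartition.ae_mem_cells : ∀ᵐ y ∂(rhoMeasure Γ ρ), y ∈ K.cells := by
  have h : ∀ᵐ y ∂((volume : Measure (Fin N → ℝ)).restrict (box Γ)), y ∈ K.cells := by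
    rw [K.restrict_eq]
    exact ae_restrict_mem K.measurableSet_cells
  exact (withDensity_absolutelyContinuous _ _).ae_le h

include K in
theorem integral_rhoMeasure (hρ : AEMeasurable ρ (volume.restrict (box Γ)))
    (hρ0 : ∀ y ∈ box Γ, 0 ≤ ρ y) (F : (Fin N → ℝ) → ℝ) :
    ∫ y in box Γ, ρ y * F y = ∫ y, F y ∂(rhoMeasure Γ ρ) := by
  rw [rhoMeasure, integral_withDensity_eq_integral_toReal_smul₀ hρ.ennreal_ofReal
    (Filter.Eventually.of_forall fun _ => ENNReal.ofReal_lt_top)]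
  refine integral_congr_ae ?_
  rw [K.restrict_eq]
  filter_upwards [ae_restrict_mem K.measurableSet_cells] with y hy
  rw [ENNReal.toReal_ofReal (hρ0 y (K.cells_subset hy)), smul_eq_mul]

theorem isFiniteMeasure_rhoMeasure (h : ∫ y in box Γ, ρ y = 1) :
    IsFiniteMeasure (rhoMeasure Γ ρ) := by
  have hi : Integrable ρ (volume.restrict (box Γ)) := by
    -- The integral of a non-integrable function is 0 by convention, which contradicts the value 1.
    by_contra hn
    rw [integral_undef hn] at h
    exact zero_ne_one h
  exact isFiniteMeasure_withDensity_ofReal hi.2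

/-- The monomial `∏ yₙ ^ kₙ` on one box, extended by zero. -/
def cellMonomial (γ : Fin K.m) (k : ∀ n, Fin (q n + 1)) : (Fin N → ℝ) → ℝ :=
  (K.cell γ).indicator fun y => ∏ n, y n ^ (k n : ℕ)

/-- The functions of `y` that vanish on all boxes. -/
def zeroOnCells : Submodule ℝ ((Fin N → ℝ) → ℝ) where
  carrier := {φ | ∀ y ∈ K.cells, φ y = 0}
  add_mem' hφ hψ y hy := by simp [hφ y hy, hψ y hy]
  zero_mem' y _ := rfl
  smul_mem' r φ hφ y hy := by simp [hφ y hy]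

/-- The span of the monomials on the boxes. -/
def cellPolys : Submodule ℝ ((Fin N → ℝ) → ℝ) :=
  Submodule.span ℝ (Set.range fun i : (Fin K.m) × (∀ n, Fin (q n + 1)) => cellMonomial K q i.1 i.2)

theorem fg_cellPolys : (cellPolys K q).FG := Submodule.fg_span (Set.finite_range _)

/-- On each box a product of univariate polynomials expands into finitely many monomials; values off
the boxes are unconstrained and are absorbed by `zeroOnCells`. -/
theorem Y_le : Y K q ≤ cellPolys K q ⊔ zeroOnCells K := by
  refine Submodule.span_le.2 ?_
  rintro _ ⟨φ, hφ, rfl⟩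
  choose p hdeg hp using hφ
  have hmono : ∀ γ, ∀ y ∈ K.cell γ, ∏ n, φ n (y n) =
      ∑ k : ∀ n, Fin (q n + 1), (∏ n, (p n γ).coeff (k n)) * ∏ n, y n ^ (k n : ℕ) := by
    intro γ y hy
    have e : ∀ n, φ n (y n) = ∑ j : Fin (q n + 1), (p n γ).coeff j * y n ^ (j : ℕ) := by
      intro n
      rw [hp n γ (y n) (hy n (Set.mem_univ n)),
        Polynomial.eval_eq_sum_range' (Nat.lt_succ_of_le (hdeg n γ)), Finset.sum_range]
    simp only [e]
    rw [Finset.prod_univ_sum, Fintype.piFinset_univ]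
    simp only [Finset.prod_mul_distrib]
  set ψ : (Fin N → ℝ) → ℝ := ∑ γ, ∑ k : ∀ n, Fin (q n + 1),
    (∏ n, (p n γ).coeff (k n)) • cellMonomial K q γ k with hψ
  have hmem : ψ ∈ cellPolys K q := Submodule.sum_mem _ fun γ _ => Submodule.sum_mem _ fun k _ =>
    Submodule.smul_mem _ _ (Submodule.subset_span ⟨(γ, k), rfl⟩)
  refine Submodule.mem_sup.2 ⟨ψ, hmem, (fun y => ∏ n, φ n (y n)) - ψ, ?_, by simp⟩
  intro y hy
  obtain ⟨γ, hγ⟩ := Set.mem_iUnion.1 hy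
  have : ψ y = ∏ n, φ n (y n) := by
    rw [hψ, Finset.sum_apply, Finset.sum_eq_single γ, hmono γ y hγ, Finset.sum_apply]
    · exact Finset.sum_congr rfl fun k _ => by simp [cellMonomial, hγ]
    · intro γ' _ hne
      have hn : y ∉ K.cell γ' := fun h => Set.disjoint_left.1 (K.disjoint hne) h hγ
      simp [cellMonomial, hn]
    · simp
  simp [this]

theorem memLp_cellMonomial [IsFiniteMeasure (rhoMeasure Γ ρ)] (γ : Fin K.m)
    (k : ∀ n, Fin (q n + 1)) : MemLp (cellMonomial K q γ k) 2 (rhoMeasure Γ ρ) := by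
  have hc : Continuous fun y : Fin N → ℝ => ∏ n, y n ^ (k n : ℕ) := by fun_prop
  obtain ⟨C, hC⟩ := (isCompact_univ_pi fun n => (isCompact_Icc : IsCompact
    (Set.Icc (K.lo γ n) (K.hi γ n)))).exists_bound_of_continuousOn hc.continuousOn
  refine MemLp.of_bound (C := max C 0)
    (hc.stronglyMeasurable.indicator (K.isOpen_cell γ).measurableSet).aestronglyMeasurable ?_
  refine Filter.Eventually.of_forall fun y => ?_
  rw [cellMonomial]
  by_cases h : y ∈ K.cell γ
  · rw [Set.indicator_of_mem h]
    exact (hC y fun n hn => Set.Ioo_subset_Icc_self (h n hn)).trans (le_max_left _ _)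
  · rw [Set.indicator_of_notMem h]; simp

theorem memLp_of_mem_Y [IsFiniteMeasure (rhoMeasure Γ ρ)] {φ : (Fin N → ℝ) → ℝ} (hφ : φ ∈ Y K q) :
    MemLp φ 2 (rhoMeasure Γ ρ) := by
  obtain ⟨ψ, hψ, χ, hχ, rfl⟩ := Submodule.mem_sup.1 (Y_le K q hφ)
  have h1 : MemLp ψ 2 (rhoMeasure Γ ρ) := by
    clear hφ
    induction hψ using Submodule.span_induction with
    | mem x h => obtain ⟨i, rfl⟩ := h; exact memLp_cellMonomial K q _ _
    | zero => exact MemLp.zero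
    | add x y _ _ hx hy => exact hx.add hy
    | smul r x _ hx => exact hx.const_smul r
  have h2 : χ =ᵐ[rhoMeasure Γ ρ] 0 := by
    filter_upwards [K.ae_mem_cells] with y hy using hχ y hy
  exact h1.add (MemLp.zero.ae_eq h2.symm)

/-! ### Null fields -/

/-- The fields on a measure space that vanish almost everywhere. -/
def nullSpace {α : Type*} [MeasurableSpace α] (μ : Measure α) (V : Type*) [AddCommGroup V]
    [Module ℝ V] : Submodule ℝ (α → V) where
  carrier := {w | ∀ᵐ x ∂μ, w x = 0}
  add_mem' {v w} hv hw := by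
    change ∀ᵐ x ∂μ, v x = 0 at hv
    change ∀ᵐ x ∂μ, w x = 0 at hw
    change ∀ᵐ x ∂μ, v x + w x = 0
    filter_upwards [hv, hw] with x h1 h2
    rw [h1, h2, add_zero]
  zero_mem' := (Filter.Eventually.of_forall fun _ => rfl : ∀ᵐ _ ∂μ, (0 : V) = 0)
  smul_mem' r w hw := by
    change ∀ᵐ x ∂μ, w x = 0 at hw
    change ∀ᵐ x ∂μ, r • w x = 0
    filter_upwards [hw] with x h
    rw [h, smul_zero]

/-- The random fields that vanish almost everywhere. -/
def nullFields (π : Measure (Fin N → ℝ)) (μ : Measure Plane) (V : Type) [AddCommGroup V]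
    [Module ℝ V] : Submodule ℝ ((Fin N → ℝ) → Plane → V) where
  carrier := {F | ∀ᵐ y ∂π, ∀ᵐ x ∂μ, F y x = 0}
  add_mem' {v w} hv hw := by
    change ∀ᵐ y ∂π, ∀ᵐ x ∂μ, v y x = 0 at hv
    change ∀ᵐ y ∂π, ∀ᵐ x ∂μ, w y x = 0 at hw
    change ∀ᵐ y ∂π, ∀ᵐ x ∂μ, v y x + w y x = 0
    filter_upwards [hv, hw] with y h1 h2
    filter_upwards [h1, h2] with x g1 g2
    rw [g1, g2, add_zero]
  zero_mem' := (Filter.Eventually.of_forall fun _ => Filter.Eventually.of_forall fun _ => rfl :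
    ∀ᵐ _ ∂π, ∀ᵐ _ ∂μ, (0 : V) = 0)
  smul_mem' r w hw := by
    change ∀ᵐ y ∂π, ∀ᵐ x ∂μ, w y x = 0 at hw
    change ∀ᵐ y ∂π, ∀ᵐ x ∂μ, r • w y x = 0
    filter_upwards [hw] with y h
    filter_upwards [h] with x g
    rw [g, smul_zero]

/-- `φ(y) w(x)` as a bilinear map. -/
def tensorMap (N : ℕ) (V : Type) [AddCommGroup V] [Module ℝ V] :
    ((Fin N → ℝ) → ℝ) →ₗ[ℝ] (Plane → V) →ₗ[ℝ] ((Fin N → ℝ) → Plane → V) :=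
  LinearMap.mk₂ ℝ (fun φ w y x => φ y • w x)
    (fun φ φ' w => by ext y x; simp [add_smul]) (fun r φ w => by ext y x; simp [mul_smul])
    (fun φ w w' => by ext y x; simp) (fun r φ w => by ext y x; exact smul_comm _ _ _)

variable {V : Type} [AddCommGroup V] [Module ℝ V]

/-- Both factors are split into a finite-dimensional and a negligible part; every product with a
negligible factor is a null field. -/
theorem tensorSpace_le {X : Set (Plane → V)} {R : Submodule ℝ (Plane → V)} {μ : Measure Plane}
    (hX : ∀ w ∈ X, w ∈ R ⊔ nullSpace μ V) :
    tensorSpace K q X ≤ Submodule.map₂ (tensorMap N V) (cellPolys K q) R ⊔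
      nullFields (rhoMeasure Γ ρ) μ V := by
  refine Submodule.span_le.2 ?_
  rintro _ ⟨φ, hφ, w, hw, rfl⟩
  obtain ⟨φ₁, hφ₁, φ₂, hφ₂, rfl⟩ := Submodule.mem_sup.1 (Y_le K q hφ)
  obtain ⟨w₁, hw₁, w₂, hw₂, rfl⟩ := Submodule.mem_sup.1 (hX w hw)
  refine Submodule.mem_sup.2 ⟨tensorMap N V φ₁ w₁, Submodule.apply_mem_map₂ _ hφ₁ hw₁,
    tensorMap N V φ₁ w₂ + tensorMap N V φ₂ (w₁ + w₂), ?_, ?_⟩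
  · refine Submodule.add_mem _ ?_ ?_
    · change ∀ᵐ y ∂(rhoMeasure Γ ρ), ∀ᵐ x ∂μ, tensorMap N V φ₁ w₂ y x = 0
      refine Filter.Eventually.of_forall fun y => ?_
      have hw₂' : ∀ᵐ x ∂μ, w₂ x = 0 := hw₂
      filter_upwards [hw₂'] with x hx
      simp [tensorMap, hx]
    · change ∀ᵐ y ∂(rhoMeasure Γ ρ), ∀ᵐ x ∂μ, tensorMap N V φ₂ (w₁ + w₂) y x = 0
      filter_upwards [K.ae_mem_cells] with y hy
      refine Filter.Eventually.of_forall fun x => ?_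
      simp [tensorMap, hφ₂ y hy]
  · ext y x
    simp [tensorMap, add_smul]
    abel

theorem finite_tensorSpace_quotient {X : Set (Plane → V)} {R : Submodule ℝ (Plane → V)}
    {μ : Measure Plane} (hR : R.FG) (hX : ∀ w ∈ X, w ∈ R ⊔ nullSpace μ V) :
    Module.Finite ℝ (tensorSpace K q X ⧸
      (nullFields (rhoMeasure Γ ρ) μ V).comap (tensorSpace K q X).subtype) :=
  finite_quotient_comap ((fg_cellPolys K q).map₂ _ hR) (tensorSpace_le K q hX)

theorem slice_mem {K : BoxPartition Γ} {q : Fin N → ℕ} (X : Submodule ℝ (Plane → V)) {F : (Fin N → ℝ) → Plane → V}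
    (hF : F ∈ tensorSpace K q (X : Set (Plane → V))) (y : Fin N → ℝ) : F y ∈ X := by
  have : tensorSpace K q (X : Set (Plane → V)) ≤ X.comap (LinearMap.proj y) := by
    refine Submodule.span_le.2 ?_
    rintro _ ⟨φ, _, w, hw, rfl⟩
    exact X.smul_mem (φ y) hw
  exact this hF

/-! ### Square integrability and Fubini on the product of space and parameters. -/

theorem memLp_tensor {μ : Measure Plane} [SFinite μ] {π : Measure (Fin N → ℝ)} [SFinite π]
    {φ : (Fin N → ℝ) → ℝ} {w : Plane → ℝ} (hφ : MemLp φ 2 π) (hw : MemLp w 2 μ) :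
    MemLp (fun p : Plane × (Fin N → ℝ) => φ p.2 * w p.1) 2 (μ.prod π) := by
  refine (memLp_two_iff_integrable_sq (hφ.1.comp_snd.mul hw.1.comp_fst)).2 ?_
  have := hw.integrable_sq.mul_prod hφ.integrable_sq
  refine this.congr (Filter.Eventually.of_forall fun p => ?_)
  simp only [Pi.mul_apply]; ring

theorem memLp_of_mem_tensorSpace {K : BoxPartition Γ} {q : Fin N → ℕ}
    [IsFiniteMeasure (rhoMeasure Γ ρ)] {μ : Measure Plane} [SFinite μ]
    {X : Set (Plane → V)} (L : V →ₗ[ℝ] ℝ) (hX : ∀ w ∈ X, MemLp (fun x => L (w x)) 2 μ)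
    {F : (Fin N → ℝ) → Plane → V} (hF : F ∈ tensorSpace K q X) :
    MemLp (fun p : Plane × (Fin N → ℝ) => L (F p.2 p.1)) 2 (μ.prod (rhoMeasure Γ ρ)) := by
  induction hF using Submodule.span_induction with
  | mem x h =>
    obtain ⟨φ, hφ, w, hw, rfl⟩ := h
    simpa using memLp_tensor (memLp_of_mem_Y K q hφ) (hX w hw)
  | zero => simp
  | add x y _ _ hx hy =>
    refine (hx.add hy).ae_eq (Filter.Eventually.of_forall fun p => ?_)
    simp
  | smul r x _ hx =>
    refine (hx.const_smul r).ae_eq (Filter.Eventually.of_forall fun p => ?_)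
    simp

-- The forms are iterated integrals; as integrals of integrable functions over the product measure
-- they are visibly linear.
include K in
theorem integral_iterated (hρ : AEMeasurable ρ (volume.restrict (box Γ)))
    (hρ0 : ∀ y ∈ box Γ, 0 ≤ ρ y) [IsFiniteMeasure (rhoMeasure Γ ρ)] {μ : Measure Plane} [SFinite μ]
    {f : Plane → (Fin N → ℝ) → ℝ}
    (hf : Integrable (fun p : Plane × (Fin N → ℝ) => f p.1 p.2) (μ.prod (rhoMeasure Γ ρ))) :
    ∫ y in box Γ, ρ y * ∫ x, f x y ∂μ = ∫ p, f p.1 p.2 ∂(μ.prod (rhoMeasure Γ ρ)) := by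
  rw [integral_rhoMeasure K hρ hρ0, integral_prod_symm _ hf]

-- No joint measurability is required here: for almost every `y` the inner integral already
-- vanishes.
include K in
theorem integral_iterated_eq_zero (hρ : AEMeasurable ρ (volume.restrict (box Γ)))
    (hρ0 : ∀ y ∈ box Γ, 0 ≤ ρ y) {μ : Measure Plane} {f : Plane → (Fin N → ℝ) → ℝ}
    (hf : ∀ᵐ y ∂(rhoMeasure Γ ρ), ∀ᵐ x ∂μ, f x y = 0) :
    ∫ y in box Γ, ρ y * ∫ x, f x y ∂μ = 0 := by
  rw [integral_rhoMeasure K hρ hρ0]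
  refine integral_eq_zero_of_ae ?_
  filter_upwards [hf] with y hy
  exact integral_eq_zero_of_ae hy

end Stochastic

/-! ### The discrete spaces modulo null fields -/

section Spaces
variable {P : PolygonalDomain} (M : QuadMesh P.D)

theorem bilin_add (c c' : Fin 4 → Plane) (s t : ℝ) :
    bilin (c + c') s t = bilin c s t + bilin c' s t := by
  ext i; simp [bilin]; ring

theorem bilin_smul (r : ℝ) (c : Fin 4 → Plane) (s t : ℝ) :
    bilin (r • c) s t = r • bilin c s t := by
  ext i; simp [bilin]; ring

/-- `DisplSpaceH` as a subspace. -/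
def displSubmodule (P : PolygonalDomain) (M : QuadMesh P.D) : Submodule ℝ (Plane → Plane) where
  carrier := DisplSpaceH P M
  add_mem' := by
    rintro v w ⟨h1, h2, h3, h4⟩ ⟨g1, g2, g3, g4⟩
    refine ⟨h1.add g1, h2.add g2, ?_, fun T => ?_⟩
    · filter_upwards [h3, g3] with x hx gx
      rw [Pi.add_apply, hx, gx, add_zero]
    · obtain ⟨c, hc⟩ := h4 T
      obtain ⟨c', hc'⟩ := g4 T
      exact ⟨c + c', fun s hs t ht => by
        rw [Pi.add_apply, hc s hs t ht, hc' s hs t ht, bilin_add]⟩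
  zero_mem' := ⟨memH1_zero, continuousOn_const, Filter.Eventually.of_forall fun _ => rfl,
    fun T => ⟨0, fun s _ t _ => by simp [bilin]⟩⟩
  smul_mem' := by
    rintro r v ⟨h1, h2, h3, h4⟩
    refine ⟨h1.smul r, h2.const_smul r, ?_, fun T => ?_⟩
    · filter_upwards [h3] with x hx
      rw [Pi.smul_apply, hx, smul_zero]
    · obtain ⟨c, hc⟩ := h4 T
      exact ⟨r • c, fun s hs t ht => by rw [Pi.smul_apply, hc s hs t ht, bilin_smul]⟩

/-- `pwStress` as a linear map. -/
def pwStressL : (Fin M.m → Fin 5 → ℝ) →ₗ[ℝ] (Plane → Tensor) where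
  toFun := pwStress M
  map_add' := pwStress_add M
  map_smul' := pwStress_smul M

/-- The field with the given bilinear coefficients on each open element. -/
def pwDisplL : (Fin M.m → Fin 4 → Plane) →ₗ[ℝ] (Plane → Plane) where
  toFun c x := ∑ T, (M.el T).indicator (fun x => bilin (c T) (refInv (M.A T) x 0)
    (refInv (M.A T) x 1)) x
  map_add' c c' := by
    ext1 x
    simp only [Pi.add_apply, ← Finset.sum_add_distrib]
    refine Finset.sum_congr rfl fun T _ => ?_
    by_cases h : x ∈ M.el T <;> simp [h, bilin_add]
  map_smul' r c := by
    ext1 x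
    simp only [Pi.smul_apply, Finset.smul_sum]
    refine Finset.sum_congr rfl fun T _ => ?_
    by_cases h : x ∈ M.el T <;> simp [h, bilin_smul]

theorem pwDisplL_of_mem (c : Fin M.m → Fin 4 → Plane) {T : Fin M.m} {x : Plane} (hx : x ∈ M.el T) :
    pwDisplL M c x = bilin (c T) (refInv (M.A T) x 0) (refInv (M.A T) x 1) := by
  rw [pwDisplL, LinearMap.coe_mk, AddHom.coe_mk, Finset.sum_eq_single T, Set.indicator_of_mem hx]
  · intro T' _ hT
    exact Set.indicator_of_notMem (fun h => Set.disjoint_left.1 (M.disjoint_el hT) h hx) _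
  · simp

theorem mem_sup_nullSpace {V : Type*} [AddCommGroup V] [Module ℝ V] {R : Submodule ℝ (Plane → V)}
    {μ : Measure Plane} {w w' : Plane → V} (hw' : w' ∈ R) (h : ∀ᵐ x ∂μ, w x = w' x) :
    w ∈ R ⊔ nullSpace μ V := by
  refine Submodule.mem_sup.2 ⟨w', hw', w - w', ?_, by abel⟩
  change ∀ᵐ x ∂μ, w x - w' x = 0
  filter_upwards [h] with x hx using sub_eq_zero.2 hx

theorem stressSpaceH_subset (w : Plane → Tensor) (hw : w ∈ StressSpaceH P M) :
    w ∈ LinearMap.range (pwStressL M) ⊔ nullSpace (volume.restrict P.D) Tensor := by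
  obtain ⟨β, hβ⟩ := ae_eq_pwStress M hw
  exact mem_sup_nullSpace ⟨β, rfl⟩ hβ

/-- The range of `pwDisplL` also contains discontinuous fields, which is harmless because only an
upper bound on the dimension is needed. -/
theorem displSpaceH_subset (w : Plane → Plane) (hw : w ∈ DisplSpaceH P M) :
    w ∈ LinearMap.range (pwDisplL M) ⊔ nullSpace (volume.restrict P.D) Plane := by
  choose c hc using hw.2.2.2
  refine mem_sup_nullSpace ⟨c, rfl⟩ ?_
  filter_upwards [M.ae_mem_el] with x ⟨T, hT⟩
  rw [pwDisplL_of_mem M c hT]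
  have hm := refSquare_subset_closed (refInv_mem hT)
  have := hc T _ (hm 0) _ (hm 1)
  rwa [show quadMap (M.A T) (refInv (M.A T) x 0) (refInv (M.A T) x 1) = x from
    refMap_refInv hT] at this

theorem fg_range {E F : Type*} [AddCommGroup E] [Module ℝ E] [Module.Finite ℝ E] [AddCommGroup F]
    [Module ℝ F] (f : E →ₗ[ℝ] F) : (LinearMap.range f).FG :=
  Module.Finite.iff_fg.1 inferInstance

end Spaces

/-! ### The forms -/

theorem contract_add_left (σ σ' τ : Tensor) :
    contract (σ + σ') τ = contract σ τ + contract σ' τ := by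
  simp [contract, Fin.sum_univ_two]; ring

theorem contract_add_right (σ τ τ' : Tensor) :
    contract σ (τ + τ') = contract σ τ + contract σ τ' := by
  simp [contract, Fin.sum_univ_two]; ring

theorem contract_smul_left (r : ℝ) (σ τ : Tensor) : contract (r • σ) τ = r * contract σ τ := by
  simp [contract, Fin.sum_univ_two]; ring

theorem contract_smul_right (r : ℝ) (σ τ : Tensor) : contract σ (r • τ) = r * contract σ τ := by
  simp [contract, Fin.sum_univ_two]; ring

theorem contract_zero_left (τ : Tensor) : contract 0 τ = 0 := by simp [contract]

theorem contract_zero_right (σ : Tensor) : contract σ 0 = 0 := by simp [contract]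

theorem compliance_add (μ lam : ℝ) (τ τ' : Tensor) :
    compliance μ lam (τ + τ') = compliance μ lam τ + compliance μ lam τ' := by
  simp only [compliance, Matrix.trace_add, mul_add, add_smul, ← smul_add]
  congr 1; abel

theorem compliance_smul (μ lam r : ℝ) (τ : Tensor) :
    compliance μ lam (r • τ) = r • compliance μ lam τ := by
  ext i j
  simp [compliance, Matrix.trace_smul]; ring

theorem compliance_zero (μ lam : ℝ) : compliance μ lam 0 = 0 := by
  simp [compliance]

theorem contract_self_nonneg (σ : Tensor) : 0 ≤ contract σ σ :=
  Finset.sum_nonneg fun _ _ => Finset.sum_nonneg fun _ _ => mul_self_nonneg _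

theorem eq_zero_of_contract_self {σ : Tensor} (h : contract σ σ = 0) : σ = 0 := by
  ext i j
  have h1 := (Finset.sum_eq_zero_iff_of_nonneg fun i _ =>
    Finset.sum_nonneg fun j _ => mul_self_nonneg (σ i j)).1 h i (Finset.mem_univ i)
  exact mul_self_eq_zero.1 ((Finset.sum_eq_zero_iff_of_nonneg fun j _ =>
    mul_self_nonneg (σ i j)).1 h1 j (Finset.mem_univ j))

/-- The constant is the eigenvalue of the stiffness on multiples of the identity. The remainder is
`lam / μ` times the squared norm of the deviator, hence nonnegative. -/
theorem contract_self_le {μ lam : ℝ} (hμ : 0 < μ) (hlam : 0 < lam) (σ : Tensor) :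
    contract σ σ ≤ (2 * μ + 2 * lam) * contract σ (compliance μ lam σ) := by
  have e : (2 * μ + 2 * lam) * contract σ (compliance μ lam σ) = contract σ σ +
      lam / (2 * μ) * ((σ 0 0 - σ 1 1) ^ 2 + 2 * σ 0 1 ^ 2 + 2 * σ 1 0 ^ 2) := by
    have : 2 * μ + 2 * lam ≠ 0 := by positivity
    have : μ + lam ≠ 0 := by positivity
    simp [contract, compliance, Fin.sum_univ_two, Matrix.trace]
    field_simp
    ring
  rw [e]
  have : 0 ≤ lam / (2 * μ) * ((σ 0 0 - σ 1 1) ^ 2 + 2 * σ 0 1 ^ 2 + 2 * σ 1 0 ^ 2) := by positivity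
  linarith

section Forms
variable {P : PolygonalDomain} {M : QuadMesh P.D} {N : ℕ} {Γ : Fin N → Set ℝ}
  {K : BoxPartition Γ} {q : Fin N → ℕ} {ρ : (Fin N → ℝ) → ℝ}

theorem memLp_stress [IsFiniteMeasure (rhoMeasure Γ ρ)] {σ : (Fin N → ℝ) → Plane → Tensor}
    (hσ : σ ∈ tensorSpace K q (StressSpaceH P M)) (i j : Fin 2) :
    MemLp (fun p : Plane × (Fin N → ℝ) => σ p.2 p.1 i j) 2
      ((volume.restrict P.D).prod (rhoMeasure Γ ρ)) :=
  memLp_of_mem_tensorSpace (Matrix.entryLinearMap ℝ ℝ i j) (fun _ hw => hw.1.1 i j) hσ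

theorem memLp_compliance {α : Type*} [MeasurableSpace α] {m : Measure α} (μ lam : ℝ)
    {τ : α → Tensor} (hτ : ∀ i j, MemLp (fun x => τ x i j) 2 m) (i j : Fin 2) :
    MemLp (fun x => compliance μ lam (τ x) i j) 2 m := by
  have h : MemLp (fun x => 1 / (2 * μ) * (τ x i j - lam / (2 * μ + 2 * lam) *
      (1 : Tensor) i j * (τ x 0 0 + τ x 1 1))) 2 m :=
    ((hτ i j).sub (((hτ 0 0).add (hτ 1 1)).const_mul _)).const_mul _
  refine h.ae_eq (Filter.Eventually.of_forall fun x => ?_)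
  simp only [compliance, Matrix.trace, Fin.sum_univ_two, Matrix.smul_apply, Matrix.sub_apply,
    Matrix.diag_apply, smul_eq_mul]
  ring

theorem memLp_symPart {α : Type*} [MeasurableSpace α] {m : Measure α}
    {τ : α → Tensor} (hτ : ∀ i j, MemLp (fun x => τ x i j) 2 m) (i j : Fin 2) :
    MemLp (fun x => symPart (τ x) i j) 2 m :=
  ((hτ i j).add (hτ j i)).const_mul (1 / 2)

theorem symPart_add (G H : Tensor) : symPart (G + H) = symPart G + symPart H := by
  ext i j; simp [symPart_apply]; ring

theorem symPart_smul (r : ℝ) (G : Tensor) : symPart (r • G) = r • symPart G := by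
  ext i j; simp [symPart_apply]; ring

/-! #### The elastic energy -/

section A
variable {EN : Plane → (Fin N → ℝ) → ℝ} {eMin eMax : ℝ} (μ lam : ℝ)

theorem integrable_aForm [IsFiniteMeasure (rhoMeasure Γ ρ)] (he : 0 < eMin)
    (hEm : AEStronglyMeasurable (fun p : Plane × (Fin N → ℝ) => EN p.1 p.2)
      ((volume.restrict P.D).prod (rhoMeasure Γ ρ)))
    (hE : ∀ᵐ p ∂((volume.restrict P.D).prod (rhoMeasure Γ ρ)),
      eMin ≤ EN p.1 p.2 ∧ EN p.1 p.2 ≤ eMax)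
    {σ τ : (Fin N → ℝ) → Plane → Tensor} (hσ : σ ∈ tensorSpace K q (StressSpaceH P M))
    (hτ : τ ∈ tensorSpace K q (StressSpaceH P M)) :
    Integrable (fun p : Plane × (Fin N → ℝ) => 1 / EN p.1 p.2 *
      contract (σ p.2 p.1) (compliance μ lam (τ p.2 p.1)))
      ((volume.restrict P.D).prod (rhoMeasure Γ ρ)) := by
  have h := integrable_contract (memLp_stress (ρ := ρ) hσ)
    (memLp_compliance μ lam (memLp_stress (ρ := ρ) hτ))
  refine h.bdd_mul (c := 1 / eMin) ?_ ?_
  · simp only [one_div]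
    exact hEm.aemeasurable.inv.aestronglyMeasurable
  · filter_upwards [hE] with p hp
    rw [Real.norm_eq_abs, abs_of_pos (one_div_pos.2 (he.trans_le hp.1))]
    exact one_div_le_one_div_of_le he hp.1

theorem aForm_eq [IsFiniteMeasure (rhoMeasure Γ ρ)]
    (hρ : AEMeasurable ρ (volume.restrict (box Γ))) (hρ0 : ∀ y ∈ box Γ, 0 ≤ ρ y) (he : 0 < eMin)
    (hEm : AEStronglyMeasurable (fun p : Plane × (Fin N → ℝ) => EN p.1 p.2)
      ((volume.restrict P.D).prod (rhoMeasure Γ ρ)))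
    (hE : ∀ᵐ p ∂((volume.restrict P.D).prod (rhoMeasure Γ ρ)),
      eMin ≤ EN p.1 p.2 ∧ EN p.1 p.2 ≤ eMax)
    {σ τ : (Fin N → ℝ) → Plane → Tensor} (hσ : σ ∈ tensorSpace K q (StressSpaceH P M))
    (hτ : τ ∈ tensorSpace K q (StressSpaceH P M)) :
    aForm P μ lam Γ ρ EN σ τ = ∫ p : Plane × (Fin N → ℝ), 1 / EN p.1 p.2 *
      contract (σ p.2 p.1) (compliance μ lam (τ p.2 p.1))
      ∂((volume.restrict P.D).prod (rhoMeasure Γ ρ)) :=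
  integral_iterated K hρ hρ0
    (f := fun x y => 1 / EN x y * contract (σ y x) (compliance μ lam (τ y x)))
    (integrable_aForm μ lam he hEm hE hσ hτ)

/-- `aForm` as a bilinear form. -/
def aFormL (K : BoxPartition Γ) (q : Fin N → ℕ) (M : QuadMesh P.D)
    [IsFiniteMeasure (rhoMeasure Γ ρ)]
    (hρ : AEMeasurable ρ (volume.restrict (box Γ))) (hρ0 : ∀ y ∈ box Γ, 0 ≤ ρ y) (he : 0 < eMin)
    (hEm : AEStronglyMeasurable (fun p : Plane × (Fin N → ℝ) => EN p.1 p.2)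
      ((volume.restrict P.D).prod (rhoMeasure Γ ρ)))
    (hE : ∀ᵐ p ∂((volume.restrict P.D).prod (rhoMeasure Γ ρ)),
      eMin ≤ EN p.1 p.2 ∧ EN p.1 p.2 ≤ eMax) :
    tensorSpace K q (StressSpaceH P M) →ₗ[ℝ] tensorSpace K q (StressSpaceH P M) →ₗ[ℝ] ℝ :=
  LinearMap.mk₂ ℝ (fun σ τ => aForm P μ lam Γ ρ EN σ τ)
    (fun σ σ' τ => by
      rw [aForm_eq μ lam hρ hρ0 he hEm hE (σ + σ').2 τ.2, aForm_eq μ lam hρ hρ0 he hEm hE σ.2 τ.2,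
        aForm_eq μ lam hρ hρ0 he hEm hE σ'.2 τ.2,
        ← integral_add (integrable_aForm μ lam he hEm hE σ.2 τ.2)
          (integrable_aForm μ lam he hEm hE σ'.2 τ.2)]
      simp [contract_add_left, mul_add])
    (fun r σ τ => by
      rw [aForm_eq μ lam hρ hρ0 he hEm hE (r • σ).2 τ.2, aForm_eq μ lam hρ hρ0 he hEm hE σ.2 τ.2,
        smul_eq_mul, ← integral_const_mul]
      simp [contract_smul_left, mul_left_comm])
    (fun σ τ τ' => by
      rw [aForm_eq μ lam hρ hρ0 he hEm hE σ.2 (τ + τ').2, aForm_eq μ lam hρ hρ0 he hEm hE σ.2 τ.2,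
        aForm_eq μ lam hρ hρ0 he hEm hE σ.2 τ'.2,
        ← integral_add (integrable_aForm μ lam he hEm hE σ.2 τ.2)
          (integrable_aForm μ lam he hEm hE σ.2 τ'.2)]
      simp [contract_add_right, compliance_add, mul_add])
    (fun r σ τ => by
      rw [aForm_eq μ lam hρ hρ0 he hEm hE σ.2 (r • τ).2, aForm_eq μ lam hρ hρ0 he hEm hE σ.2 τ.2,
        smul_eq_mul, ← integral_const_mul]
      simp [contract_smul_right, compliance_smul, mul_left_comm])

theorem mem_nullFields_of_ae {π : Measure (Fin N → ℝ)} [SFinite π] {m : Measure Plane} [SFinite m]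
    {V : Type} [AddCommGroup V] [Module ℝ V] {F : (Fin N → ℝ) → Plane → V}
    (h : ∀ᵐ p ∂(m.prod π), F p.2 p.1 = 0) : F ∈ nullFields π m V := by
  have h2 : ∀ᵐ p ∂(π.prod m), F p.1 p.2 = 0 :=
    (Measure.measurePreserving_swap (μ := π) (ν := m)).quasiMeasurePreserving.ae h
  exact Measure.ae_ae_of_ae_prod h2

theorem mem_nullFields_of_aForm [IsFiniteMeasure (rhoMeasure Γ ρ)] {μ lam : ℝ} (hμ : 0 < μ)
    (hlam : 0 < lam)
    (hρ : AEMeasurable ρ (volume.restrict (box Γ))) (hρ0 : ∀ y ∈ box Γ, 0 ≤ ρ y) (he : 0 < eMin)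
    (hEm : AEStronglyMeasurable (fun p : Plane × (Fin N → ℝ) => EN p.1 p.2)
      ((volume.restrict P.D).prod (rhoMeasure Γ ρ)))
    (hE : ∀ᵐ p ∂((volume.restrict P.D).prod (rhoMeasure Γ ρ)),
      eMin ≤ EN p.1 p.2 ∧ EN p.1 p.2 ≤ eMax)
    {σ : (Fin N → ℝ) → Plane → Tensor} (hσ : σ ∈ tensorSpace K q (StressSpaceH P M))
    (h0 : aForm P μ lam Γ ρ EN σ σ = 0) :
    σ ∈ nullFields (rhoMeasure Γ ρ) (volume.restrict P.D) Tensor := by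
  have hc : ∀ τ : Tensor, 0 ≤ contract τ (compliance μ lam τ) := fun τ =>
    nonneg_of_mul_nonneg_right ((contract_self_nonneg τ).trans (contract_self_le hμ hlam τ))
      (by positivity)
  rw [aForm_eq μ lam hρ hρ0 he hEm hE hσ hσ, integral_eq_zero_iff_of_nonneg_ae ?_
    (integrable_aForm μ lam he hEm hE hσ hσ)] at h0
  · refine mem_nullFields_of_ae ?_
    filter_upwards [h0, hE] with p h1 h2
    have hEp : 1 / EN p.1 p.2 ≠ 0 := (one_div_pos.2 (he.trans_le h2.1)).ne'
    have h3 := (mul_eq_zero.1 h1).resolve_left hEp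
    have h4 := contract_self_le hμ hlam (σ p.2 p.1)
    rw [h3, mul_zero] at h4
    exact eq_zero_of_contract_self (le_antisymm h4 (contract_self_nonneg _))
  · filter_upwards [hE] with p hp
    exact mul_nonneg (one_div_pos.2 (he.trans_le hp.1)).le (hc _)

end A
end Forms

section Forms
variable {P : PolygonalDomain} {M : QuadMesh P.D} {N : ℕ} {Γ : Fin N → Set ℝ}
  {K : BoxPartition Γ} {q : Fin N → ℕ} {ρ : (Fin N → ℝ) → ℝ}

/-! #### The coupling form -/

theorem memH1_slice {u : (Fin N → ℝ) → Plane → Plane}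
    (hu : u ∈ tensorSpace K q (DisplSpaceH P M)) (y : Fin N → ℝ) : MemH1 P.D (u y) :=
  (slice_mem (displSubmodule P M) hu y).1

theorem integral_contract_strain_eq {τ : Plane → Tensor} {v : Plane → Plane} {G : Plane → Tensor}
    (hG : IsWeakGradient P.D v G) :
    ∫ x in P.D, contract (τ x) (strain P.D v x) = ∫ x in P.D, contract (τ x) (symPart (G x)) := by
  refine integral_congr_ae ?_
  filter_upwards [hG.ae_strain P.isOpen] with x hx
  rw [hx]

/-- `weakGradient` is chosen separately for each slice `u y`, so its measurability in `(x, y)` is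
unknown. Building a gradient along the span from products `φ(y) ∇w(x)` provides a jointly square
integrable one. -/
theorem exists_joint_gradient [IsFiniteMeasure (rhoMeasure Γ ρ)] {u : (Fin N → ℝ) → Plane → Plane}
    (hu : u ∈ tensorSpace K q (DisplSpaceH P M)) :
    ∃ G : (Fin N → ℝ) → Plane → Tensor, (∀ y, IsWeakGradient P.D (u y) (G y)) ∧
      ∀ i j, MemLp (fun p : Plane × (Fin N → ℝ) => G p.2 p.1 i j) 2
        ((volume.restrict P.D).prod (rhoMeasure Γ ρ)) := by
  induction hu using Submodule.span_induction with
  | mem x h =>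
    obtain ⟨φ, hφ, w, hw, rfl⟩ := h
    have hG := isWeakGradient_weakGradient hw.1
    exact ⟨fun y => φ y • weakGradient P.D w, fun y => hG.smul (φ y), fun i j =>
      memLp_tensor (memLp_of_mem_Y K q hφ) (hG.1 i j)⟩
  | zero => exact ⟨0, fun y => isWeakGradient_zero, fun i j => by simp⟩
  | add u u' hu hu' h h' =>
    obtain ⟨G, h1, h2⟩ := h
    obtain ⟨G', h1', h2'⟩ := h'
    exact ⟨G + G', fun y => (h1 y).add (memH1_slice hu y).1 (memH1_slice hu' y).1 (h1' y),
      fun i j => (h2 i j).add (h2' i j)⟩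
  | smul r u hu h =>
    obtain ⟨G, h1, h2⟩ := h
    exact ⟨r • G, fun y => (h1 y).smul r, fun i j => (h2 i j).const_smul r⟩

theorem integrable_bForm [IsFiniteMeasure (rhoMeasure Γ ρ)]
    {τ G : (Fin N → ℝ) → Plane → Tensor} (hτ : τ ∈ tensorSpace K q (StressSpaceH P M))
    (hG : ∀ i j, MemLp (fun p : Plane × (Fin N → ℝ) => G p.2 p.1 i j) 2
        ((volume.restrict P.D).prod (rhoMeasure Γ ρ))) :
    Integrable (fun p : Plane × (Fin N → ℝ) => contract (τ p.2 p.1) (symPart (G p.2 p.1)))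
      ((volume.restrict P.D).prod (rhoMeasure Γ ρ)) :=
  integrable_contract (memLp_stress hτ) (memLp_symPart hG)

theorem bForm_eq [IsFiniteMeasure (rhoMeasure Γ ρ)]
    (hρ : AEMeasurable ρ (volume.restrict (box Γ))) (hρ0 : ∀ y ∈ box Γ, 0 ≤ ρ y)
    {τ G : (Fin N → ℝ) → Plane → Tensor} (hτ : τ ∈ tensorSpace K q (StressSpaceH P M))
    {u : (Fin N → ℝ) → Plane → Plane} (hG1 : ∀ y, IsWeakGradient P.D (u y) (G y))
    (hG : ∀ i j, MemLp (fun p : Plane × (Fin N → ℝ) => G p.2 p.1 i j) 2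
        ((volume.restrict P.D).prod (rhoMeasure Γ ρ))) :
    bForm P Γ ρ τ u = ∫ p : Plane × (Fin N → ℝ), contract (τ p.2 p.1) (symPart (G p.2 p.1))
      ∂((volume.restrict P.D).prod (rhoMeasure Γ ρ)) := by
  rw [bForm, ← integral_iterated K hρ hρ0 (f := fun x y => contract (τ y x) (symPart (G y x)))
    (integrable_bForm hτ hG)]
  simp only [fun y => integral_contract_strain_eq (τ := τ y) (hG1 y)]

/-- `bForm` as a bilinear form. -/
def bFormL (K : BoxPartition Γ) (q : Fin N → ℕ) (M : QuadMesh P.D)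
    [IsFiniteMeasure (rhoMeasure Γ ρ)]
    (hρ : AEMeasurable ρ (volume.restrict (box Γ))) (hρ0 : ∀ y ∈ box Γ, 0 ≤ ρ y) :
    tensorSpace K q (StressSpaceH P M) →ₗ[ℝ] tensorSpace K q (DisplSpaceH P M) →ₗ[ℝ] ℝ :=
  LinearMap.mk₂ ℝ (fun τ u => bForm P Γ ρ τ u)
    (fun τ τ' u => by
      obtain ⟨G, hG1, hG2⟩ := exists_joint_gradient (ρ := ρ) u.2
      rw [bForm_eq hρ hρ0 (τ + τ').2 hG1 hG2, bForm_eq hρ hρ0 τ.2 hG1 hG2,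
        bForm_eq hρ hρ0 τ'.2 hG1 hG2,
        ← integral_add (integrable_bForm τ.2 hG2) (integrable_bForm τ'.2 hG2)]
      simp [contract_add_left])
    (fun r τ u => by
      obtain ⟨G, hG1, hG2⟩ := exists_joint_gradient (ρ := ρ) u.2
      rw [bForm_eq hρ hρ0 (r • τ).2 hG1 hG2, bForm_eq hρ hρ0 τ.2 hG1 hG2, smul_eq_mul,
        ← integral_const_mul]
      simp [contract_smul_left])
    (fun τ u u' => by
      obtain ⟨G, hG1, hG2⟩ := exists_joint_gradient (ρ := ρ) u.2
      obtain ⟨G', hG1', hG2'⟩ := exists_joint_gradient (ρ := ρ) u'.2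
      rw [bForm_eq hρ hρ0 (G := G + G') (u := (u + u').1) τ.2
        (fun y => (hG1 y).add (memH1_slice u.2 y).1 (memH1_slice u'.2 y).1 (hG1' y))
        (fun i j => (hG2 i j).add (hG2' i j)), bForm_eq hρ hρ0 τ.2 hG1 hG2,
        bForm_eq hρ hρ0 τ.2 hG1' hG2',
        ← integral_add (integrable_bForm τ.2 hG2) (integrable_bForm τ.2 hG2')]
      simp [contract_add_right, symPart_add])
    (fun r τ u => by
      obtain ⟨G, hG1, hG2⟩ := exists_joint_gradient (ρ := ρ) u.2
      rw [bForm_eq hρ hρ0 (G := r • G) (u := (r • u).1) τ.2 (fun y => (hG1 y).smul r)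
        (fun i j => (hG2 i j).const_smul r), bForm_eq hρ hρ0 τ.2 hG1 hG2, smul_eq_mul,
        ← integral_const_mul]
      simp [contract_smul_right, symPart_smul])

/-- Continuity up to the boundary carries the zeros to `D1`, which the area measure on `D` does not
see; this is why null displacements do no work against the traction. -/
theorem eqOn_zero_of_ae {v : Plane → Plane} (hv : v ∈ DisplSpaceH P M)
    (h : ∀ᵐ x ∂(volume.restrict P.D), v x = 0) : ∀ x ∈ closure P.D, v x = 0 := by
  have h1 : Set.EqOn v 0 P.D := Measure.eqOn_open_of_ae_eq h P.isOpen
    (hv.2.1.mono subset_closure) continuousOn_const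
  exact h1.of_subset_closure hv.2.1 continuousOn_const subset_closure subset_rfl

theorem ae_strain_eq_zero {v : Plane → Plane} (h : ∀ x ∈ closure P.D, v x = 0) :
    ∀ᵐ x ∂(volume.restrict P.D), strain P.D v x = 0 := by
  have hG : IsWeakGradient P.D v 0 := by
    refine ⟨fun i j => by simp, fun i j φ _ _ _ => ?_⟩
    have : ∫ x in P.D, v x i * fderiv ℝ φ x (EuclideanSpace.single j 1) = 0 := by
      refine setIntegral_eq_zero_of_forall_eq_zero fun x hx => ?_
      rw [h x (subset_closure hx)]; simp
    rw [this]; simp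
  filter_upwards [hG.ae_strain P.isOpen] with x hx
  rw [hx]; ext i j; simp [symPart_apply]

theorem ae_eqOn_zero {u : (Fin N → ℝ) → Plane → Plane}
    (hu : u ∈ tensorSpace K q (DisplSpaceH P M))
    (h0 : u ∈ nullFields (rhoMeasure Γ ρ) (volume.restrict P.D) Plane) :
    ∀ᵐ y ∂(rhoMeasure Γ ρ), ∀ x ∈ closure P.D, u y x = 0 := by
  have h : ∀ᵐ y ∂(rhoMeasure Γ ρ), ∀ᵐ x ∂(volume.restrict P.D), u y x = 0 := h0
  filter_upwards [h] with y hy using eqOn_zero_of_ae (slice_mem (displSubmodule P M) hu y) hy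

/-- On `φ(y) w(x)` the value is `φ(y)` times a number. The identity holds at every `y`, because the
integral over `D` ignores the choice of weak gradient. -/
theorem strainEnergy_mem_Y {τ : Plane → Tensor}
    (hτ : ∀ i j, MemLp (fun x => τ x i j) 2 (volume.restrict P.D))
    {u : (Fin N → ℝ) → Plane → Plane} (hu : u ∈ tensorSpace K q (DisplSpaceH P M)) :
    (fun y => ∫ x in P.D, contract (τ x) (strain P.D (u y) x)) ∈ Y K q := by
  induction hu using Submodule.span_induction with
  | mem x h =>
    obtain ⟨φ, hφ, w, hw, rfl⟩ := h
    have hG := isWeakGradient_weakGradient hw.1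
    have e : (fun y => ∫ x in P.D, contract (τ x) (strain P.D (fun x => φ y • w x) x)) =
        (∫ x in P.D, contract (τ x) (symPart (weakGradient P.D w x))) • φ := by
      funext y
      rw [integral_contract_strain_eq (v := fun x => φ y • w x) (hG.smul (φ y))]
      simp only [Pi.smul_apply, symPart_smul, contract_smul_right]
      rw [integral_const_mul, smul_eq_mul, mul_comm]
    rw [e]
    exact Submodule.smul_mem _ _ hφ
  | zero =>
    have e : (fun y : Fin N → ℝ => ∫ x in P.D, contract (τ x)
        (strain P.D ((0 : (Fin N → ℝ) → Plane → Plane) y) x)) = 0 := by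
      funext y
      rw [integral_contract_strain_eq (v := (0 : (Fin N → ℝ) → Plane → Plane) y)
        isWeakGradient_zero]
      simp [symPart, contract]
    rw [e]
    exact Submodule.zero_mem _
  | add u u' hu hu' h h' =>
    have e : (fun y => ∫ x in P.D, contract (τ x) (strain P.D ((u + u') y) x)) =
        (fun y => ∫ x in P.D, contract (τ x) (strain P.D (u y) x)) +
        (fun y => ∫ x in P.D, contract (τ x) (strain P.D (u' y) x)) := by
      funext y
      have hG := isWeakGradient_weakGradient (memH1_slice hu y)
      have hG' := isWeakGradient_weakGradient (memH1_slice hu' y)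
      rw [Pi.add_apply, Pi.add_apply, integral_contract_strain_eq
        (hG.add (memH1_slice hu y).1 (memH1_slice hu' y).1 hG'), integral_contract_strain_eq hG,
        integral_contract_strain_eq hG', ← integral_add
        (integrable_contract hτ (memLp_symPart hG.1))
        (integrable_contract hτ (memLp_symPart hG'.1))]
      simp [symPart_add, contract_add_right]
    rw [e]
    exact Submodule.add_mem _ h h'
  | smul r u hu h =>
    have e : (fun y => ∫ x in P.D, contract (τ x) (strain P.D ((r • u) y) x)) =
        r • (fun y => ∫ x in P.D, contract (τ x) (strain P.D (u y) x)) := by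
      funext y
      have hG := isWeakGradient_weakGradient (memH1_slice hu y)
      rw [Pi.smul_apply, Pi.smul_apply, integral_contract_strain_eq (hG.smul r),
        integral_contract_strain_eq hG, smul_eq_mul, ← integral_const_mul]
      simp [symPart_smul, contract_smul_right]
    rw [e]
    exact Submodule.smul_mem _ _ h

theorem ae_strainEnergy_eq_zero [IsFiniteMeasure (rhoMeasure Γ ρ)]
    (hρ : AEMeasurable ρ (volume.restrict (box Γ))) (hρ0 : ∀ y ∈ box Γ, 0 ≤ ρ y)
    {u : (Fin N → ℝ) → Plane → Plane} (hu : u ∈ tensorSpace K q (DisplSpaceH P M))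
    (h : ∀ τ ∈ tensorSpace K q (StressSpaceH P M), bForm P Γ ρ τ u = 0)
    {τ : Plane → Tensor} (hτ : τ ∈ StressSpaceH P M) :
    ∀ᵐ y ∂(rhoMeasure Γ ρ), ∫ x in P.D, contract (τ x) (strain P.D (u y) x) = 0 := by
  set c : (Fin N → ℝ) → ℝ := fun y => ∫ x in P.D, contract (τ x) (strain P.D (u y) x) with hc
  have hcY : c ∈ Y K q := strainEnergy_mem_Y hτ.1.1 hu
  -- Testing with `c ⊗ τ` turns the coupling form into the integral of `c²`.
  have hb := h (fun y x => c y • τ x) (Submodule.subset_span ⟨c, hcY, τ, hτ, rfl⟩)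
  simp only [bForm, contract_smul_left, integral_const_mul] at hb
  rw [integral_rhoMeasure K hρ hρ0 (fun y => c y * c y)] at hb
  have hi : Integrable (fun y => c y * c y) (rhoMeasure Γ ρ) :=
    (memLp_of_mem_Y K q hcY).integrable_mul (memLp_of_mem_Y K q hcY)
  rw [integral_eq_zero_iff_of_nonneg (fun y => mul_self_nonneg _) hi] at hb
  filter_upwards [hb] with y hy using mul_self_eq_zero.1 hy

/-- The parameters of the piecewise Pian-Sumihara stresses that satisfy the mean value condition. -/
def admissible (M : QuadMesh P.D) : Submodule ℝ (Fin M.m → Fin 5 → ℝ) where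
  carrier := {β | Measure.hausdorffMeasure (X := Plane) 1 P.D1 = 0 →
    totalEnergy M (fun T => quadCoeff (M.A T)) β = 0}
  add_mem' h h' h0 := by rw [map_add, h h0, h' h0, add_zero]
  zero_mem' _ := map_zero _
  smul_mem' r _ h h0 := by rw [map_smul, h h0, smul_zero]

/-- For each stress the orthogonality holds off a null set of `y` that depends on the stress.
Finitely many generators of `admissible M` give one common null set, off which the spatial result
applies to the slice. -/
theorem mem_nullFields_of_bForm [IsFiniteMeasure (rhoMeasure Γ ρ)]
    (hρ : AEMeasurable ρ (volume.restrict (box Γ))) (hρ0 : ∀ y ∈ box Γ, 0 ≤ ρ y)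
    {u : (Fin N → ℝ) → Plane → Plane} (hu : u ∈ tensorSpace K q (DisplSpaceH P M))
    (h : ∀ τ ∈ tensorSpace K q (StressSpaceH P M), bForm P Γ ρ τ u = 0) :
    u ∈ nullFields (rhoMeasure Γ ρ) (volume.restrict P.D) Plane := by
  obtain ⟨s, hs⟩ := IsNoetherian.noetherian (admissible M)
  have hae : ∀ᵐ y ∂(rhoMeasure Γ ρ), ∀ β ∈ s,
      ∫ x in P.D, contract (pwStress M β x) (strain P.D (u y) x) = 0 := by
    rw [Filter.eventually_all_finset]
    intro β hβ
    refine ae_strainEnergy_eq_zero hρ hρ0 hu h (pwStress_mem_stressSpaceH M fun h0 => ?_)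
    have hm : β ∈ admissible M := hs ▸ Submodule.subset_span hβ
    rw [integral_trace_pwStress]
    exact hm h0
  change ∀ᵐ y ∂(rhoMeasure Γ ρ), ∀ᵐ x ∂(volume.restrict P.D), u y x = 0
  filter_upwards [hae] with y hy
  have hv : u y ∈ DisplSpaceH P M := slice_mem (displSubmodule P M) hu y
  choose c hc using hv.2.2.2
  have hle : admissible M ≤ LinearMap.ker (totalEnergy M c) := by
    rw [← hs, Submodule.span_le]
    intro β hβ
    rw [SetLike.mem_coe, LinearMap.mem_ker, ← integral_pwStress_strain M β hv.1 hc]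
    exact hy β hβ
  have h0 := eq_zero_of_forall_integral_strain_eq_zero M hv fun β hβ => by
    rw [integral_pwStress_strain M β hv.1 hc]
    refine hle fun h0 => ?_
    rw [← integral_trace_pwStress]
    exact hβ.1.2.2 h0
  filter_upwards [ae_restrict_mem P.isOpen.measurableSet] with x hx using h0 x (subset_closure hx)

/-! #### The load -/

theorem integrable_inner_load {α : Type*} [MeasurableSpace α] {m : Measure α} {f v : α → Plane}
    (hf : MemLp f 2 m) (hv : ∀ i, MemLp (fun x => v x i) 2 m) :
    Integrable (fun x => inner ℝ (f x) (v x)) m := by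
  have h : Integrable (fun x => ∑ i, f x i * v x i) m :=
    integrable_finsetSum _ fun i _ => (memLp_coord hf i).integrable_mul (hv i)
  refine h.congr (Filter.Eventually.of_forall fun x => ?_)
  simp [PiLp.inner_apply, mul_comm]

theorem memLp_coord_interior {w : Plane → Plane} (hw : w ∈ DisplSpaceH P M) (i : Fin 2) :
    MemLp (fun x => w x i) 2 (volume.restrict P.D) := memLp_coord hw.1.1 i

theorem memLp_coord_boundary {w : Plane → Plane} (hw : w ∈ DisplSpaceH P M) (i : Fin 2) :
    MemLp (fun x => w x i) 2 ((Measure.hausdorffMeasure (X := Plane) 1).restrict P.D1) := by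
  have hc : ContinuousOn (fun x => w x i) (closure P.D) :=
    (EuclideanSpace.proj (𝕜 := ℝ) i).continuous.comp_continuousOn hw.2.1
  obtain ⟨C, hC⟩ := P.isCompact_closure.exists_bound_of_continuousOn hc
  refine MemLp.of_bound ((hc.mono P.D1_subset).aestronglyMeasurable P.measurable_D1) C ?_
  filter_upwards [ae_restrict_mem P.measurable_D1] with x hx using hC x (P.D1_subset hx)

theorem memLp_displ [IsFiniteMeasure (rhoMeasure Γ ρ)] {m : Measure Plane} [SFinite m]
    (hm : ∀ w ∈ DisplSpaceH P M, ∀ i, MemLp (fun x => w x i) 2 m)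
    {u : (Fin N → ℝ) → Plane → Plane} (hu : u ∈ tensorSpace K q (DisplSpaceH P M)) (i : Fin 2) :
    MemLp (fun p : Plane × (Fin N → ℝ) => u p.2 p.1 i) 2 (m.prod (rhoMeasure Γ ρ)) :=
  memLp_of_mem_tensorSpace ((EuclideanSpace.proj (𝕜 := ℝ) i : Plane →L[ℝ] ℝ) : Plane →ₗ[ℝ] ℝ)
    (fun w hw => hm w hw i) hu

/-- The work of a load against the discrete displacements. -/
def workL (K : BoxPartition Γ) (q : Fin N → ℕ) (M : QuadMesh P.D) [IsFiniteMeasure (rhoMeasure Γ ρ)]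
    (hρ : AEMeasurable ρ (volume.restrict (box Γ))) (hρ0 : ∀ y ∈ box Γ, 0 ≤ ρ y)
    (m : Measure Plane) [SFinite m] (hm : ∀ w ∈ DisplSpaceH P M, ∀ i, MemLp (fun x => w x i) 2 m)
    (f : Plane → (Fin N → ℝ) → Plane)
    (hf : MemLp (fun p : Plane × (Fin N → ℝ) => f p.1 p.2) 2 (m.prod (rhoMeasure Γ ρ))) :
    tensorSpace K q (DisplSpaceH P M) →ₗ[ℝ] ℝ where
  toFun v := ∫ y in box Γ, ρ y * ∫ x, inner ℝ (f x y) (v.1 y x) ∂m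
  map_add' u v := by
    have hu := integrable_inner_load hf (memLp_displ (ρ := ρ) hm u.2)
    have hv := integrable_inner_load hf (memLp_displ (ρ := ρ) hm v.2)
    rw [integral_iterated K hρ hρ0 (f := fun x y => inner ℝ (f x y) (u.1 y x)) hu,
      integral_iterated K hρ hρ0 (f := fun x y => inner ℝ (f x y) (v.1 y x)) hv,
      integral_iterated K hρ hρ0 (f := fun x y => inner ℝ (f x y) ((u + v).1 y x))
        (integrable_inner_load hf (memLp_displ (ρ := ρ) hm (u + v).2)), ← integral_add hu hv]
    simp [inner_add_right]
  map_smul' r u := by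
    have hu := integrable_inner_load hf (memLp_displ (ρ := ρ) hm u.2)
    rw [integral_iterated K hρ hρ0 (f := fun x y => inner ℝ (f x y) (u.1 y x)) hu,
      integral_iterated K hρ hρ0 (f := fun x y => inner ℝ (f x y) ((r • u).1 y x))
        (integrable_inner_load hf (memLp_displ (ρ := ρ) hm (r • u).2)), smul_eq_mul,
      ← integral_const_mul]
    simp [inner_smul_right]

end Forms
-- Existence and uniqueness for the discrete mixed problem.
/-- The discrete mixed problem has exactly one solution, up to null fields. The coupling form is
nondegenerate in the displacement on every mesh, so that no stability of the mesh is needed. -/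
theorem exists_unique_isDiscreteSolution
    (P : PolygonalDomain) (M : QuadMesh P.D)
    {μ lam : ℝ} (hμ : 0 < μ) (hlam : 0 < lam)
    (N : ℕ) (Γ : Fin N → Set ℝ)
    (K : BoxPartition Γ) (q : Fin N → ℕ)
    (ρ : (Fin N → ℝ) → ℝ)
    (hρ_meas : AEMeasurable ρ (volume.restrict (box Γ)))
    (hρ_nonneg : ∀ y ∈ box Γ, 0 ≤ ρ y)
    (hρ_one : ∫ y in box Γ, ρ y = 1)
    (EN : Plane → (Fin N → ℝ) → ℝ) (eMin eMax : ℝ) (he : 0 < eMin)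
    (hEN_meas : AEStronglyMeasurable (fun p : Plane × (Fin N → ℝ) => EN p.1 p.2)
      ((volume.restrict P.D).prod (rhoMeasure Γ ρ)))
    (hEN : ∀ᵐ p ∂((volume.restrict P.D).prod (rhoMeasure Γ ρ)),
      eMin ≤ EN p.1 p.2 ∧ EN p.1 p.2 ≤ eMax)
    (fN gN : Plane → (Fin N → ℝ) → Plane)
    (hfN : MemLp (fun p : Plane × (Fin N → ℝ) => fN p.1 p.2) 2
      ((volume.restrict P.D).prod (rhoMeasure Γ ρ)))
    (hgN : MemLp (fun p : Plane × (Fin N → ℝ) => gN p.1 p.2) 2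
      (((Measure.hausdorffMeasure 1).restrict P.D1).prod (rhoMeasure Γ ρ))) :
    ∃ (σ : (Fin N → ℝ) → Plane → Tensor)
      (u : (Fin N → ℝ) → Plane → Plane),
      IsDiscreteSolution P M μ lam K q ρ EN fN gN σ u ∧
      ∀ (σ' : (Fin N → ℝ) → Plane → Tensor)
        (u' : (Fin N → ℝ) → Plane → Plane),
        IsDiscreteSolution P M μ lam K q ρ EN fN gN σ' u' →
        ∀ᵐ y ∂(rhoMeasure Γ ρ), ∀ᵐ x ∂(volume.restrict P.D),
          σ' y x = σ y x ∧ u' y x = u y x := by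
  have hfin : IsFiniteMeasure (rhoMeasure Γ ρ) := isFiniteMeasure_rhoMeasure hρ_one
  have := finite_tensorSpace_quotient K q (ρ := ρ) (fg_range (pwStressL M)) (stressSpaceH_subset M)
  have := finite_tensorSpace_quotient K q (ρ := ρ) (fg_range (pwDisplL M)) (displSpaceH_subset M)
  obtain ⟨σ, u, ⟨h1, h2⟩, h3⟩ := exists_saddle
    (aFormL μ lam K q M hρ_meas hρ_nonneg he hEN_meas hEN)
    (bFormL K q M hρ_meas hρ_nonneg)
    (workL K q M hρ_meas hρ_nonneg (volume.restrict P.D) (fun _ hw => memLp_coord_interior hw) fN hfN +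
      workL K q M hρ_meas hρ_nonneg ((Measure.hausdorffMeasure (X := Plane) 1).restrict P.D1)
        (fun _ hw => memLp_coord_boundary hw) gN hgN)
    ((nullFields (rhoMeasure Γ ρ) (volume.restrict P.D) Tensor).comap
      (tensorSpace K q (StressSpaceH P M)).subtype)
    ((nullFields (rhoMeasure Γ ρ) (volume.restrict P.D) Plane).comap
      (tensorSpace K q (DisplSpaceH P M)).subtype)
    (fun σ hσ τ => by
      have hσ' : ∀ᵐ y ∂(rhoMeasure Γ ρ), ∀ᵐ x ∂(volume.restrict P.D), σ.1 y x = 0 := hσ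
      refine integral_iterated_eq_zero K hρ_meas hρ_nonneg
        (f := fun x y => 1 / EN x y * contract (σ.1 y x) (compliance _ lam (τ.1 y x))) ?_
      filter_upwards [hσ'] with y hy
      filter_upwards [hy] with x hx
      rw [hx, contract_zero_left, mul_zero])
    (fun σ τ hτ => by
      have hτ' : ∀ᵐ y ∂(rhoMeasure Γ ρ), ∀ᵐ x ∂(volume.restrict P.D), τ.1 y x = 0 := hτ
      refine integral_iterated_eq_zero K hρ_meas hρ_nonneg
        (f := fun x y => 1 / EN x y * contract (σ.1 y x) (compliance _ lam (τ.1 y x))) ?_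
      filter_upwards [hτ'] with y hy
      filter_upwards [hy] with x hx
      rw [hx, compliance_zero, contract_zero_right, mul_zero])
    (fun τ hτ u => by
      have hτ' : ∀ᵐ y ∂(rhoMeasure Γ ρ), ∀ᵐ x ∂(volume.restrict P.D), τ.1 y x = 0 := hτ
      refine integral_iterated_eq_zero K hρ_meas hρ_nonneg
        (f := fun x y => contract (τ.1 y x) (strain P.D (u.1 y) x)) ?_
      filter_upwards [hτ'] with y hy
      filter_upwards [hy] with x hx
      rw [hx, contract_zero_left])
    (fun τ u hu => by
      refine integral_iterated_eq_zero K hρ_meas hρ_nonneg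
        (f := fun x y => contract (τ.1 y x) (strain P.D (u.1 y) x)) ?_
      filter_upwards [ae_eqOn_zero u.2 hu] with y hy
      filter_upwards [ae_strain_eq_zero hy] with x hx
      rw [hx, contract_zero_right])
    (fun u hu => by
      have e1 := integral_iterated_eq_zero K hρ_meas hρ_nonneg (μ := volume.restrict P.D)
        (f := fun x y => inner ℝ (fN x y) (u.1 y x)) (by
          filter_upwards [ae_eqOn_zero u.2 hu] with y hy
          filter_upwards [ae_restrict_mem P.isOpen.measurableSet] with x hx
          rw [hy x (subset_closure hx), inner_zero_right])
      have e2 := integral_iterated_eq_zero K hρ_meas hρ_nonneg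
        (μ := (Measure.hausdorffMeasure (X := Plane) 1).restrict P.D1)
        (f := fun x y => inner ℝ (gN x y) (u.1 y x)) (by
          filter_upwards [ae_eqOn_zero u.2 hu] with y hy
          filter_upwards [ae_restrict_mem P.measurable_D1] with x hx
          rw [hy x (P.D1_subset hx), inner_zero_right])
      exact (congrArg₂ (· + ·) e1 e2).trans (add_zero 0))
    (fun σ h0 => mem_nullFields_of_aForm hμ hlam hρ_meas hρ_nonneg he hEN_meas hEN σ.2 h0)
    (fun u h0 => mem_nullFields_of_bForm hρ_meas hρ_nonneg u.2 fun τ hτ => h0 ⟨τ, hτ⟩)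
  refine ⟨σ, u, ⟨σ.2, u.2, fun τ hτ => h1 ⟨τ, hτ⟩, fun v hv => h2 ⟨v, hv⟩⟩, ?_⟩
  rintro σ' u' ⟨hσ', hu', h1', h2'⟩
  obtain ⟨k1, k2⟩ := h3 ⟨σ', hσ'⟩ ⟨u', hu'⟩ (fun τ => h1' τ τ.2) (fun v => h2' v v.2)
  have k1' : ∀ᵐ y ∂(rhoMeasure Γ ρ), ∀ᵐ x ∂(volume.restrict P.D), σ' y x - σ.1 y x = 0 := k1
  have k2' : ∀ᵐ y ∂(rhoMeasure Γ ρ), ∀ᵐ x ∂(volume.restrict P.D), u' y x - u.1 y x = 0 := k2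
  filter_upwards [k1', k2'] with y g1 g2
  filter_upwards [g1, g2] with x f1 f2
  exact ⟨sub_eq_zero.1 f1, sub_eq_zero.1 f2⟩

end SHSFEM

end

theorem mainTheorem9
    (P : SHSFEM.PolygonalDomain) (M : SHSFEM.QuadMesh P.D)
    (hM : SHSFEM.Q1P0Stable P M)
    -- the elasticity tensor
    (ν lam : ℝ) (hν : 0 < ν) (hν' : ν < 1 / 2) (hlam : 0 < lam)
    -- the stochastic field
    (N : ℕ) (Γ : Fin N → Set ℝ) (hΓ : ∀ n, Bornology.IsBounded (Γ n))
    (K : SHSFEM.BoxPartition Γ) (q : Fin N → ℕ)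
    (ρ : (Fin N → ℝ) → ℝ)
    (hρ_meas : AEMeasurable ρ (volume.restrict (SHSFEM.box Γ)))
    (hρ_nonneg : ∀ y ∈ SHSFEM.box Γ, 0 ≤ ρ y)
    (hρ_bdd : ∃ B : ℝ, ∀ᵐ y ∂(volume.restrict (SHSFEM.box Γ)), ρ y ≤ B)
    (hρ_one : ∫ y in SHSFEM.box Γ, ρ y = 1)
    -- the coefficient and the loads
    (EN : SHSFEM.Plane → (Fin N → ℝ) → ℝ) (eMin eMax : ℝ) (he : 0 < eMin)
    (hEN_meas : AEStronglyMeasurable (fun p : SHSFEM.Plane × (Fin N → ℝ) => EN p.1 p.2)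
      ((volume.restrict P.D).prod (SHSFEM.rhoMeasure Γ ρ)))
    (hEN : ∀ᵐ p ∂((volume.restrict P.D).prod (SHSFEM.rhoMeasure Γ ρ)),
      eMin ≤ EN p.1 p.2 ∧ EN p.1 p.2 ≤ eMax)
    (fN gN : SHSFEM.Plane → (Fin N → ℝ) → SHSFEM.Plane)
    (hfN : MemLp (fun p : SHSFEM.Plane × (Fin N → ℝ) => fN p.1 p.2) 2
      ((volume.restrict P.D).prod (SHSFEM.rhoMeasure Γ ρ)))
    (hgN : MemLp (fun p : SHSFEM.Plane × (Fin N → ℝ) => gN p.1 p.2) 2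
      (((Measure.hausdorffMeasure 1).restrict P.D1).prod (SHSFEM.rhoMeasure Γ ρ))) :
    ∃ (σ : (Fin N → ℝ) → SHSFEM.Plane → SHSFEM.Tensor)
      (u : (Fin N → ℝ) → SHSFEM.Plane → SHSFEM.Plane),
      SHSFEM.IsDiscreteSolution P M (1 / (2 * (1 + ν))) lam K q ρ EN fN gN σ u ∧
      ∀ (σ' : (Fin N → ℝ) → SHSFEM.Plane → SHSFEM.Tensor)
        (u' : (Fin N → ℝ) → SHSFEM.Plane → SHSFEM.Plane),
        SHSFEM.IsDiscreteSolution P M (1 / (2 * (1 + ν))) lam K q ρ EN fN gN σ' u' →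
        ∀ᵐ y ∂(SHSFEM.rhoMeasure Γ ρ), ∀ᵐ x ∂(volume.restrict P.D),
          σ' y x = σ y x ∧ u' y x = u y x := by
  -- The stiffness carries the factor `2 * μ`, so `μ = 1 / (2 * (1 + ν))` reproduces the coefficient
  -- `1 / (1 + ν)`.
  exact SHSFEM.exists_unique_isDiscreteSolution P M (by positivity) hlam N Γ K q ρ hρ_meas hρ_nonneg hρ_one
    EN eMin eMax he hEN_meas hEN fN gN hfN hgN
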